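/- **Setting.** Fronts are oriented generic fronts in the $xz$-plane: closed oriented curves without vertical tangencies whose only singularities are left and right semicubical cusps and transverse double points, at pairwise distinct abscissas. They are encoded combinatorially, as words of left cusps, right cusps and double points read from left to right. The smoothed front is the oriented link diagram obtained by smoothing the cusps and letting the strand of smaller slope pass over the other one at each double point. *Legendrian isotopy* of fronts is the equivalence relation generated by planar isotopy of fronts and the three Legendrian Reidemeister moves. The self-linking number of a front $F$ is $\operatorname{sl}(F)=w(F)-c_\downarrow(F)$, where $w(F)$ is the writhe of the smoothed front and $c_\downarrow(F)$ is the number of cusps of $F$ that are traversed downwards. The HOMFLY-PT polynomial $P(L)(a,z)\in\mathbb Z[a^{\pm1},z^{\pm1}]$ is the invariant of oriented links (link diagrams up to planar isotopy and Reidemeister moves) with value $1$ on the unknot and $$aP(L_+)-a^{-1}P(L_-)=zP(L_0)$$ whenever $L_+,L_-,L_0$ differ only near one point, where they are a positive crossing, a negative crossing, and the oriented smoothing. The HOMFLY-PT polynomial bound is $\operatorname{sl}(F)\le-\operatorname{max-deg}_aP(F)-1$; it is *sharp for $F$* if $\operatorname{sl}(F)=-\operatorname{max-deg}_aP(F)-1$.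 *Skein relation for fronts.* Consider tangles made of one (left or right) cusp and one strand that lies, on the side where the cusp opens, between the two branches of the cusp at its far end, having crossed exactly one branch of the cusp. The strand crosses either the upper or the lower branch; with the induced orientations, one of these two tangles has a positive crossing and the other a negative one. Oriented smoothing of the crossing of the positive one gives a cusp disjoint from a strand. Three fronts $F_+,F_-,F_0$ which agree outside a disk and are there the positive tangle, the negative tangle and this smoothing are said to be related by the oriented skein relation. An *oriented skein tree* of a front $F$ is a finite rooted tree of fronts with root $F$, obtained by the following steps: replace a front by a Legendrian isotopic one; eliminate an upward zigzag (one whose two cusps are both traversed upwards) from a front; replace a front $F_+$ by the two fronts $F_-,F_0$, or a front $F_-$ by the two fronts $F_+,F_0$, where $F_+,F_-,F_0$ are related by the oriented skein relation. Each terminal leaf is either a positive stabilization (a front Legendrian isotopic to one with a zigzag whose two cusps are both traversed downwards) or a standard Legendrian unlink (a front Legendrian isotopic to a disjoint union of $n\ge1$ fronts with two cusps and no double points, i.e. standard $\operatorname{tb}=-1$ unknots). **Theorem 3.4.** Let $F$ be a front. If, for some oriented skein tree of $F$, the number of terminal leaves that are standard Legendrian unlinks is odd, then the HOMFLY-PT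 polynomial bound on $\operatorname{sl}$ is sharp for $F$, that is, $$\operatorname{sl}(F)=-\operatorname{max-deg}_aP(F)(a,z)-1 .$$ -/

import Mathlib

open scoped LaurentPolynomial

namespace LegendrianFront

/-! ### Oriented link diagrams in the plane

A diagram in general position is read from left to right. Away from finitely many
abscissas it is a stack of strands, listed from top to bottom; at each exceptional abscissa exactly
one elementary piece occurs. Directions of strands: `true` is rightward, `false` is leftward. -/

/-- The elementary pieces, decorated with the directions of the strands involved.
* `cup d`: a left extremum `⊂` (a left cusp, in a front); the upper strand has direction `d`,
  the lower one `!d`;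
* `cap d`: a right extremum `⊃` (a right cusp, in a front); the upper strand has direction `d`,
  the lower one `!d`;
* `cross x y s`: a crossing; on its left the upper strand has direction `x` and the lower strand
  has direction `y`. The strand of smaller slope, which descends from upper left to lower right,
  is the overstrand if `s = true` and the understrand if `s = false`. -/
inductive Piece : Type
  | cup (d : Bool)
  | cap (d : Bool)
  | cross (x y s : Bool)

namespace Piece

/-- Directions of the strands entering a piece on its left, from top to bottom. -/
def dom : Piece → List Bool
  | cup _ => []
  | cap d => [d, !d]
  | cross x y _ => [x, y]

/-- Directions of the strands on the right of a piece, from top to bottom. -/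
def cod : Piece → List Bool
  | cup d => [d, !d]
  | cap _ => []
  | cross x y _ => [y, x]

/-- The sign of a crossing, and `0` for the other pieces. When the descending strand is the
overstrand, a crossing is positive iff both strands have the same horizontal direction. -/
def sign : Piece → ℤ
  | cup _ => 0
  | cap _ => 0
  | cross x y s => if (x == y) = s then 1 else -1

/-- `1` for an extremum (cusp) that is traversed downwards, `0` for the other pieces. -/
def downCusp : Piece → ℤ
  | cup d => if d then 0 else 1
  | cap d => if d then 1 else 0
  | cross _ _ _ => 0

end Piece

/-- A piece together with its height: `pos` is the number of strands above it. -/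
structure Event : Type where
  pos : ℕ
  piece : Piece

/-- A left extremum at height `k`. -/
abbrev cup (k : ℕ) (d : Bool) : Event := ⟨k, .cup d⟩

/-- A right extremum at height `k`. -/
abbrev cap (k : ℕ) (d : Bool) : Event := ⟨k, .cap d⟩

/-- A crossing at height `k`. -/
abbrev cross (k : ℕ) (x y s : Bool) : Event := ⟨k, .cross x y s⟩

/-- `Runs a w b`: starting from the stack of strands `a`, the events of `w` can be performed
one after the other from left to right, consistently with all directions, and end in the stack of
strands `b`. -/
inductive Runs : List Bool → List Event → List Bool → Prop
  | nil (a : List Bool) : Runs a [] a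
  | cons (u v : List Bool) (p : Piece) (w : List Event) (b : List Bool) :
      Runs (u ++ p.cod ++ v) w b → Runs (u ++ p.dom ++ v) (⟨u.length, p⟩ :: w) b

/-- An oriented link diagram in general position. -/
structure Diagram : Type where
  word : List Event
  closed : Runs [] word []

/-- An (oriented, generic) front: its singularities are left cusps (`cup`), right cusps (`cap`)
and double points, at pairwise distinct abscissas, and at each double point the strand of smaller
slope is the overstrand. Smoothing out the cusps turns them into the extrema of
`toDiagram`, so `toDiagram` is the smoothed front. -/
structure Front extends Diagram where
  descending_over : ∀ (k : ℕ) (x y s : Bool), cross k x y s ∈ word → s = true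

/-- The front double point at height `k`. -/
abbrev dbl (k : ℕ) (x y : Bool) : Event := cross k x y true

/-! ### Classical invariants -/

/-- The writhe: the number of crossings counted with sign. -/
def Diagram.writhe (D : Diagram) : ℤ := (D.word.map fun e => e.piece.sign).sum

/-- The number of downward cusps of a front. -/
def Front.downCusps (F : Front) : ℤ := (F.word.map fun e => e.piece.downCusp).sum

/-- The self-linking number of a front. -/
def Front.sl (F : Front) : ℤ := F.toDiagram.writhe - F.downCusps

/-! ### Isotopy -/

/-- Pieces lying one above the other may be performed in either order. -/
inductive Exchange : List Event → List Event → Prop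
  | mk (k m : ℕ) (p q : Piece) :
      Exchange [⟨k, p⟩, ⟨k + p.cod.length + m, q⟩] [⟨k + p.dom.length + m, q⟩, ⟨k, p⟩]

/-- Local moves generating isotopy of oriented links, on diagrams in general position with respect
to the horizontal coordinate: planar isotopy (exchange, straightening of a zigzag, sliding an
extremum past a strand) and the Reidemeister moves. -/
inductive LinkMove : List Event → List Event → Prop
  | exchange (l r : List Event) : Exchange l r → LinkMove l r
  | straighten₁ (k : ℕ) (x : Bool) : LinkMove [cup k x, cap (k + 1) (!x)] []
  | straighten₂ (k : ℕ) (x : Bool) : LinkMove [cup (k + 1) (!x), cap k x] []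
  | slideCup₁ (k : ℕ) (d x s : Bool) :
      LinkMove [cup k d, cross (k + 1) (!d) x s, cross k d x s] [cup (k + 1) d]
  | slideCup₂ (k : ℕ) (d x s : Bool) :
      LinkMove [cup (k + 1) d, cross k x d s, cross (k + 1) x (!d) s] [cup k d]
  | slideCap₁ (k : ℕ) (d x s : Bool) :
      LinkMove [cross k x d s, cross (k + 1) x (!d) s, cap k d] [cap (k + 1) d]
  | slideCap₂ (k : ℕ) (d x s : Bool) :
      LinkMove [cross (k + 1) (!d) x s, cross k d x s, cap (k + 1) d] [cap k d]
  | reidemeister1Cup (k : ℕ) (d s : Bool) :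
      LinkMove [cup k d, cross k d (!d) s] [cup k (!d)]
  | reidemeister1Cap (k : ℕ) (d s : Bool) :
      LinkMove [cross k d (!d) s, cap k (!d)] [cap k d]
  | reidemeister2 (k : ℕ) (x y s : Bool) :
      LinkMove [cross k x y s, cross k y x (!s)] []
  /-- The hypothesis says that the overcrossings among the three strands are not cyclic. -/
  | reidemeister3 (k : ℕ) (x y t s₁₂ s₁₃ s₂₃ : Bool) :
      ¬ (s₁₂ = s₂₃ ∧ s₁₃ ≠ s₁₂) →
      LinkMove [cross k x y s₁₂, cross (k + 1) x t s₁₃, cross k y t s₂₃]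
        [cross (k + 1) y t s₂₃, cross k x t s₁₃, cross (k + 1) x y s₁₂]

/-- Two diagrams that differ by one local move. -/
def Diagram.Move (D E : Diagram) : Prop :=
  ∃ u l r v, LinkMove l r ∧ D.word = u ++ l ++ v ∧ E.word = u ++ r ++ v

/-- Isotopy of oriented links, on diagrams. -/
def Diagram.Isotopic : Diagram → Diagram → Prop := Relation.EqvGen Diagram.Move

/-- Local moves generating Legendrian isotopy, on generic fronts: planar isotopy of fronts and the
three Legendrian Reidemeister moves (with all their reflections). -/
inductive LegendrianMove : List Event → List Event → Prop
  | exchange (l r : List Event) : Exchange l r → LegendrianMove l r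
  | reidemeister1Above (k : ℕ) (x : Bool) :
      LegendrianMove [cup k (!x), dbl (k + 1) x x, cap k (!x)] []
  | reidemeister1Below (k : ℕ) (x : Bool) :
      LegendrianMove [cup (k + 1) x, dbl k x x, cap (k + 1) x] []
  | reidemeister2Left₁ (k : ℕ) (d x : Bool) :
      LegendrianMove [cup k d, dbl (k + 1) (!d) x, dbl k d x] [cup (k + 1) d]
  | reidemeister2Left₂ (k : ℕ) (d x : Bool) :
      LegendrianMove [cup (k + 1) d, dbl k x d, dbl (k + 1) x (!d)] [cup k d]
  | reidemeister2Right₁ (k : ℕ) (d x : Bool) :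
      LegendrianMove [dbl k x d, dbl (k + 1) x (!d), cap k d] [cap (k + 1) d]
  | reidemeister2Right₂ (k : ℕ) (d x : Bool) :
      LegendrianMove [dbl (k + 1) (!d) x, dbl k d x, cap (k + 1) d] [cap k d]
  | reidemeister3 (k : ℕ) (x y t : Bool) :
      LegendrianMove [dbl k x y, dbl (k + 1) x t, dbl k y t]
        [dbl (k + 1) y t, dbl k x t, dbl (k + 1) x y]

/-- Two fronts that differ by one local move. -/
def Front.Move (F G : Front) : Prop :=
  ∃ u l r v, LegendrianMove l r ∧ F.word = u ++ l ++ v ∧ G.word = u ++ r ++ v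

/-- Legendrian isotopy, on fronts. -/
def Front.Isotopic : Front → Front → Prop := Relation.EqvGen Front.Move

/-! ### The HOMFLY-PT polynomial -/

/-- The ring `ℤ[a, a⁻¹, z, z⁻¹]`, as Laurent polynomials in `a` over `ℤ[z, z⁻¹]`. -/
abbrev Coeff : Type := LaurentPolynomial (LaurentPolynomial ℤ)

/-- `a ^ n`. -/
noncomputable def aPow (n : ℤ) : Coeff := LaurentPolynomial.T n

/-- The variable `z`. -/
noncomputable def zVar : Coeff := LaurentPolynomial.C (LaurentPolynomial.T 1)

/-- A positive crossing, the negative crossing obtained from it by a crossing change, and their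
oriented smoothing. -/
inductive LocalSkein : List Event → List Event → List Event → Prop
  | parallel (k : ℕ) (x : Bool) :
      LocalSkein [cross k x x true] [cross k x x false] []
  | antiparallel (k : ℕ) (x : Bool) :
      LocalSkein [cross k x (!x) false] [cross k x (!x) true] [cap k x, cup k (!x)]

/-- Three diagrams that differ only near one point, where they are a positive crossing, a negative
crossing and the oriented smoothing. -/
def Diagram.SkeinTriple (Dp Dm D₀ : Diagram) : Prop :=
  ∃ u p m o v, LocalSkein p m o ∧
    Dp.word = u ++ p ++ v ∧ Dm.word = u ++ m ++ v ∧ D₀.word = u ++ o ++ v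

/-- The properties that characterize the HOMFLY-PT polynomial of (nonempty) oriented links. -/
structure IsHomfly (P : Diagram → Coeff) : Prop where
  isotopy : ∀ D E : Diagram, D.Isotopic E → P D = P E
  unknot : ∀ (D : Diagram) (d : Bool), D.word = [cup 0 d, cap 0 d] → P D = 1
  skein : ∀ Dp Dm D₀ : Diagram, Diagram.SkeinTriple Dp Dm D₀ →
    aPow 1 * P Dp - aPow (-1) * P Dm = zVar * P D₀

/-- The HOMFLY-PT polynomial: the invariant of oriented links that is `1` on the unknot and
satisfies `a P(positive) - a⁻¹ P(negative) = z P(smoothing)`. -/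
noncomputable def homfly : Diagram → Coeff := Classical.epsilon IsHomfly

/-- The HOMFLY-PT bound `sl ≤ - max-deg_a P - 1` is an equality for the front `F`
(`LaurentPolynomial.degree` is the maximal degree in the outer variable `a`, as an element of
`WithBot ℤ`). -/
def Front.HomflySharp (F : Front) : Prop :=
  (homfly F.toDiagram).degree = ((-F.sl - 1 : ℤ) : WithBot ℤ)

/-! ### Oriented skein trees -/

/-- Zigzags. At `zigzag down`, both cusps are traversed downwards if `down = true`, and both are
traversed upwards if `down = false`. -/
inductive Zigzag (down : Bool) : List Event → Prop
  | above (k : ℕ) : Zigzag down [cup k (!down), cap (k + 1) down]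
  | below (k : ℕ) : Zigzag down [cup (k + 1) (!down), cap k down]

/-- `F` has a zigzag at some place and `G` is the result of straightening it. -/
def Front.EliminatesZigzag (down : Bool) (F G : Front) : Prop :=
  ∃ u l v, Zigzag down l ∧ F.word = u ++ l ++ v ∧ G.word = u ++ v

/-- Positive stabilizations: fronts that are isotopic to a front with a downward zigzag. -/
def Front.IsPositiveStabilization (F : Front) : Prop :=
  ∃ G : Front, F.Isotopic G ∧ ∃ u l v, Zigzag true l ∧ G.word = u ++ l ++ v

/-- Standard Legendrian unlinks: fronts isotopic to a disjoint union of one or more fronts, each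
with one left cusp, one right cusp and no double point. -/
def Front.IsStandardUnlink (F : Front) : Prop :=
  ∃ G : Front, F.Isotopic G ∧
    ∃ ds : List Bool, ds ≠ [] ∧ G.word = ds.flatMap fun d => [cup 0 d, cap 0 d]

/-- The skein relation for oriented front tangles consisting of one cusp and one strand: the tangle
with a positive crossing, the one with a negative crossing (the strand crosses one branch of the
cusp in the first and the other branch in the second), and the oriented smoothing, a cusp disjoint
from a strand. For each orientation the smoothing is the one tangle, among
the two possible ones, which inherits an orientation. -/
inductive FrontLocalSkein : List Event → List Event → List Event → Prop
  | left₁ (k : ℕ) (d : Bool) :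
      FrontLocalSkein [cup k d, dbl (k + 1) (!d) (!d)] [cup (k + 1) d, dbl k (!d) d] [cup k d]
  | left₂ (k : ℕ) (d : Bool) :
      FrontLocalSkein [cup (k + 1) d, dbl k d d] [cup k d, dbl (k + 1) (!d) d] [cup (k + 1) d]
  | right₁ (k : ℕ) (d : Bool) :
      FrontLocalSkein [dbl (k + 1) (!d) (!d), cap k d] [dbl k d (!d), cap (k + 1) d] [cap k d]
  | right₂ (k : ℕ) (d : Bool) :
      FrontLocalSkein [dbl k d d, cap (k + 1) d] [dbl (k + 1) d (!d), cap k d] [cap (k + 1) d]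

/-- Three fronts related by the oriented skein relation (positive, negative, smoothing). -/
def Front.SkeinTriple (Fp Fm F₀ : Front) : Prop :=
  ∃ u p m o v, FrontLocalSkein p m o ∧
    Fp.word = u ++ p ++ v ∧ Fm.word = u ++ m ++ v ∧ F₀.word = u ++ o ++ v

/-- Oriented skein trees of a front. -/
inductive OrientedSkeinTree : Front → Type
  /-- A terminal leaf: a standard Legendrian unlink. -/
  | unlinkLeaf (F : Front) : F.IsStandardUnlink → OrientedSkeinTree F
  /-- A terminal leaf: a positive stabilization. -/
  | stabilizedLeaf (F : Front) : F.IsPositiveStabilization → OrientedSkeinTree F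
  /-- Simplify by Legendrian isotopy and proceed. -/
  | isotopy (F G : Front) : F.Isotopic G → OrientedSkeinTree G → OrientedSkeinTree F
  /-- Eliminate an upward zigzag and proceed. -/
  | destabilize (F G : Front) : F.EliminatesZigzag false G →
      OrientedSkeinTree G → OrientedSkeinTree F
  /-- Replace a front with a positive tangle by the two fronts related to it. -/
  | skeinPositive (Fp Fm F₀ : Front) : Front.SkeinTriple Fp Fm F₀ →
      OrientedSkeinTree Fm → OrientedSkeinTree F₀ → OrientedSkeinTree Fp
  /-- Replace a front with a negative tangle by the two fronts related to it. -/
  | skeinNegative (Fp Fm F₀ : Front) : Front.SkeinTriple Fp Fm F₀ →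
      OrientedSkeinTree Fp → OrientedSkeinTree F₀ → OrientedSkeinTree Fm

/-- The number of terminal leaves that are standard Legendrian unlinks. (A standard unlink is
never a positive stabilization, so this does not depend on how a leaf is labelled.) -/
def OrientedSkeinTree.unlinkLeaves : {F : Front} → OrientedSkeinTree F → ℕ
  | _, .unlinkLeaf _ _ => 1
  | _, .stabilizedLeaf _ _ => 0
  | _, .isotopy _ _ _ T => T.unlinkLeaves
  | _, .destabilize _ _ _ T => T.unlinkLeaves
  | _, .skeinPositive _ _ _ _ T T' => T.unlinkLeaves + T'.unlinkLeaves
  | _, .skeinNegative _ _ _ _ T T' => T.unlinkLeaves + T'.unlinkLeaves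

end LegendrianFront

/-! Call the coefficient of `a ^ (-sl - 1)` in the HOMFLY-PT polynomial the critical coefficient of
a front. The bound says that no higher power of `a` occurs, so sharpness means that this coefficient
is nonzero. In a front skein triple the self-linking numbers are `sl(F₀) + 1`, `sl(F₀) - 1` and
`sl(F₀)`, which is exactly the shift that turns the skein relation of polynomials into `c(F₊) -
c(F₋) = z c(F₀)` for critical coefficients. Legendrian isotopy and removal of upward zigzags change
neither the polynomial nor `sl`. A positive stabilization has critical coefficient zero:
straightening its downward zigzag keeps the polynomial and raises `sl` by two, so the exponent lies
above the bound for the straightened front. A standard unlink with `n` components has critical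
coefficient `z ^ (1 - n)`. Setting `z = 1` and reducing modulo two, which removes all signs, the
critical coefficient of `F` counts the unlink leaves of any skein tree
(`OrientedSkeinTree.criticalParity_eq`). If their number is odd, the coefficient is nonzero.

This uses the existence of the polynomial and the bound, and both are proved from one state sum. A
vertex model with `N` labels gives operators for cups, caps and crossings that satisfy all local
moves, and the skein relation at `a = q ^ N`, `z = q - q⁻¹`. Independently, every nonempty diagram
reduces to unlinks by isotopy and skein relations (`Diagram.resolution`): tangles are built piece by
piece and kept in a layered normal form in which each arc lies over the earlier ones. Hence the
state sums of a diagram are `[N]` times the values of one Laurent polynomial (`exists_represents`),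
and `homfly`, although chosen by `epsilon`, is that polynomial (`represents_homfly`).

For the bound, only extrema traversed downwards carry a nontrivial weight, of size at most `q ^ N`,
and a front crossing contributes at most `(q ^ N) ^ (-sign)`, both up to factors polynomial in `N`.
So the state sum is at most a polynomial in `N` times `(q ^ N) ^ (-sl)`. Dividing by `[N]`, which
grows like `q ^ N`, and letting `N` tend to infinity with `q` fixed bounds the degree in `a` by `-sl
- 1` (`degree_homfly_le`). -/

namespace LegendrianFront

/-! ### A vertex model -/

section VertexModel

open Stream'

variable {N : ℕ}

/-- The weight of an extremum labelled `i` where the direction turns from left to right. -/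
noncomputable def cuspWeight (q : ℝ) (i : Fin N) : ℝ := q ^ (2 * (i : ℤ) - N + 1)

/-- Together with `capWeight`, this puts the nontrivial weights exactly at the extrema traversed
downwards, those counted by `downCusp`. The estimate of state sums of fronts depends on this choice.
-/
noncomputable def cupWeight (q : ℝ) (d : Bool) (i : Fin N) : ℝ := if d then 1 else cuspWeight q i

noncomputable def capWeight (q : ℝ) (d : Bool) (i : Fin N) : ℝ :=
  if d then (cuspWeight q i)⁻¹ else 1

/-- The strict order on labels, or its opposite. -/
def labelLT (b : Bool) (i j : Fin N) : Prop := if b then i < j else j < i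

instance (b : Bool) : DecidableRel (labelLT (N := N) b) := fun i j => by
  unfold labelLT; infer_instance

/-- The contribution of a smoothed crossing to the vertex weights of a crossing. -/
noncomputable def smoothTerm (q : ℝ) (x y e : Bool) (f : Stream' (Fin N) → ℝ)
    (i j : Fin N) (τ : Stream' (Fin N)) : ℝ :=
  if x = y then (if labelLT (x != e) i j then f (i :: j :: τ) else 0)
  else if i = j then
    ∑ k, if labelLT (x == e) k i then capWeight q x k * cupWeight q (!x) i * f (k :: k :: τ) else 0
  else 0

/-- The flag `e` records whether the crossing is positive. The prefactor `a⁻¹` or `a`, at `a = q ^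
N`, corrects the framing: without it a curl would contribute a power of `q ^ N`. -/
noncomputable def crossOp (q : ℝ) (x y e : Bool) (f : Stream' (Fin N) → ℝ)
    (i j : Fin N) (τ : Stream' (Fin N)) : ℝ :=
  (if e then (q ^ N)⁻¹ else q ^ N) *
    ((if i = j then (if e then q else q⁻¹) else 1) * f (j :: i :: τ) +
      (if e then q - q⁻¹ else q⁻¹ - q) * smoothTerm q x y e f i j τ)

/-- The operator of a piece of height `0`. A stack of strands is labelled by a stream, of which
only an initial part matters. -/
noncomputable def pieceOp (q : ℝ) : Piece → (Stream' (Fin N) → ℝ) → Stream' (Fin N) → ℝ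
  | .cup d, f, σ => if σ.head = σ.tail.head then cupWeight q d σ.head * f σ.tail.tail else 0
  | .cap d, f, σ => ∑ i, capWeight q d i * f (i :: i :: σ)
  | .cross x y s, f, σ => crossOp q x y ((x == y) == s) f σ.head σ.tail.head σ.tail.tail

/-- Let an operator act below the topmost `k` strands. -/
def lowerOp : ℕ → ((Stream' (Fin N) → ℝ) → Stream' (Fin N) → ℝ) →
    (Stream' (Fin N) → ℝ) → Stream' (Fin N) → ℝ
  | 0, T => T
  | k + 1, T => fun f σ => lowerOp k T (fun τ => f (σ.head :: τ)) σ.tail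

noncomputable def eventOp (q : ℝ) (e : Event) : (Stream' (Fin N) → ℝ) → Stream' (Fin N) → ℝ :=
  lowerOp e.pos (pieceOp q e.piece)

/-- The argument is a function of the labels to the left of the word and the value a function of
those to its right, so the first event acts first. -/
noncomputable def wordOp (q : ℝ) : List Event → (Stream' (Fin N) → ℝ) → Stream' (Fin N) → ℝ
  | .nil, f => f
  | .cons e w, f => wordOp q w (eventOp q e f)

theorem wordOp_append (q : ℝ) (u v : List Event) (f : Stream' (Fin N) → ℝ) :
    wordOp q (u ++ v) f = wordOp q v (wordOp q u f) := by
  induction u generalizing f with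
  | nil => rfl
  | cons e u ih => exact ih _

/-- Lower an event by `m` strands. -/
def Event.lower (m : ℕ) (e : Event) : Event := ⟨e.pos + m, e.piece⟩

theorem wordOp_lower_one (q : ℝ) (w : List Event) (f : Stream' (Fin N) → ℝ) (i : Fin N)
    (τ : Stream' (Fin N)) :
    wordOp q (w.map (Event.lower 1)) f (i :: τ) = wordOp q w (fun τ => f (i :: τ)) τ := by
  induction w generalizing f with
  | nil => rfl
  | cons e w ih => exact ih _

/-- Reduces every local relation to height zero: the labels of the strands above are mere
parameters. -/
theorem wordOp_lower {q : ℝ} {u v : List Event}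
    (h : ∀ f : Stream' (Fin N) → ℝ, wordOp q u f = wordOp q v f) (m : ℕ)
    (f : Stream' (Fin N) → ℝ) :
    wordOp q (u.map (Event.lower m)) f = wordOp q (v.map (Event.lower m)) f := by
  induction m generalizing f with
  | zero =>
    have : Event.lower 0 = id := rfl
    simpa [this] using h f
  | succ m ih =>
    have key : ∀ w : List Event,
        w.map (Event.lower (m + 1)) = (w.map (Event.lower m)).map (Event.lower 1) := by
      intro w; simp [Event.lower, Function.comp_def, add_assoc]
    funext σ
    rw [← Stream'.eta σ, key, key, wordOp_lower_one, wordOp_lower_one, ih]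

theorem pieceOp_linear (q : ℝ) (p : Piece) (c d : ℝ) (f g : Stream' (Fin N) → ℝ)
    (σ : Stream' (Fin N)) :
    pieceOp q p (fun τ => c * f τ + d * g τ) σ = c * pieceOp q p f σ + d * pieceOp q p g σ := by
  cases p with
  | cup e => simp only [pieceOp]; split_ifs <;> ring
  | cap e =>
    simp only [pieceOp, Finset.mul_sum, ← Finset.sum_add_distrib]
    exact Finset.sum_congr rfl fun i _ => by ring
  | cross x y s =>
    have key : ∀ e i j τ, smoothTerm q x y e (fun τ => c * f τ + d * g τ) i j τ =
        c * smoothTerm q x y e f i j τ + d * smoothTerm q x y e g i j τ := by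
      intro e i j τ
      simp only [smoothTerm]
      split_ifs
      · rfl
      · ring
      · simp only [Finset.mul_sum, ← Finset.sum_add_distrib]
        exact Finset.sum_congr rfl fun i _ => by split_ifs <;> ring
      · ring
    simp only [pieceOp, crossOp, key]
    ring

theorem lowerOp_pieceOp_linear (q : ℝ) (m : ℕ) (p : Piece) (c d : ℝ)
    (f g : Stream' (Fin N) → ℝ) (σ : Stream' (Fin N)) :
    lowerOp m (pieceOp q p) (fun τ => c * f τ + d * g τ) σ =
      c * lowerOp m (pieceOp q p) f σ + d * lowerOp m (pieceOp q p) g σ := by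
  induction m generalizing f g σ with
  | zero => exact pieceOp_linear ..
  | succ m ih => exact ih ..

theorem lowerOp_pieceOp_zero (q : ℝ) (m : ℕ) (p : Piece) (σ : Stream' (Fin N)) :
    lowerOp m (pieceOp q p) (fun _ => 0) σ = 0 := by
  simpa using lowerOp_pieceOp_linear q m p 0 0 (fun _ => 0) (fun _ => 0) σ

theorem lowerOp_pieceOp_mul (q : ℝ) (m : ℕ) (p : Piece) (c : ℝ) (f : Stream' (Fin N) → ℝ)
    (σ : Stream' (Fin N)) :
    lowerOp m (pieceOp q p) (fun τ => c * f τ) σ = c * lowerOp m (pieceOp q p) f σ := by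
  simpa using lowerOp_pieceOp_linear q m p c 0 f (fun _ => 0) σ

theorem lowerOp_pieceOp_sum {ι : Type*} (q : ℝ) (m : ℕ) (p : Piece) (s : Finset ι)
    (f : ι → Stream' (Fin N) → ℝ) (σ : Stream' (Fin N)) :
    lowerOp m (pieceOp q p) (fun τ => ∑ i ∈ s, f i τ) σ =
      ∑ i ∈ s, lowerOp m (pieceOp q p) (f i) σ := by
  classical
  induction s using Finset.induction_on with
  | empty => simpa using lowerOp_pieceOp_zero q m p σ
  | insert i s hi ih =>
    simp only [Finset.sum_insert hi]
    have := lowerOp_pieceOp_linear q m p 1 1 (f i) (fun τ => ∑ i ∈ s, f i τ) σ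
    simpa [ih] using this

theorem lowerOp_pieceOp_add (q : ℝ) (m : ℕ) (p : Piece)
    (f g : Stream' (Fin N) → ℝ) (σ : Stream' (Fin N)) :
    lowerOp m (pieceOp q p) (fun τ => f τ + g τ) σ =
      lowerOp m (pieceOp q p) f σ + lowerOp m (pieceOp q p) g σ := by
  simpa using lowerOp_pieceOp_linear q m p 1 1 f g σ

theorem lowerOp_pieceOp_ite (q : ℝ) (m : ℕ) (p : Piece) (c : Prop) [Decidable c]
    (f : Stream' (Fin N) → ℝ) (σ : Stream' (Fin N)) :
    lowerOp m (pieceOp q p) (fun τ => if c then f τ else 0) σ =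
      if c then lowerOp m (pieceOp q p) f σ else 0 := by
  split_ifs
  · rfl
  · exact lowerOp_pieceOp_zero q m p σ

theorem lowerOp_add_two (m : ℕ) (T : (Stream' (Fin N) → ℝ) → Stream' (Fin N) → ℝ)
    (f : Stream' (Fin N) → ℝ) (i j : Fin N) (τ : Stream' (Fin N)) :
    lowerOp (2 + m) T f (i :: j :: τ) = lowerOp m T (fun τ => f (i :: j :: τ)) τ := by
  rw [add_comm]; rfl

theorem exists_cons_cons (σ : Stream' (Fin N)) :
    ∃ (i j : Fin N) (τ : Stream' (Fin N)), σ = i :: j :: τ :=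
  ⟨σ.head, σ.tail.head, σ.tail.tail, by rw [Stream'.eta, Stream'.eta]⟩

theorem exists_cons_cons_cons (σ : Stream' (Fin N)) :
    ∃ (i j k : Fin N) (τ : Stream' (Fin N)), σ = i :: j :: k :: τ :=
  ⟨σ.head, σ.tail.head, σ.tail.tail.head, σ.tail.tail.tail, by
    rw [Stream'.eta, Stream'.eta, Stream'.eta]⟩

theorem pieceOp_cup (q : ℝ) (d : Bool) (f : Stream' (Fin N) → ℝ) (i j τ) :
    pieceOp q (.cup d) f (i :: j :: τ) = if i = j then cupWeight q d i * f τ else 0 := rfl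

theorem pieceOp_cap (q : ℝ) (d : Bool) (f : Stream' (Fin N) → ℝ) (τ) :
    pieceOp q (.cap d) f τ = ∑ i, capWeight q d i * f (i :: i :: τ) := rfl

theorem pieceOp_cross (q : ℝ) (x y s : Bool) (f : Stream' (Fin N) → ℝ) (i j τ) :
    pieceOp q (.cross x y s) f (i :: j :: τ) = crossOp q x y ((x == y) == s) f i j τ := rfl

/-- Pieces at disjoint heights commute. -/
theorem pieceOp_exchange (q : ℝ) (m : ℕ) (p r : Piece) (f : Stream' (Fin N) → ℝ) :
    lowerOp (p.cod.length + m) (pieceOp q r) (pieceOp q p f) =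
      pieceOp q p (lowerOp (p.dom.length + m) (pieceOp q r) f) := by
  funext σ
  cases p with
  | cup d =>
    obtain ⟨i, j, τ, rfl⟩ := exists_cons_cons σ
    simp only [Piece.cod, Piece.dom, List.length_cons, List.length_nil, Nat.zero_add,
      lowerOp_add_two, pieceOp_cup, lowerOp_pieceOp_ite, lowerOp_pieceOp_mul, Nat.reduceAdd]
  | cap d =>
    simp only [Piece.cod, Piece.dom, List.length_cons, List.length_nil, Nat.zero_add,
      lowerOp_add_two, pieceOp_cap, Nat.reduceAdd, funext (pieceOp_cap q d f),
      lowerOp_pieceOp_sum, lowerOp_pieceOp_mul]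
  | cross x y s =>
    obtain ⟨i, j, τ, rfl⟩ := exists_cons_cons σ
    simp only [Piece.cod, Piece.dom, List.length_cons, List.length_nil, Nat.zero_add,
      lowerOp_add_two, pieceOp_cross, Nat.reduceAdd, crossOp, smoothTerm,
      lowerOp_pieceOp_mul, lowerOp_pieceOp_add]
    by_cases h : x = y <;> by_cases h' : i = j <;>
      simp [h, h', lowerOp_pieceOp_mul, lowerOp_pieceOp_ite,
      lowerOp_pieceOp_sum, lowerOp_pieceOp_zero]

theorem wordOp_exchange (q : ℝ) {l r : List Event} (h : Exchange l r)
    (f : Stream' (Fin N) → ℝ) : wordOp q l f = wordOp q r f := by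
  obtain ⟨k, m, p, r⟩ := h
  have := wordOp_lower (q := q) (N := N) (u := [⟨0, p⟩, ⟨p.cod.length + m, r⟩])
    (v := [⟨p.dom.length + m, r⟩, ⟨0, p⟩]) (fun f => pieceOp_exchange q m p r f) k f
  simpa [Event.lower, add_comm, add_left_comm] using this

theorem eventOp_exchange (q : ℝ) (k m : ℕ) (p r : Piece) (f : Stream' (Fin N) → ℝ) :
    eventOp q ⟨k + p.cod.length + m, r⟩ (eventOp q ⟨k, p⟩ f) =
      eventOp q ⟨k, p⟩ (eventOp q ⟨k + p.dom.length + m, r⟩ f) :=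
  wordOp_exchange q (.mk k m p r) f

end VertexModel

/-! ### Local relations of the vertex model at height zero -/

section VertexModel

open Stream'

variable {N : ℕ} {q : ℝ}

theorem cuspWeight_ne_zero (hq : 0 < q) (i : Fin N) : cuspWeight q i ≠ 0 :=
  (zpow_pos hq _).ne'

/-- The two crossings have the same sign, and exactly one of them is between parallel strands. For
the other, the cup forces two labels to agree, so that the sum in its smoothing has at most one
nonzero term; the extremum weights then cancel to those of the parallel smoothing. -/
theorem wordOp_slideCup (hq : 0 < q) (d x s : Bool) (f : Stream' (Fin N) → ℝ) :
    wordOp q [cup 0 d, cross 1 (!d) x s] f = wordOp q [cup 1 d, cross 0 x d (!s)] f := by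
  funext σ
  obtain ⟨i, j, l, τ, rfl⟩ := exists_cons_cons_cons σ
  have hc (c b : Fin N) (y : ℝ) :
      (cuspWeight q c)⁻¹ * cuspWeight q b * (cuspWeight q c * y) = cuspWeight q b * y := by
    field_simp [cuspWeight_ne_zero hq c]
  have sum_pick (P : Fin N → Prop) [DecidablePred P] (c : Fin N) (g : Fin N → ℝ) :
      (∑ k, if P k ∧ c = k then g k else 0) = if P c then g c else 0 := by
    simp [and_comm (a := P _), ite_and]
  have sum_pick' (P : Fin N → Prop) [DecidablePred P] (c : Fin N) (y : ℝ) :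
      (∑ k, if P k ∧ k = c then y else 0) = if P c then y else 0 := by
    simp [and_comm (a := P _), ite_and]
  simp only [wordOp, eventOp, lowerOp, pieceOp_cross, head_cons, tail_cons, crossOp, smoothTerm,
    pieceOp_cup]
  by_cases hij : i = j <;> by_cases hjl : j = l <;> by_cases hil : i = l <;>
    cases d <;> cases x <;> cases s <;>
    simp_all [labelLT, cupWeight, capWeight, ← ite_and, -mul_eq_mul_left_iff, -mul_eq_zero]

/-- Crossings of parallel strands only permute and compare labels, so this is a finite identity in
`q` for each relative order of three labels. -/
theorem wordOp_parallel_R3 (hq : 0 < q) (x : Bool) (f : Stream' (Fin N) → ℝ) :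
    wordOp q [cross 0 x x true, cross 1 x x true, cross 0 x x true] f =
      wordOp q [cross 1 x x true, cross 0 x x true, cross 1 x x true] f := by
  funext σ
  obtain ⟨i, j, l, τ, rfl⟩ := exists_cons_cons_cons σ
  simp only [wordOp, eventOp, lowerOp, pieceOp_cross, head_cons, tail_cons, crossOp, smoothTerm,
    beq_self_eq_true, if_true, Bool.bne_true]
  generalize (q ^ N)⁻¹ = a
  cases x <;> simp only [labelLT, Bool.not_true, Bool.not_false, if_true, Bool.false_eq_true,
    if_false] <;>
  rcases lt_trichotomy i j with h | h | h <;> rcases lt_trichotomy j l with h' | h' | h' <;>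
  rcases lt_trichotomy i l with h'' | h'' | h'' <;> (try subst h) <;> (try subst h') <;>
  first
  | (exfalso; order)
  | (simp only [*, ne_of_lt, ne_of_gt, lt_asymm, lt_irrefl, if_true, if_false]
     try field_simp
     try ring)

theorem capWeight_mul_cupWeight_not (hq : 0 < q) (d : Bool) (i : Fin N) :
    capWeight q d i * cupWeight q (!d) i = 1 := by
  cases d <;> simp [capWeight, cupWeight, cuspWeight_ne_zero hq]

theorem wordOp_slideCap (hq : 0 < q) (d x s : Bool) (f : Stream' (Fin N) → ℝ) :
    wordOp q [cross 1 x (!d) s, cap 0 d] f = wordOp q [cross 0 d x (!s), cap 1 d] f := by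
  funext σ
  obtain ⟨j, i, τ, rfl⟩ := exists_cons_cons σ
  generalize i :: τ = τ
  simp only [wordOp, eventOp, lowerOp, pieceOp_cap, pieceOp_cross, head_cons, tail_cons, crossOp]
  -- Both crossings have the same sign, hence the same framing factor and the same coefficient of
  -- the smoothing; the swap terms and the smoothing terms can be compared separately.
  have he : ((d == x) == !s) = ((x == !d) == s) := by cases d <;> cases x <;> cases s <;> rfl
  rw [he]
  simp only [mul_add, Finset.sum_add_distrib]
  congr 1
  · exact Finset.sum_congr rfl fun i _ => by simp only [eq_comm]
  simp only [mul_left_comm (capWeight q d _), ← Finset.mul_sum]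
  congr 2
  have hw := capWeight_mul_cupWeight_not (N := N) hq d
  by_cases h : d = x
  · subst h
    have h' : d ≠ !d := by simp
    simp only [smoothTerm, if_true, if_neg h', Finset.mul_sum, mul_ite, mul_zero,
      Finset.sum_ite_eq', Finset.mem_univ]
    refine Finset.sum_congr rfl fun k _ => ?_
    have : labelLT (d == ((d == !d) == s)) k j ↔ labelLT (d != ((d == !d) == s)) j k := by
      cases d <;> cases s <;> simp [labelLT]
    simp only [this]
    split_ifs
    · linear_combination capWeight q d k * f (j :: k :: k :: τ) * hw j
    · rfl
  · obtain rfl : x = !d := by simpa [eq_comm] using Bool.eq_not_of_ne (Ne.symm h)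
    simp only [smoothTerm, if_true, if_neg h, Finset.mul_sum, mul_ite, mul_zero,
      Finset.sum_ite_eq, Finset.mem_univ]
    refine Finset.sum_congr rfl fun k _ => ?_
    have : labelLT (d == (((!d) == !d) == s)) k j ↔ labelLT ((!d) != (((!d) == !d) == s)) k j := by
      cases d <;> cases s <;> simp [labelLT]
    simp only [this]
    split_ifs
    · linear_combination -capWeight q d k * f (k :: k :: j :: τ) * hw j
    · rfl

/-! Telescoping sums of cusp weights -/

theorem sum_fin_telescope (B : ℕ → ℝ) {m n : ℕ} (hmn : m ≤ n) (hn : n ≤ N) :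
    (∑ k : Fin N, if m ≤ (k : ℕ) ∧ (k : ℕ) < n then B (k + 1) - B k else 0) = B n - B m := by
  rw [Fin.sum_univ_eq_sum_range (fun k => if m ≤ k ∧ k < n then B (k + 1) - B k else 0) N,
    ← Finset.sum_filter]
  have : (Finset.range N).filter (fun k => m ≤ k ∧ k < n) = Finset.Ico m n := by
    ext k; simp; omega
  rw [this, Finset.sum_Ico_sub B hmn]

/-- The weights form a geometric progression of ratio `q ^ 2`, so multiplying by `z` turns each one
into a difference of consecutive powers. All sums over intervals of labels below telescope for this
reason. -/
theorem sub_inv_mul_cuspWeight (hq : 0 < q) (k : Fin N) :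
    (q - q⁻¹) * cuspWeight q k =
      q ^ (2 * ((k + 1 : ℕ) : ℤ) - N) - q ^ (2 * ((k : ℕ) : ℤ) - N) := by
  have hq' := hq.ne'
  have h1 : (2 * ((k + 1 : ℕ) : ℤ) - N) = (2 * (k : ℤ) - N + 1) + 1 := by push_cast; ring
  have h2 : (2 * ((k : ℕ) : ℤ) - N) = (2 * (k : ℤ) - N + 1) - 1 := by ring
  rw [h1, h2, zpow_add_one₀ hq', zpow_sub_one₀ hq', cuspWeight]
  ring_nf

theorem sub_inv_mul_cuspWeight_inv (hq : 0 < q) (k : Fin N) :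
    (q⁻¹ - q) * (cuspWeight q k)⁻¹ =
      q ^ (N - 2 * ((k + 1 : ℕ) : ℤ)) - q ^ (N - 2 * ((k : ℕ) : ℤ)) := by
  have hq' := hq.ne'
  have h1 : (N - 2 * ((k + 1 : ℕ) : ℤ)) = -(2 * (k : ℤ) - N + 1) - 1 := by push_cast; ring
  have h2 : (N - 2 * ((k : ℕ) : ℤ)) = -(2 * (k : ℤ) - N + 1) + 1 := by ring
  rw [h1, h2, zpow_add_one₀ hq', zpow_sub_one₀ hq', cuspWeight, zpow_neg]
  ring

theorem sum_cuspWeight (hq : 0 < q) {m n : ℕ} (hmn : m ≤ n) (hn : n ≤ N) :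
    (q - q⁻¹) * (∑ k : Fin N, if m ≤ (k : ℕ) ∧ (k : ℕ) < n then cuspWeight q k else 0) =
      q ^ (2 * (n : ℤ) - N) - q ^ (2 * (m : ℤ) - N) := by
  rw [← sum_fin_telescope (fun k => q ^ (2 * (k : ℤ) - N)) hmn hn, Finset.mul_sum]
  refine Finset.sum_congr rfl fun k _ => ?_
  rw [mul_ite, mul_zero, sub_inv_mul_cuspWeight hq]

theorem sum_cuspWeight_inv (hq : 0 < q) {m n : ℕ} (hmn : m ≤ n) (hn : n ≤ N) :
    (q⁻¹ - q) * (∑ k : Fin N, if m ≤ (k : ℕ) ∧ (k : ℕ) < n then (cuspWeight q k)⁻¹ else 0) =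
      q ^ (N - 2 * (n : ℤ)) - q ^ (N - 2 * (m : ℤ)) := by
  rw [← sum_fin_telescope (fun k => q ^ (N - 2 * (k : ℤ))) hmn hn, Finset.mul_sum]
  refine Finset.sum_congr rfl fun k _ => ?_
  rw [mul_ite, mul_zero, sub_inv_mul_cuspWeight_inv hq]

theorem zpow_two_mul_sub (hq : 0 < q) (i : Fin N) :
    q ^ (2 * ((i : ℕ) : ℤ) - N) = q⁻¹ * cuspWeight q i := by
  have h2 : (2 * ((i : ℕ) : ℤ) - N) = (2 * (i : ℤ) - N + 1) - 1 := by ring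
  rw [h2, zpow_sub_one₀ hq.ne', cuspWeight, mul_comm]

theorem zpow_two_mul_succ_sub (hq : 0 < q) (i : Fin N) :
    q ^ (2 * ((i + 1 : ℕ) : ℤ) - N) = q * cuspWeight q i := by
  have h2 : (2 * ((i + 1 : ℕ) : ℤ) - N) = (2 * (i : ℤ) - N + 1) + 1 := by push_cast; ring
  rw [h2, zpow_add_one₀ hq.ne', cuspWeight, mul_comm]

theorem zpow_sub_two_mul (hq : 0 < q) (i : Fin N) :
    q ^ (N - 2 * ((i : ℕ) : ℤ)) = q * (cuspWeight q i)⁻¹ := by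
  have h2 : (N - 2 * ((i : ℕ) : ℤ)) = -(2 * (i : ℤ) - N + 1) + 1 := by ring
  rw [h2, zpow_add_one₀ hq.ne', cuspWeight, zpow_neg, mul_comm]

theorem zpow_sub_two_mul_succ (hq : 0 < q) (i : Fin N) :
    q ^ (N - 2 * ((i + 1 : ℕ) : ℤ)) = q⁻¹ * (cuspWeight q i)⁻¹ := by
  have h2 : (N - 2 * ((i + 1 : ℕ) : ℤ)) = -(2 * (i : ℤ) - N + 1) - 1 := by push_cast; ring
  rw [h2, zpow_sub_one₀ hq.ne', cuspWeight, zpow_neg, mul_comm]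

/-- A sum of cusp weights over the labels between two given ones. -/
theorem sum_cuspWeight_between (hq : 0 < q) {i j : Fin N} (h : i < j) :
    (q - q⁻¹) * (∑ k : Fin N, if i < k ∧ k < j then cuspWeight q k else 0) =
      q⁻¹ * cuspWeight q j - q * cuspWeight q i := by
  rw [← zpow_two_mul_sub hq, ← zpow_two_mul_succ_sub hq,
    ← sum_cuspWeight hq (show (i : ℕ) + 1 ≤ j from h) j.2.le]
  simp only [Fin.lt_def, Nat.succ_le_iff]

theorem sum_cuspWeight_inv_between (hq : 0 < q) {i j : Fin N} (h : i < j) :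
    (q⁻¹ - q) * (∑ k : Fin N, if i < k ∧ k < j then (cuspWeight q k)⁻¹ else 0) =
      q * (cuspWeight q j)⁻¹ - q⁻¹ * (cuspWeight q i)⁻¹ := by
  rw [← zpow_sub_two_mul hq, ← zpow_sub_two_mul_succ hq,
    ← sum_cuspWeight_inv hq (show (i : ℕ) + 1 ≤ j from h) j.2.le]
  simp only [Fin.lt_def, Nat.add_one_le_iff]

theorem sum_cuspWeight_lt (hq : 0 < q) (i : Fin N) :
    (q - q⁻¹) * (∑ k : Fin N, if k < i then cuspWeight q k else 0) =
      q⁻¹ * cuspWeight q i - (q ^ N)⁻¹ := by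
  have := sum_cuspWeight hq (Nat.zero_le i) i.2.le
  simpa [zpow_two_mul_sub hq] using this

theorem sum_cuspWeight_gt (hq : 0 < q) (i : Fin N) :
    (q - q⁻¹) * (∑ k : Fin N, if i < k then cuspWeight q k else 0) =
      q ^ N - q * cuspWeight q i := by
  have := sum_cuspWeight hq (show (i : ℕ) + 1 ≤ N from i.2) le_rfl
  rw [zpow_two_mul_succ_sub hq] at this
  rw [← zpow_natCast, show (N : ℤ) = 2 * N - N by ring, ← this]
  simp

theorem sum_cuspWeight_inv_lt (hq : 0 < q) (i : Fin N) :
    (q⁻¹ - q) * (∑ k : Fin N, if k < i then (cuspWeight q k)⁻¹ else 0) =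
      q * (cuspWeight q i)⁻¹ - q ^ N := by
  have := sum_cuspWeight_inv hq (Nat.zero_le i) i.2.le
  rw [zpow_sub_two_mul hq] at this
  simpa using this

theorem sum_cuspWeight_inv_gt (hq : 0 < q) (i : Fin N) :
    (q⁻¹ - q) * (∑ k : Fin N, if i < k then (cuspWeight q k)⁻¹ else 0) =
      (q ^ N)⁻¹ - q⁻¹ * (cuspWeight q i)⁻¹ := by
  have := sum_cuspWeight_inv hq (show (i : ℕ) + 1 ≤ N from i.2) le_rfl
  rw [zpow_sub_two_mul_succ hq] at this
  rw [← zpow_natCast, ← zpow_neg, show (-N : ℤ) = N - 2 * N by ring, ← this]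
  simp

theorem sum_cuspWeight_univ (hq : 0 < q) :
    (q - q⁻¹) * (∑ k : Fin N, cuspWeight q k) = q ^ N - (q ^ N)⁻¹ := by
  have := sum_cuspWeight (N := N) hq (Nat.zero_le N) le_rfl
  rw [show (2 * (N : ℤ) - N) = N by ring] at this
  simpa using this

theorem sum_cuspWeight_inv_univ (hq : 0 < q) :
    (q - q⁻¹) * (∑ k : Fin N, (cuspWeight q k)⁻¹) = q ^ N - (q ^ N)⁻¹ := by
  have := sum_cuspWeight_inv (N := N) hq (Nat.zero_le N) le_rfl
  rw [show (N - 2 * (N : ℤ)) = -N by ring] at this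
  simp at this
  linarith

/-! ### The second and first Reidemeister moves in the vertex model -/

theorem labelLT_trans {b : Bool} {i j k : Fin N} (h : labelLT b i j) (h' : labelLT b j k) :
    labelLT b i k := by
  cases b
  · exact lt_trans (α := Fin N) h' h
  · exact lt_trans (α := Fin N) h h'

/-- Two successive antiparallel smoothings pass through an intermediate label `k` strictly between
`l` and `i`. Its total weight telescopes to two boundary terms, which are what the products of a
smoothing with a swap require in order to cancel. -/
theorem sum_smooth_smooth (hq : 0 < q) (x e : Bool) (i l : Fin N) :
    (if e then q - q⁻¹ else q⁻¹ - q) * (∑ k, if labelLT (x == e) k i then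
      capWeight q (!x) k * cupWeight q x i * (if labelLT (x == e) l k then
        capWeight q x l * cupWeight q (!x) k else 0) else 0) =
      if labelLT (x == e) l i then
        (if e then q⁻¹ else q) * (capWeight q x l * cupWeight q (!x) i) -
          (if e then q else q⁻¹) * (capWeight q (!x) l * cupWeight q x i) else 0 := by
  have hi := cuspWeight_ne_zero hq i
  have hl := cuspWeight_ne_zero hq l
  by_cases h : labelLT (x == e) l i
  swap
  · rw [if_neg h, Finset.sum_eq_zero, mul_zero]
    intro k _
    split_ifs with h1 h2
    · exact absurd (labelLT_trans h2 h1) h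
    · exact mul_zero _
    · rfl
  rw [if_pos h]
  cases e
  · cases x <;> simp [labelLT, capWeight, cupWeight] at h ⊢
    · have := sum_cuspWeight_inv_between hq h
      simp only [← ite_and, ← Finset.sum_mul, ← ite_zero_mul, and_comm (b := l < _)]
      rw [← mul_assoc, this]
      field_simp
    · have := sum_cuspWeight_between hq h
      simp only [← ite_and, ← Finset.mul_sum, ← mul_ite_zero]
      rw [mul_left_comm, ← neg_sub, neg_mul, this]
      field_simp
      ring
  · cases x <;> simp [labelLT, capWeight, cupWeight] at h ⊢
    · have := sum_cuspWeight_inv_between hq h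
      simp only [← ite_and, ← Finset.sum_mul, ← ite_zero_mul]
      rw [← mul_assoc, ← neg_sub, neg_mul, this]
      field_simp
      ring
    · have := sum_cuspWeight_between hq h
      simp only [← ite_and, ← Finset.mul_sum, ← mul_ite_zero, and_comm (b := l < _)]
      rw [mul_left_comm, this]
      field_simp

/-- For parallel strands this is a computation on each pair of labels. For antiparallel strands,
distinct labels are just swapped up to the framing factor, while on equal labels the crossing is a
triangular matrix, whose product with that of the opposite crossing is evaluated by
`sum_smooth_smooth`. -/
theorem crossOp_crossOp (hq : 0 < q) (x y e : Bool) {f g : Stream' (Fin N) → ℝ}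
    {τ : Stream' (Fin N)} (hg : ∀ i j, g (i :: j :: τ) = crossOp q x y e f i j τ) (i j : Fin N) :
    crossOp q y x (!e) g i j τ = f (i :: j :: τ) := by
  have hq' := hq.ne'
  have hN : q ^ N ≠ 0 := pow_ne_zero _ hq'
  by_cases h : x = y
  · subst h
    simp only [crossOp, hg, smoothTerm, if_true, labelLT]
    rcases lt_trichotomy i j with h | h | h <;> cases x <;> cases e <;>
    (try subst h) <;> simp [*, ne_of_lt, ne_of_gt, lt_asymm] <;> field_simp <;> ring
  obtain rfl : y = !x := by simpa [eq_comm] using Bool.eq_not_of_ne (Ne.symm h)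
  have h' : (!x) ≠ x := Ne.symm h
  by_cases hij : i = j
  · subst hij
    simp only [crossOp, hg, smoothTerm, if_true, if_neg h, if_neg h']
    have hb : ((!x) == (!e)) = (x == e) := by cases x <;> cases e <;> rfl
    simp only [hb, Bool.not_not]
    -- `S` is the result of a single smoothing. The identity `key` expresses the double smoothing
    -- through single ones of both kinds.
    set S : Fin N → ℝ := fun i => ∑ k, if labelLT (x == e) k i then
      capWeight q x k * cupWeight q (!x) i * f (k :: k :: τ) else 0 with hS
    have key : (if e then q - q⁻¹ else q⁻¹ - q) * (∑ k, if labelLT (x == e) k i then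
        capWeight q (!x) k * cupWeight q x i * S k else 0) =
        (if e then q⁻¹ else q) * S i - (if e then q else q⁻¹) *
          ∑ k, if labelLT (x == e) k i then
            capWeight q (!x) k * cupWeight q x i * f (k :: k :: τ) else 0 := by
      have : (if e then q - q⁻¹ else q⁻¹ - q) * (∑ k, if labelLT (x == e) k i then
          capWeight q (!x) k * cupWeight q x i * S k else 0) =
          ∑ l, ((if e then q - q⁻¹ else q⁻¹ - q) * (∑ k, if labelLT (x == e) k i then
            capWeight q (!x) k * cupWeight q x i * (if labelLT (x == e) l k then
            capWeight q x l * cupWeight q (!x) k else 0) else 0)) * f (l :: l :: τ) := by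
        simp only [← Finset.mul_sum, mul_assoc, Finset.sum_mul]
        rw [Finset.sum_comm]
        congr 1
        refine Finset.sum_congr rfl fun k _ => ?_
        split_ifs
        · simp only [hS, Finset.mul_sum]
          refine Finset.sum_congr rfl fun l _ => ?_
          split_ifs <;> ring
        · simp
      rw [this]
      simp only [sum_smooth_smooth hq, hS, Finset.mul_sum, ← Finset.sum_sub_distrib]
      refine Finset.sum_congr rfl fun l _ => ?_
      split_ifs <;> ring
    have split : (∑ k, if labelLT (x == e) k i then capWeight q (!x) k * cupWeight q x i *
        ((if e then (q ^ N)⁻¹ else q ^ N) * ((if e then q else q⁻¹) * f (k :: k :: τ) +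
          (if e then q - q⁻¹ else q⁻¹ - q) * S k)) else 0) =
        (if e then (q ^ N)⁻¹ else q ^ N) * ((if e then q else q⁻¹) *
          (∑ k, if labelLT (x == e) k i then
            capWeight q (!x) k * cupWeight q x i * f (k :: k :: τ) else 0) +
          (if e then q - q⁻¹ else q⁻¹ - q) * ∑ k, if labelLT (x == e) k i then
            capWeight q (!x) k * cupWeight q x i * S k else 0) := by
      simp only [Finset.mul_sum, ← Finset.sum_add_distrib]
      refine Finset.sum_congr rfl fun l _ => ?_
      by_cases hl : labelLT (x == e) l i
      · simp only [if_pos hl]; ring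
      · simp only [if_neg hl]; ring
    have hSi : S i = ∑ k, if labelLT (x == e) k i then
      capWeight q x k * cupWeight q (!x) i * f (k :: k :: τ) else 0 := rfl
    rw [← hSi, split, key]
    cases e <;> simp <;> field_simp <;> ring
  · have hji : ¬j = i := Ne.symm hij
    simp only [crossOp, hg, smoothTerm, if_neg hij, if_neg h, if_neg h']
    cases e <;> simp [hN, hji]

theorem wordOp_R2 (hq : 0 < q) (x y s : Bool) (f : Stream' (Fin N) → ℝ) :
    wordOp q [cross 0 x y s, cross 0 y x (!s)] f = f := by
  funext σ
  obtain ⟨i, j, τ, rfl⟩ := exists_cons_cons σ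
  have he : ((y == x) == !s) = !((x == y) == s) := by cases y <;> cases x <;> cases s <;> rfl
  simp only [wordOp, eventOp, lowerOp, pieceOp_cross, he]
  exact crossOp_crossOp hq x y _ (fun _ _ => rfl) i j

/-- The smoothing sums the weights of all labels on one side of `i`. The sum telescopes: its
boundary term at `i` cancels the swap term, and the one at the end of the label range, `q ^ N` or
its inverse, cancels the framing factor. -/
theorem wordOp_R1_cup (hq : 0 < q) (d s : Bool) (f : Stream' (Fin N) → ℝ) :
    wordOp q [cup 0 d, cross 0 d (!d) s] f = wordOp q [cup 0 (!d)] f := by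
  funext σ
  obtain ⟨i, j, τ, rfl⟩ := exists_cons_cons σ
  have hi := cuspWeight_ne_zero hq i
  have hq' := hq.ne'
  have hN : q ^ N ≠ 0 := pow_ne_zero _ hq'
  have h : d ≠ !d := by simp
  simp only [wordOp, eventOp, lowerOp, pieceOp_cross, crossOp, smoothTerm, if_neg h, pieceOp_cup]
  by_cases hij : i = j
  · subst hij
    simp only [if_true]
    have : ∀ k : Fin N, capWeight q d k * cupWeight q (!d) i * (cupWeight q d k * f τ) =
        capWeight q d k * cupWeight q d k * (cupWeight q (!d) i * f τ) := fun k => by ring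
    simp only [this, ← ite_zero_mul, ← Finset.sum_mul]
    rw [← mul_assoc _ (∑ _, _)]
    have h1 := sum_cuspWeight_lt hq i
    have h2 := sum_cuspWeight_gt hq i
    have h3 := sum_cuspWeight_inv_lt hq i
    have h4 := sum_cuspWeight_inv_gt hq i
    have h5 := neg_sub q q⁻¹
    have h6 := neg_sub q⁻¹ q
    cases d <;> cases s <;> simp [labelLT, capWeight, cupWeight]
    · rw [h2]; field_simp; ring
    · rw [← h5, neg_mul, h1]; field_simp; ring
    · rw [← h6, neg_mul, h3]; field_simp; ring
    · rw [h4]; field_simp; ring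
  · simp [hij, Ne.symm hij]

theorem wordOp_R1_cap (hq : 0 < q) (d s : Bool) (f : Stream' (Fin N) → ℝ) :
    wordOp q [cross 0 d (!d) s, cap 0 (!d)] f = wordOp q [cap 0 d] f := by
  funext τ
  have hq' := hq.ne'
  have hN : q ^ N ≠ 0 := pow_ne_zero _ hq'
  have h : d ≠ !d := by simp
  simp only [wordOp, eventOp, lowerOp, pieceOp_cross, crossOp, smoothTerm, if_neg h, pieceOp_cap,
    if_true]
  set e := ((d == !d) == s) with he
  have : ∀ i, capWeight q (!d) i * ((if e then (q ^ N)⁻¹ else q ^ N) *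
      ((if e then q else q⁻¹) * f (i :: i :: τ) + (if e then q - q⁻¹ else q⁻¹ - q) *
        ∑ k, if labelLT (d == e) k i then
          capWeight q d k * cupWeight q (!d) i * f (k :: k :: τ) else 0)) =
      (if e then (q ^ N)⁻¹ else q ^ N) * (if e then q else q⁻¹) *
        capWeight q (!d) i * f (i :: i :: τ) +
      ∑ k, (if e then (q ^ N)⁻¹ else q ^ N) * ((if e then q - q⁻¹ else q⁻¹ - q) *
        (if labelLT (d == e) k i then capWeight q (!d) i * cupWeight q (!d) i else 0)) *
          (capWeight q d k * f (k :: k :: τ)) := by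
    intro i
    simp only [mul_add, Finset.mul_sum]
    congr 1
    · ring
    · refine Finset.sum_congr rfl fun k _ => ?_
      by_cases hl : labelLT (d == e) k i
      · simp only [if_pos hl]; ring
      · simp only [if_neg hl]; ring
  simp only [this, Finset.sum_add_distrib]
  -- After exchanging the sums, the coefficient of each value of `f` on a pair of equal labels is
  -- again a telescoping sum over the labels on one side.
  rw [Finset.sum_comm, ← Finset.sum_add_distrib]
  refine Finset.sum_congr rfl fun i _ => ?_
  rw [← Finset.sum_mul, ← Finset.mul_sum, ← Finset.mul_sum]
  have hi := cuspWeight_ne_zero hq i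
  have h1 := sum_cuspWeight_lt hq i
  have h2 := sum_cuspWeight_gt hq i
  have h3 := sum_cuspWeight_inv_lt hq i
  have h4 := sum_cuspWeight_inv_gt hq i
  have h5 := neg_sub q q⁻¹
  have h6 := neg_sub q⁻¹ q
  rw [he]
  cases d <;> cases s <;> simp [labelLT, capWeight, cupWeight]
  · rw [← h6, neg_mul, h3]; field_simp; ring
  · rw [h4]; field_simp; ring
  · rw [h2]; field_simp; ring
  · rw [← h5, neg_mul, h1]; field_simp; ring

end VertexModel

/-! ### Relations at arbitrary height and the Yang–Baxter equation -/

section VertexModel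

variable {N : ℕ} {q : ℝ}

theorem eventOp_slideCup (hq : 0 < q) (k : ℕ) (d x s : Bool) (f : Stream' (Fin N) → ℝ) :
    eventOp q (cross (k + 1) (!d) x s) (eventOp q (cup k d) f) =
      eventOp q (cross k x d (!s)) (eventOp q (cup (k + 1) d) f) := by
  simpa [Event.lower, add_comm, wordOp] using wordOp_lower (wordOp_slideCup (N := N) hq d x s) k f

theorem eventOp_slideCap (hq : 0 < q) (k : ℕ) (d x s : Bool) (f : Stream' (Fin N) → ℝ) :
    eventOp q (cap k d) (eventOp q (cross (k + 1) x (!d) s) f) =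
      eventOp q (cap (k + 1) d) (eventOp q (cross k d x (!s)) f) := by
  simpa [Event.lower, add_comm, wordOp] using wordOp_lower (wordOp_slideCap (N := N) hq d x s) k f

theorem eventOp_R2 (hq : 0 < q) (k : ℕ) (x y s : Bool) (f : Stream' (Fin N) → ℝ) :
    eventOp q (cross k y x (!s)) (eventOp q (cross k x y s) f) = f := by
  simpa [Event.lower, add_comm, wordOp] using
    wordOp_lower (v := []) (wordOp_R2 (N := N) hq x y s) k f

theorem eventOp_R2' (hq : 0 < q) (k : ℕ) (x y s : Bool) (f : Stream' (Fin N) → ℝ) :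
    eventOp q (cross k y x s) (eventOp q (cross k x y (!s)) f) = f := by
  simpa using eventOp_R2 hq k x y (!s) f

theorem eventOp_R1_cup (hq : 0 < q) (k : ℕ) (d s : Bool) (f : Stream' (Fin N) → ℝ) :
    eventOp q (cross k d (!d) s) (eventOp q (cup k d) f) = eventOp q (cup k (!d)) f := by
  simpa [Event.lower, add_comm, wordOp] using wordOp_lower (wordOp_R1_cup (N := N) hq d s) k f

theorem eventOp_R1_cap (hq : 0 < q) (k : ℕ) (d s : Bool) (f : Stream' (Fin N) → ℝ) :
    eventOp q (cap k (!d)) (eventOp q (cross k d (!d) s) f) = eventOp q (cap k d) f := by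
  simpa [Event.lower, add_comm, wordOp] using wordOp_lower (wordOp_R1_cap (N := N) hq d s) k f

open Stream' in
theorem eventOp_straighten₁ (hq : 0 < q) (k : ℕ) (x : Bool) (f : Stream' (Fin N) → ℝ) :
    eventOp q (cap (k + 1) (!x)) (eventOp q (cup k x) f) = f := by
  have : ∀ f : Stream' (Fin N) → ℝ, wordOp q [cup 0 x, cap 1 (!x)] f = wordOp q [] f := by
    intro f
    funext σ
    rw [← Stream'.eta σ]
    simp only [wordOp, eventOp, lowerOp, pieceOp_cap, head_cons, tail_cons, pieceOp_cup]
    have := capWeight_mul_cupWeight_not hq (!x) σ.head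
    rw [Bool.not_not] at this
    simp [← mul_assoc, this]
  simpa [Event.lower, add_comm, wordOp] using wordOp_lower this k f

open Stream' in
theorem eventOp_straighten₂ (hq : 0 < q) (k : ℕ) (x : Bool) (f : Stream' (Fin N) → ℝ) :
    eventOp q (cap k x) (eventOp q (cup (k + 1) (!x)) f) = f := by
  have : ∀ f : Stream' (Fin N) → ℝ, wordOp q [cup 1 (!x), cap 0 x] f = wordOp q [] f := by
    intro f
    funext σ
    rw [← Stream'.eta σ]
    simp only [wordOp, eventOp, lowerOp, pieceOp_cap, head_cons, tail_cons, pieceOp_cup]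
    have := capWeight_mul_cupWeight_not hq x σ.head
    simp [← mul_assoc, this]
  simpa [Event.lower, add_comm, wordOp] using wordOp_lower this k f

/-- The third Reidemeister move for three strands of given directions, and given signs. -/
def YangBaxter (N : ℕ) (q : ℝ) (x y t s₁₂ s₁₃ s₂₃ : Bool) : Prop :=
  ∀ (k : ℕ) (f : Stream' (Fin N) → ℝ),
    eventOp q (cross k y t s₂₃) (eventOp q (cross (k + 1) x t s₁₃)
        (eventOp q (cross k x y s₁₂) f)) =
      eventOp q (cross (k + 1) x y s₁₂) (eventOp q (cross k x t s₁₃)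
        (eventOp q (cross (k + 1) y t s₂₃) f))

theorem YangBaxter.parallel (hq : 0 < q) (x : Bool) : YangBaxter N q x x x true true true := by
  intro k f
  simpa [Event.lower, add_comm, wordOp] using
    wordOp_lower (wordOp_parallel_R3 (N := N) hq x) k f

/-- Crossings at distance two commute. -/
theorem eventOp_cross_comm (k m : ℕ) (x y s : Bool) (p : Piece) (f : Stream' (Fin N) → ℝ) :
    eventOp q ⟨k + 2 + m, p⟩ (eventOp q (cross k x y s) f) =
      eventOp q (cross k x y s) (eventOp q ⟨k + 2 + m, p⟩ f) :=
  eventOp_exchange q k m (.cross x y s) p f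

theorem eventOp_cup_comm (k m : ℕ) (d : Bool) (p : Piece) (f : Stream' (Fin N) → ℝ) :
    eventOp q ⟨k + 2 + m, p⟩ (eventOp q (cup k d) f) =
      eventOp q (cup k d) (eventOp q ⟨k + m, p⟩ f) :=
  eventOp_exchange q k m (.cup d) p f

theorem eventOp_cap_comm (k m : ℕ) (d : Bool) (p : Piece) (f : Stream' (Fin N) → ℝ) :
    eventOp q ⟨k + m, p⟩ (eventOp q (cap k d) f) =
      eventOp q (cap k d) (eventOp q ⟨k + 2 + m, p⟩ f) :=
  eventOp_exchange q k m (.cap d) p f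

theorem eventOp_slideCup₁ (hq : 0 < q) (k : ℕ) (d x s : Bool) (f : Stream' (Fin N) → ℝ) :
    eventOp q (cross k d x s) (eventOp q (cross (k + 1) (!d) x s) (eventOp q (cup k d) f)) =
      eventOp q (cup (k + 1) d) f := by
  rw [eventOp_slideCup hq, eventOp_R2' hq]

theorem eventOp_slideCup₂ (hq : 0 < q) (k : ℕ) (d x s : Bool) (f : Stream' (Fin N) → ℝ) :
    eventOp q (cross (k + 1) x (!d) s) (eventOp q (cross k x d s) (eventOp q (cup (k + 1) d) f)) =
      eventOp q (cup k d) f := by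
  have := eventOp_slideCup hq k d x (!s) f
  rw [Bool.not_not] at this
  rw [← this, eventOp_R2' hq]

theorem eventOp_slideCap₁ (hq : 0 < q) (k : ℕ) (d x s : Bool) (f : Stream' (Fin N) → ℝ) :
    eventOp q (cap k d) (eventOp q (cross (k + 1) x (!d) s) (eventOp q (cross k x d s) f)) =
      eventOp q (cap (k + 1) d) f := by
  rw [eventOp_slideCap hq, eventOp_R2 hq]

theorem eventOp_slideCap₂ (hq : 0 < q) (k : ℕ) (d x s : Bool) (f : Stream' (Fin N) → ℝ) :
    eventOp q (cap (k + 1) d) (eventOp q (cross k d x s) (eventOp q (cross (k + 1) (!d) x s) f)) =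
      eventOp q (cap k d) f := by
  have := eventOp_slideCap hq k d x (!s) (eventOp q (cross (k + 1) (!d) x s) f)
  rw [Bool.not_not] at this
  rw [← this, eventOp_R2 hq]

/-- Reversal of the first strand. -/
theorem YangBaxter.bend_first (hq : 0 < q) {x y t : Bool}
    (h : YangBaxter N q (!x) y t true true true) : YangBaxter N q x y t true true true := by
  -- Here the first strand is the lower branch of a cup. Apply to both sides the crossings of the
  -- upper branch with the strands `t` and `y`, which are invertible. The hypothesis then applies to
  -- the upper branch, of direction `!x`, and the cup slides past the other two strands on each
  -- side.
  have main : ∀ k (g : Stream' (Fin N) → ℝ),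
      eventOp q (cross (k + 1) y t true) (eventOp q (cross (k + 2) x t true)
        (eventOp q (cross (k + 1) x y true) (eventOp q (cup k (!x)) g))) =
      eventOp q (cross (k + 2) x y true) (eventOp q (cross (k + 1) x t true)
        (eventOp q (cross (k + 2) y t true) (eventOp q (cup k (!x)) g))) := by
    intro k g
    have cancel : ∀ u v : Stream' (Fin N) → ℝ,
        eventOp q (cross (k + 1) (!x) y true) (eventOp q (cross k (!x) t true) u) =
          eventOp q (cross (k + 1) (!x) y true) (eventOp q (cross k (!x) t true) v) → u = v := by
      intro u v huv
      rw [← eventOp_R2 hq k (!x) t true u, ← eventOp_R2 hq (k + 1) (!x) y true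
        (eventOp q (cross k (!x) t true) u), huv, eventOp_R2 hq, eventOp_R2 hq]
    apply cancel
    have e1 (f : Stream' (Fin N) → ℝ) := eventOp_slideCup₁ hq k (!x) y true f
    have e2 (f : Stream' (Fin N) → ℝ) := eventOp_slideCup₁ hq (k + 1) (!x) t true f
    have e3 (f : Stream' (Fin N) → ℝ) := eventOp_slideCup₁ hq k (!x) t true f
    have e4 (f : Stream' (Fin N) → ℝ) := eventOp_slideCup₁ hq (k + 1) (!x) y true f
    have c1 (f : Stream' (Fin N) → ℝ) :=
      eventOp_cross_comm (q := q) k 0 (!x) y true (.cross x t true) f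
    have c2 (f : Stream' (Fin N) → ℝ) :=
      eventOp_cross_comm (q := q) k 0 (!x) t true (.cross x y true) f
    have c3 (f : Stream' (Fin N) → ℝ) := eventOp_cup_comm (q := q) k 0 (!x) (.cross y t true) f
    have c4 (f : Stream' (Fin N) → ℝ) :=
      eventOp_cross_comm (q := q) k 0 y t true (.cup (!x)) f
    simp only [Bool.not_not, add_zero, add_assoc, Nat.reduceAdd] at e1 e2 e3 e4 c1 c2 c3 c4
    rw [← h, ← c1, e1, e2, ← c2, c3, e3, e4, c4]
  intro k f
  have c1 (p : Piece) (f : Stream' (Fin N) → ℝ) := eventOp_cap_comm (q := q) k 0 x p f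
  have c2 (p : Piece) (f : Stream' (Fin N) → ℝ) := eventOp_cap_comm (q := q) k 1 x p f
  simp only [add_zero, add_assoc, Nat.reduceAdd] at c1 c2
  -- Insert a zigzag into the first strand. Its cap commutes past the three crossings, which leaves
  -- a cup whose lower branch takes part in them.
  rw [← eventOp_straighten₂ hq k x f, c1, c2, c1, c2, c1, c2, main (k + 1)]

/-- Reversal of the third strand. -/
theorem YangBaxter.bend_third (hq : 0 < q) {x y t : Bool}
    (h : YangBaxter N q x y (!t) true true true) : YangBaxter N q x y t true true true := by
  -- The mirror image of the preceding argument: the third strand is now the upper branch of a cup,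
  -- and the hypothesis applies to the lower one.
  have main : ∀ k (g : Stream' (Fin N) → ℝ),
      eventOp q (cross k y t true) (eventOp q (cross (k + 1) x t true)
        (eventOp q (cross k x y true) (eventOp q (cup (k + 2) t) g))) =
      eventOp q (cross (k + 1) x y true) (eventOp q (cross k x t true)
        (eventOp q (cross (k + 1) y t true) (eventOp q (cup (k + 2) t) g))) := by
    intro k g
    have cancel : ∀ u v : Stream' (Fin N) → ℝ,
        eventOp q (cross (k + 1) y (!t) true) (eventOp q (cross (k + 2) x (!t) true) u) =
          eventOp q (cross (k + 1) y (!t) true) (eventOp q (cross (k + 2) x (!t) true) v) →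
        u = v := by
      intro u v huv
      rw [← eventOp_R2 hq (k + 2) x (!t) true u, ← eventOp_R2 hq (k + 1) y (!t) true
        (eventOp q (cross (k + 2) x (!t) true) u), huv, eventOp_R2 hq, eventOp_R2 hq]
    apply cancel
    have e1 (f : Stream' (Fin N) → ℝ) := eventOp_slideCup₂ hq (k + 1) t x true f
    have e2 (f : Stream' (Fin N) → ℝ) := eventOp_slideCup₂ hq k t y true f
    have e3 (f : Stream' (Fin N) → ℝ) := eventOp_slideCup₂ hq (k + 1) t y true f
    have e4 (f : Stream' (Fin N) → ℝ) := eventOp_slideCup₂ hq k t x true f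
    have c1 (f : Stream' (Fin N) → ℝ) :=
      eventOp_cross_comm (q := q) k 0 y t true (.cross x (!t) true) f
    have c2 (f : Stream' (Fin N) → ℝ) :=
      eventOp_cross_comm (q := q) k 0 x t true (.cross y (!t) true) f
    have c3 (f : Stream' (Fin N) → ℝ) := eventOp_cup_comm (q := q) k 0 t (.cross x y true) f
    have c4 (f : Stream' (Fin N) → ℝ) :=
      eventOp_cross_comm (q := q) k 0 x y true (.cup t) f
    have h' := h (k + 1)
    simp only [add_zero, add_assoc, Nat.reduceAdd] at e1 e2 e3 e4 c1 c2 c3 c4 h'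
    rw [c1, ← c4, e1, e2, h', c2, e3, e4, c3]
  intro k f
  have c1 (x y s : Bool) (f : Stream' (Fin N) → ℝ) :=
    eventOp_cross_comm (q := q) k 1 x y s (.cap (!t)) f
  have c2 (x y s : Bool) (f : Stream' (Fin N) → ℝ) :=
    eventOp_cross_comm (q := q) (k + 1) 0 x y s (.cap (!t)) f
  simp only [add_zero, add_assoc, Nat.reduceAdd] at c1 c2
  rw [← eventOp_straighten₁ hq (k + 2) t f, ← c1, ← c2, ← c1, ← c2, ← c1, ← c2, main k]

/-- Reversing the first and third strands when necessary gives them the direction of the middle one,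
which is the parallel case. -/
theorem YangBaxter.all_true (hq : 0 < q) (x y t : Bool) : YangBaxter N q x y t true true true := by
  have h1 : YangBaxter N q x y y true true true := by
    by_cases h : x = y
    · subst h; exact .parallel hq x
    · apply YangBaxter.bend_first hq
      rw [Bool.eq_not_of_ne h, Bool.not_not]
      exact .parallel hq y
  by_cases h : t = y
  · subst h; exact h1
  · apply YangBaxter.bend_third hq
    rwa [Bool.eq_not_of_ne h, Bool.not_not]

/-- By the second Reidemeister move this is the equation between the inverses of the two sides of
`YangBaxter.all_true`. -/
theorem YangBaxter.all_false (hq : 0 < q) (x y t : Bool) :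
    YangBaxter N q x y t false false false := by
  intro k f
  have h := YangBaxter.all_true (N := N) hq t y x k
    (eventOp q (cross k y t false) (eventOp q (cross (k + 1) x t false)
        (eventOp q (cross k x y false) f)))
  have r (k : ℕ) (x y : Bool) (f : Stream' (Fin N) → ℝ) := eventOp_R2' hq k x y true f
  have r' (k : ℕ) (x y : Bool) (f : Stream' (Fin N) → ℝ) := eventOp_R2' hq k x y false f
  simp only [Bool.not_true, Bool.not_false] at r r'
  rw [r, r, r] at h
  conv_rhs => rw [h, r', r', r']

/-- Conjugation by the crossing of the first two strands. -/
theorem YangBaxter.swap_first (hq : 0 < q) {x y t s s₁₂ : Bool}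
    (h : YangBaxter N q y x t s₁₂ s s) : YangBaxter N q x y t (!s₁₂) s s := by
  intro k f
  have := h k (eventOp q (cross k x y (!s₁₂)) f)
  rw [eventOp_R2' hq] at this
  rw [this, eventOp_R2 hq]

/-- Conjugation by the crossing of the last two strands. -/
theorem YangBaxter.swap_last (hq : 0 < q) {x y t s s₂₃ : Bool}
    (h : YangBaxter N q x t y s s s₂₃) : YangBaxter N q x y t s s (!s₂₃) := by
  intro k f
  have := h k (eventOp q (cross (k + 1) y t (!s₂₃)) f)
  rw [eventOp_R2' hq] at this
  rw [← this, eventOp_R2 hq]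

/-- Of the eight patterns of overcrossings two are constant; conjugating these by the first or the
last crossing yields four more. The remaining two are the cyclic ones. -/
theorem YangBaxter.of_not_cyclic (hq : 0 < q) {x y t s₁₂ s₁₃ s₂₃ : Bool}
    (h : ¬ (s₁₂ = s₂₃ ∧ s₁₃ ≠ s₁₂)) : YangBaxter N q x y t s₁₂ s₁₃ s₂₃ := by
  have all (s x y t : Bool) : YangBaxter N q x y t s s s := by
    cases s
    · exact .all_false hq x y t
    · exact .all_true hq x y t
  by_cases h12 : s₁₃ = s₁₂
  · subst h12
    by_cases h23 : s₂₃ = s₁₃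
    · subst h23; exact all _ _ _ _
    · rw [Bool.eq_not_of_ne h23]; exact .swap_last hq (all _ _ _ _)
  · have h23 : s₂₃ = s₁₃ := by
      revert h h12; cases s₁₂ <;> cases s₁₃ <;> cases s₂₃ <;> simp
    subst h23
    rw [Bool.eq_not_of_ne (Ne.symm h12)]; exact .swap_first hq (all _ _ _ _)

theorem wordOp_linkMove (hq : 0 < q) {l r : List Event} (h : LinkMove l r)
    (f : Stream' (Fin N) → ℝ) : wordOp q l f = wordOp q r f := by
  cases h with
  | exchange l r h => exact wordOp_exchange q h f
  | straighten₁ k x => exact eventOp_straighten₁ hq k x f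
  | straighten₂ k x => exact eventOp_straighten₂ hq k x f
  | slideCup₁ k d x s => exact eventOp_slideCup₁ hq k d x s f
  | slideCup₂ k d x s => exact eventOp_slideCup₂ hq k d x s f
  | slideCap₁ k d x s => exact eventOp_slideCap₁ hq k d x s f
  | slideCap₂ k d x s => exact eventOp_slideCap₂ hq k d x s f
  | reidemeister1Cup k d s => exact eventOp_R1_cup hq k d s f
  | reidemeister1Cap k d s => exact eventOp_R1_cap hq k d s f
  | reidemeister2 k x y s => exact eventOp_R2 hq k x y s f
  | reidemeister3 k x y t s₁₂ s₁₃ s₂₃ h => exact YangBaxter.of_not_cyclic hq h k f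

end VertexModel

/-! ### Words of events and isotopy of tangles -/

/-- Lower a word by `n` strands. -/
def lowerWord (n : ℕ) (w : List Event) : List Event := w.map (Event.lower n)

@[simp] theorem lowerWord_nil (n : ℕ) : lowerWord n [] = [] := rfl

@[simp] theorem lowerWord_cons (n : ℕ) (k : ℕ) (p : Piece) (w : List Event) :
    lowerWord n (⟨k, p⟩ :: w) = ⟨k + n, p⟩ :: lowerWord n w := rfl

@[simp] theorem lowerWord_append (n : ℕ) (w w' : List Event) :
    lowerWord n (w ++ w') = lowerWord n w ++ lowerWord n w' := List.map_append ..

@[simp] theorem lowerWord_zero (w : List Event) : lowerWord 0 w = w := by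
  have : Event.lower 0 = id := rfl
  simp [lowerWord, this]

theorem lowerWord_lowerWord (m n : ℕ) (w : List Event) :
    lowerWord m (lowerWord n w) = lowerWord (n + m) w := by
  simp [lowerWord, Event.lower, Function.comp_def, add_assoc]

theorem Runs.single {a b : List Bool} {k : ℕ} {p : Piece} (u v : List Bool)
    (hk : k = u.length) (ha : a = u ++ p.dom ++ v) (hb : b = u ++ p.cod ++ v) :
    Runs a [⟨k, p⟩] b := by
  subst hk ha hb
  exact .cons u v p [] _ (.nil _)

theorem Runs.append {a b c : List Bool} {w w' : List Event} (h : Runs a w b) (h' : Runs b w' c) :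
    Runs a (w ++ w') c := by
  induction h with
  | nil => exact h'
  | cons u v p w b _ ih => exact .cons u v p _ _ (ih h')

theorem Runs.cons_inv {a b : List Bool} {k : ℕ} {p : Piece} {w : List Event}
    (h : Runs a (⟨k, p⟩ :: w) b) :
    ∃ u v, k = u.length ∧ a = u ++ p.dom ++ v ∧ Runs (u ++ p.cod ++ v) w b := by
  cases h with
  | cons u v p w b h => exact ⟨u, v, rfl, rfl, h⟩

theorem Runs.nil_inv {a b : List Bool} (h : Runs a [] b) : a = b := by
  cases h; rfl

theorem Runs.single_inv {a b : List Bool} {k : ℕ} {p : Piece} (h : Runs a [⟨k, p⟩] b) :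
    ∃ u v, k = u.length ∧ a = u ++ p.dom ++ v ∧ b = u ++ p.cod ++ v := by
  obtain ⟨u, v, h1, h2, h3⟩ := h.cons_inv
  exact ⟨u, v, h1, h2, h3.nil_inv.symm⟩

theorem Runs.append_inv {a c : List Bool} {w w' : List Event} (h : Runs a (w ++ w') c) :
    ∃ b, Runs a w b ∧ Runs b w' c := by
  induction w generalizing a with
  | nil => exact ⟨a, .nil a, h⟩
  | cons e w ih =>
    obtain ⟨k, p⟩ := e
    obtain ⟨u, v, rfl, rfl, h3⟩ := Runs.cons_inv h
    obtain ⟨b, hb, hb'⟩ := ih h3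
    exact ⟨b, .cons u v p w b hb, hb'⟩

theorem Runs.frame {a b : List Bool} {w : List Event} (h : Runs a w b) (x y : List Bool) :
    Runs (x ++ a ++ y) (lowerWord x.length w) (x ++ b ++ y) := by
  induction h with
  | nil => exact .nil _
  | cons u v p w b _ ih =>
    have := Runs.cons (x ++ u) (v ++ y) p _ _ (by simpa using ih)
    simpa [add_comm] using this

theorem LinkMove.lower {l r : List Event} (h : LinkMove l r) (n : ℕ) :
    LinkMove (lowerWord n l) (lowerWord n r) := by
  cases h with
  | exchange l r h =>
    obtain ⟨k, m, p, q⟩ := h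
    have := LinkMove.exchange _ _ (.mk (k + n) m p q)
    simpa [add_right_comm _ n] using this
  | straighten₁ k x => simpa [add_right_comm _ n] using LinkMove.straighten₁ (k + n) x
  | straighten₂ k x => simpa [add_right_comm _ n] using LinkMove.straighten₂ (k + n) x
  | slideCup₁ k d x s => simpa [add_right_comm _ n] using LinkMove.slideCup₁ (k + n) d x s
  | slideCup₂ k d x s => simpa [add_right_comm _ n] using LinkMove.slideCup₂ (k + n) d x s
  | slideCap₁ k d x s => simpa [add_right_comm _ n] using LinkMove.slideCap₁ (k + n) d x s
  | slideCap₂ k d x s => simpa [add_right_comm _ n] using LinkMove.slideCap₂ (k + n) d x s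
  | reidemeister1Cup k d s => exact LinkMove.reidemeister1Cup (k + n) d s
  | reidemeister1Cap k d s => exact LinkMove.reidemeister1Cap (k + n) d s
  | reidemeister2 k x y s => exact LinkMove.reidemeister2 (k + n) x y s
  | reidemeister3 k x y t s₁₂ s₁₃ s₂₃ h =>
    simpa [add_right_comm _ n] using LinkMove.reidemeister3 (k + n) x y t s₁₂ s₁₃ s₂₃ h

/-- Isotopy of tangles with boundary stacks `a` and `b`. -/
inductive TangleIso (a b : List Bool) : List Event → List Event → Prop
  | refl (w : List Event) : Runs a w b → TangleIso a b w w
  | move (u l r v : List Event) : LinkMove l r → Runs a (u ++ l ++ v) b →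
      Runs a (u ++ r ++ v) b → TangleIso a b (u ++ l ++ v) (u ++ r ++ v)
  | symm (w w' : List Event) : TangleIso a b w w' → TangleIso a b w' w
  | trans (w w' w'' : List Event) : TangleIso a b w w' → TangleIso a b w' w'' →
      TangleIso a b w w''

namespace TangleIso

variable {a b c d : List Bool} {w w' w'' u v : List Event}

theorem symm' (h : TangleIso a b w w') : TangleIso a b w' w := .symm _ _ h

theorem trans' (h : TangleIso a b w w') (h' : TangleIso a b w' w'') : TangleIso a b w w'' :=
  .trans _ _ _ h h'

theorem runs (h : TangleIso a b w w') : Runs a w b ∧ Runs a w' b := by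
  induction h with
  | refl w h => exact ⟨h, h⟩
  | move u l r v _ h h' => exact ⟨h, h'⟩
  | symm w w' _ ih => exact ih.symm
  | trans w w' w'' _ _ ih ih' => exact ⟨ih.1, ih'.2⟩

theorem of_move {l r : List Event} (h : LinkMove l r) (hl : Runs a l b) (hr : Runs a r b) :
    TangleIso a b l r := by
  simpa using move [] l r [] h (by simpa using hl) (by simpa using hr)

theorem append_left (h : TangleIso b c w w') (hu : Runs a u b) :
    TangleIso a c (u ++ w) (u ++ w') := by
  induction h with
  | refl w h => exact .refl _ (hu.append h)
  | move u' l r v hm h h' =>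
    have := move (u ++ u') l r v hm (by simpa using hu.append h) (by simpa using hu.append h')
    simpa using this
  | symm w w' _ ih => exact ih.symm'
  | trans w w' w'' _ _ ih ih' => exact ih.trans' ih'

theorem append_right (h : TangleIso a b w w') (hv : Runs b v c) :
    TangleIso a c (w ++ v) (w' ++ v) := by
  induction h with
  | refl w h => exact .refl _ (h.append hv)
  | move u l r v' hm h h' =>
    have := move u l r (v' ++ v) hm (by simpa using h.append hv) (by simpa using h'.append hv)
    simpa using this
  | symm w w' _ ih => exact ih.symm'
  | trans w w' w'' _ _ ih ih' => exact ih.trans' ih'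

theorem frame (h : TangleIso a b w w') (x y : List Bool) :
    TangleIso (x ++ a ++ y) (x ++ b ++ y) (lowerWord x.length w) (lowerWord x.length w') := by
  induction h with
  | refl w h => exact .refl _ (h.frame x y)
  | move u l r v hm h h' =>
    have := move (lowerWord x.length u) _ _ (lowerWord x.length v) (hm.lower x.length)
      (by simpa using h.frame x y) (by simpa using h'.frame x y)
    simpa using this
  | symm w w' _ ih => exact ih.symm'
  | trans w w' w'' _ _ ih ih' => exact ih.trans' ih'

theorem exchange (u m v : List Bool) (p r : Piece) :
    TangleIso (u ++ p.dom ++ m ++ r.dom ++ v) (u ++ p.cod ++ m ++ r.cod ++ v)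
      [⟨u.length, p⟩, ⟨u.length + p.cod.length + m.length, r⟩]
      [⟨u.length + p.dom.length + m.length, r⟩, ⟨u.length, p⟩] := by
  refine of_move (.exchange _ _ (.mk ..)) ?_ ?_
  · have h1 : Runs (u ++ p.dom ++ m ++ r.dom ++ v) [⟨u.length, p⟩]
        (u ++ p.cod ++ m ++ r.dom ++ v) :=
      .single u (m ++ r.dom ++ v) rfl (by simp) (by simp)
    exact h1.append (.single (u ++ p.cod ++ m) v (by simp; omega) (by simp) (by simp))
  · have h1 : Runs (u ++ p.dom ++ m ++ r.dom ++ v) [⟨u.length + p.dom.length + m.length, r⟩]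
        (u ++ p.dom ++ m ++ r.cod ++ v) :=
      .single (u ++ p.dom ++ m) v (by simp; omega) (by simp) (by simp)
    exact h1.append (.single u (m ++ r.cod ++ v) rfl (by simp) (by simp))

/-- A piece above a word may be performed after it. -/
theorem exchange_above (h : Runs c w d) (u m : List Bool) (p : Piece) :
    TangleIso (u ++ p.dom ++ m ++ c) (u ++ p.cod ++ m ++ d)
      (⟨u.length, p⟩ :: lowerWord (u.length + p.cod.length + m.length) w)
      (lowerWord (u.length + p.dom.length + m.length) w ++ [⟨u.length, p⟩]) := by
  induction h with
  | nil c => exact .refl _ (.single u (m ++ c) rfl (by simp) (by simp))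
  | cons c₁ c₂ q w d hw ih =>
    have h1 := exchange u (m ++ c₁) c₂ p q
    have h2 : Runs (u ++ p.cod ++ (m ++ c₁) ++ q.cod ++ c₂)
        (lowerWord (u.length + p.cod.length + m.length) w) (u ++ p.cod ++ m ++ d) := by
      simpa [add_assoc] using hw.frame (u ++ p.cod ++ m) []
    have h3 : Runs (u ++ p.dom ++ m ++ (c₁ ++ q.dom ++ c₂))
        [⟨c₁.length + (u.length + p.dom.length + m.length), q⟩]
        (u ++ p.dom ++ m ++ (c₁ ++ q.cod ++ c₂)) :=
      .single (u ++ p.dom ++ m ++ c₁) c₂ (by simp; omega) (by simp) (by simp)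
    have h4 := ih.append_left h3
    have h5 := h1.append_right h2
    refine trans' (w' := [⟨c₁.length + (u.length + p.dom.length + m.length), q⟩] ++
      ⟨u.length, p⟩ :: lowerWord (u.length + p.cod.length + m.length) w) ?_ (by simpa using h4)
    simpa [add_comm, add_left_comm, add_assoc] using h5

/-- A piece below a word may be performed before it. -/
theorem exchange_below (h : Runs c w d) (m : List Bool) (r : Piece) :
    TangleIso (c ++ m ++ r.dom) (d ++ m ++ r.cod) (w ++ [⟨d.length + m.length, r⟩])
      (⟨c.length + m.length, r⟩ :: w) := by
  induction h with
  | nil c => exact .refl _ (.single (c ++ m) [] (by simp) (by simp) (by simp))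
  | cons c₁ c₂ p w d hw ih =>
    have h1 := exchange c₁ (c₂ ++ m) [] p r
    have h2 : Runs (c₁ ++ p.cod ++ (c₂ ++ m) ++ r.cod) w (d ++ m ++ r.cod) := by
      simpa using hw.frame [] (m ++ r.cod)
    have h3 : Runs (c₁ ++ p.dom ++ c₂ ++ m ++ r.dom) [⟨c₁.length, p⟩]
        (c₁ ++ p.cod ++ c₂ ++ m ++ r.dom) :=
      .single c₁ (c₂ ++ m ++ r.dom) rfl (by simp) (by simp)
    have h4 := ih.append_left h3
    have h5 := h1.append_right (v := w) (c := d ++ m ++ r.cod) (by simpa using h2)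
    refine trans' (by simpa using h4) ?_
    simpa [add_comm, add_left_comm, add_assoc] using h5

/-- A circle below a word may be moved past it. -/
theorem circle (h : Runs a w b) (x : Bool) :
    TangleIso a b ([cup a.length x, cap a.length x] ++ w)
      (w ++ [cup b.length x, cap b.length x]) := by
  have h1 := (exchange_below h [] (.cup x)).symm'
  have h2 := (exchange_below h [] (.cap x)).symm'
  simp only [Piece.dom, Piece.cod, List.append_nil, List.length_nil, add_zero] at h1 h2
  have h3 := h2.append_left (a := a) (u := [cup a.length x])
    (.single a [] rfl (by simp [Piece.dom]) (by simp [Piece.cod]))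
  have h4 := h1.append_right (v := [cap b.length x]) (c := b)
    (.single b [] rfl (by simp [Piece.dom]) (by simp [Piece.cod]))
  exact trans' (by simpa using h3) (by simpa using h4)

end TangleIso

/-! ### Pulling strands over stacks of strands -/

/-- A strand of direction `d` below the strands `l`, at height `k + l.length`, is pulled up over
them. -/
def pullUp : ℕ → List Bool → Bool → List Event
  | _, [], _ => []
  | k, y :: l, d => pullUp (k + 1) l d ++ [cross k y d false]

/-- A strand of direction `d` above the strands `l`, at height `k`, is pulled down over them. -/
def pullDown : ℕ → List Bool → Bool → List Event
  | _, [], _ => []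
  | k, y :: l, d => cross k d y true :: pullDown (k + 1) l d

theorem lowerWord_pullUp (n k : ℕ) (l : List Bool) (d : Bool) :
    lowerWord n (pullUp k l d) = pullUp (k + n) l d := by
  induction l generalizing k with
  | nil => rfl
  | cons y l ih => simp [pullUp, ih, add_right_comm]

theorem lowerWord_pullDown (n k : ℕ) (l : List Bool) (d : Bool) :
    lowerWord n (pullDown k l d) = pullDown (k + n) l d := by
  induction l generalizing k with
  | nil => rfl
  | cons y l ih => simp [pullDown, ih, add_right_comm]

theorem pullUp_append (k : ℕ) (l l' : List Bool) (d : Bool) :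
    pullUp k (l ++ l') d = pullUp (k + l.length) l' d ++ pullUp k l d := by
  induction l generalizing k with
  | nil => simp [pullUp]
  | cons y l ih => simp [pullUp, ih, add_comm, add_left_comm]

theorem runs_pullUp (l : List Bool) (d : Bool) : Runs (l ++ [d]) (pullUp 0 l d) (d :: l) := by
  induction l with
  | nil => exact .nil _
  | cons y l ih =>
    have h := ih.frame [y] []
    rw [lowerWord_pullUp] at h
    simp only [List.append_nil, List.singleton_append, List.length_singleton] at h
    exact h.append (.single [] l rfl rfl rfl)

theorem runs_pullDown (l : List Bool) (d : Bool) : Runs (d :: l) (pullDown 0 l d) (l ++ [d]) := by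
  induction l with
  | nil => exact .nil _
  | cons y l ih =>
    have h := ih.frame [y] []
    rw [lowerWord_pullDown] at h
    simp only [List.append_nil, List.singleton_append, List.length_singleton] at h
    exact .cons [] l (.cross d y true) _ _ (by simpa [Piece.cod] using h)

/-- An elementary piece passes under a strand. -/
theorem TangleIso.pullUp_piece (p : Piece) (d : Bool) :
    TangleIso (p.dom ++ [d]) (d :: p.cod) (⟨0, p⟩ :: pullUp 0 p.cod d)
      (pullUp 0 p.dom d ++ [⟨1, p⟩]) := by
  have h1 : Runs (p.dom ++ [d]) (⟨0, p⟩ :: pullUp 0 p.cod d) (d :: p.cod) :=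
    .cons [] [d] p _ _ (runs_pullUp p.cod d)
  have h2 : Runs (p.dom ++ [d]) (pullUp 0 p.dom d ++ [⟨1, p⟩]) (d :: p.cod) :=
    (runs_pullUp p.dom d).append (.single [d] [] rfl (by simp) (by simp))
  cases p with
  | cup x => exact of_move (.slideCup₁ 0 x d false) h1 h2
  | cap x => exact (of_move (.slideCap₂ 0 x d false) h2 h1).symm'
  | cross x y s =>
    exact of_move (.reidemeister3 0 x y d s false false (by simp)) h1 h2

/-- An elementary piece passes under a strand, within a larger stack. -/
theorem TangleIso.pullUp_event (l₁ l₂ : List Bool) (p : Piece) (d : Bool) :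
    TangleIso (l₁ ++ p.dom ++ l₂ ++ [d]) (d :: (l₁ ++ p.cod ++ l₂))
      (⟨l₁.length, p⟩ :: pullUp 0 (l₁ ++ p.cod ++ l₂) d)
      (pullUp 0 (l₁ ++ p.dom ++ l₂) d ++ [⟨l₁.length + 1, p⟩]) := by
  -- The pulled strand first passes `l₂`, which lies below the piece (`h1`), then the piece itself
  -- (`h2`), then `l₁`, which lies above it (`h3`).
  have h1 := exchange_above (runs_pullUp l₂ d) l₁ [] p
  have h2 := (pullUp_piece p d).frame l₁ l₂
  have h3 := exchange_below (runs_pullUp l₁ d) [] p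
  have h3 := h3.frame [] l₂
  simp only [lowerWord_pullUp, lowerWord_append, lowerWord_cons, lowerWord_nil, List.append_nil,
    List.length_nil, add_zero, zero_add, List.append_assoc, List.length_append, List.cons_append,
    List.nil_append, List.length_cons] at h1 h2 h3
  have r1 : Runs (l₁ ++ (p.cod ++ d :: l₂)) (pullUp l₁.length p.cod d ++ pullUp 0 l₁ d)
      (d :: (l₁ ++ (p.cod ++ l₂))) := by
    have a1 := (runs_pullUp p.cod d).frame l₁ l₂
    have a2 := (runs_pullUp l₁ d).frame [] (p.cod ++ l₂)
    simp [lowerWord_pullUp] at a1 a2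
    exact a1.append a2
  have r2 : Runs (l₁ ++ (p.dom ++ (l₂ ++ [d]))) (pullUp (l₁.length + p.dom.length) l₂ d)
      (l₁ ++ (p.dom ++ d :: l₂)) := by
    simpa [lowerWord_pullUp] using (runs_pullUp l₂ d).frame (l₁ ++ p.dom) []
  have r3 : Runs (l₁ ++ d :: (p.cod ++ l₂)) (pullUp 0 l₁ d) (d :: (l₁ ++ (p.cod ++ l₂))) := by
    simpa using (runs_pullUp l₁ d).frame [] (p.cod ++ l₂)
  have r4 : Runs (l₁ ++ (p.dom ++ d :: l₂)) (pullUp l₁.length p.dom d)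
      (l₁ ++ d :: (p.dom ++ l₂)) := by
    simpa [lowerWord_pullUp] using (runs_pullUp p.dom d).frame l₁ l₂
  have g1 := h1.append_right r1
  have g2 := (h2.append_right r3).append_left r2
  have g3 := (h3.symm'.append_left r4).append_left r2
  simp only [pullUp_append, List.append_assoc, zero_add]
  simp only [List.append_assoc, List.cons_append, List.nil_append, add_comm 1] at g1 g2 g3
  exact (g1.trans' g2).trans' g3

/-- A cup at the bottom of the strands `l`, whose upper branch is pulled up over `l`. -/
def arcWord (l : List Bool) (d : Bool) : List Event := cup l.length d :: pullUp 0 l d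

theorem runs_arcWord (l : List Bool) (d : Bool) : Runs l (arcWord l d) (d :: l ++ [!d]) := by
  have h : Runs l [cup l.length d] (l ++ [d, !d]) :=
    .single l [] rfl (by simp [Piece.dom]) (by simp [Piece.cod])
  have h' := (runs_pullUp l d).frame [] [!d]
  simp only [List.nil_append, List.append_assoc, List.length_nil, lowerWord_zero] at h'
  exact h.append h'

theorem lowerWord_arcWord (n : ℕ) (l : List Bool) (d : Bool) :
    lowerWord n (arcWord l d) = cup (l.length + n) d :: pullUp n l d := by
  simp [arcWord, lowerWord_pullUp]

namespace TangleIso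

/-- A piece inside an arc may be performed before the arc is drawn. -/
theorem arc_event (l₁ l₂ : List Bool) (p : Piece) (d : Bool) :
    TangleIso (l₁ ++ p.dom ++ l₂) (d :: (l₁ ++ p.cod ++ l₂) ++ [!d])
      (⟨l₁.length, p⟩ :: arcWord (l₁ ++ p.cod ++ l₂) d)
      (arcWord (l₁ ++ p.dom ++ l₂) d ++ [⟨l₁.length + 1, p⟩]) := by
  have h1 := exchange l₁ l₂ [] p (.cup d)
  have h2 := (pullUp_event l₁ l₂ p d).frame [] [!d]
  have h3 := (runs_pullUp (l₁ ++ p.cod ++ l₂) d).frame [] [!d]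
  have r : Runs (l₁ ++ p.dom ++ l₂) [cup (l₁ ++ p.dom ++ l₂).length d]
      (l₁ ++ p.dom ++ l₂ ++ [d, !d]) :=
    .single _ [] rfl (by simp [Piece.dom]) (by simp [Piece.cod])
  simp only [List.nil_append, List.append_assoc, List.length_nil, lowerWord_zero, Piece.dom,
    Piece.cod, List.append_nil, List.length_append, List.cons_append] at h1 h2 h3 r
  have h4 := h1.append_right h3
  have h5 := h2.append_left r
  simp only [arcWord, List.append_assoc, List.length_append, List.cons_append, List.nil_append,
    add_assoc] at h4 h5 ⊢
  exact h4.trans' h5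

/-- Joining the upper end of an arc to the strand above it. -/
theorem arc_cap_above (l : List Bool) (x : Bool) :
    TangleIso (x :: l) (l ++ [x]) (lowerWord 1 (arcWord l (!x)) ++ [cap 0 x]) (pullDown 0 l x) := by
  induction l with
  | nil =>
    refine of_move (.straighten₂ 0 x) ?_ (.nil _)
    exact Runs.append (b := [x, !x, x])
      (.single [x] [] rfl (by simp [Piece.dom]) (by simp [Piece.cod]))
      (.single [] [x] rfl (by simp [Piece.dom]) (by simp [Piece.cod]))
  | cons y l ih =>
    have h1 := (ih.frame [y] []).append_left (a := x :: y :: l) (u := [cross 0 x y true])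
      (.single [] l rfl (by simp [Piece.dom]) (by simp [Piece.cod]))
    have h2 := exchange_above (runs_arcWord l (!x)) [] [] (.cross x y true)
    -- The cap slides across `y` after a cancelling pair of crossings is inserted. This trades a
    -- crossing of the arc with `y` for a crossing of the strand `x` with `y`, and the arc has one
    -- strand fewer to cross.
    have h3 : TangleIso [x, y, !x] [y] [cross 1 y (!x) false, cap 0 x]
        [cross 0 x y true, cap 1 x] := by
      have a1 : Runs [x, y, !x] [cross 0 x y true] [y, x, !x] :=
        .single [] [!x] rfl (by simp [Piece.dom]) (by simp [Piece.cod])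
      have a2 : Runs [y, x, !x] [cap 1 x] [y] :=
        .single [y] [] rfl (by simp [Piece.dom]) (by simp [Piece.cod])
      have a3 : Runs [y, x, !x] [cross 0 y x false] [x, y, !x] :=
        .single [] [!x] rfl (by simp [Piece.dom]) (by simp [Piece.cod])
      have a4 : Runs [x, y, !x] [cross 1 y (!x) false] [x, !x, y] :=
        .single [x] [] rfl (by simp [Piece.dom]) (by simp [Piece.cod])
      have a5 : Runs [x, !x, y] [cap 0 x] [y] :=
        .single [] [y] rfl (by simp [Piece.dom]) (by simp [Piece.cod])
      have b1 := of_move (.slideCap₁ 0 x y false) (a3.append (a4.append a5)) a2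
      have b2 := of_move (.reidemeister2 0 x y true) (a1.append a3) (.nil _)
      have b3 := b1.append_left a1
      have b4 := b2.append_right (a4.append a5)
      exact b4.symm'.trans' b3
    have h4 := h3.frame [] (l ++ [x])
    have r1 : Runs (x :: y :: l) (lowerWord 2 (arcWord l (!x))) (x :: y :: (!x) :: l ++ [x]) := by
      simpa using (runs_arcWord l (!x)).frame [x, y] []
    have r2 : Runs (y :: x :: (!x) :: (l ++ [x])) [cap 1 x] (y :: (l ++ [x])) :=
      .single [y] (l ++ [x]) rfl (by simp [Piece.dom]) (by simp [Piece.cod])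
    have h5 := h4.append_left r1
    have h6 := h2.append_right (v := [cap 1 x]) (c := y :: (l ++ [x]))
      (by simpa [Piece.cod] using r2)
    simp only [lowerWord_pullDown, lowerWord_arcWord, lowerWord_append, lowerWord_cons,
      lowerWord_pullUp, lowerWord_nil, zero_add, List.nil_append, List.length_nil,
      List.append_nil, List.cons_append, Piece.cod, Piece.dom,
      List.length_cons, Nat.reduceAdd, add_zero, List.append_assoc] at h1 h5 h6
    simp only [lowerWord_arcWord, pullUp, pullDown, List.length_cons, List.cons_append, zero_add,
      List.append_assoc, List.nil_append, Nat.reduceAdd, add_assoc]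
    exact (h5.trans' h6.symm').trans' h1

/-- Joining the upper end of an arc to the strand below it. -/
theorem arc_cap_below (l : List Bool) (x : Bool) :
    TangleIso ((!x) :: l) (l ++ [!x]) (arcWord ((!x) :: l) x ++ [cap 0 x])
      (pullDown 0 l (!x)) := by
  have h1 := arc_cap_above l (!x)
  have a1 : Runs [!x, x] [cross 0 (!x) x false] [x, !x] :=
    .single [] [] rfl (by simp [Piece.dom]) (by simp [Piece.cod])
  have a2 : Runs [x, !x] [cap 0 x] [] :=
    .single [] [] rfl (by simp [Piece.dom]) (by simp [Piece.cod])
  have a3 : Runs [!x, x] [cap 0 (!x)] [] :=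
    .single [] [] rfl (by simp [Piece.dom]) (by simp [Piece.cod])
  -- The last crossing of the arc is with the very strand to which it is joined, so it is a curl at
  -- the cap. Removing the curl leaves the arc joined to the strand above it.
  have m := LinkMove.reidemeister1Cap 0 (!x) false
  rw [Bool.not_not] at m h1
  have h2 := (of_move m (a1.append a2) a3).frame [] (l ++ [!x])
  have r1 : Runs ((!x) :: l) (lowerWord 1 (arcWord l x)) ((!x) :: x :: l ++ [!x]) := by
    simpa using (runs_arcWord l x).frame [!x] []
  have h3 := h2.append_left r1
  simp only [lowerWord_arcWord, List.nil_append, List.length_nil, List.cons_append,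
    lowerWord_zero] at h1 h3
  simp only [arcWord, pullUp, List.length_cons, List.cons_append, zero_add, List.append_assoc,
    List.nil_append]
  exact h3.trans' h1

/-- Joining the lower end of an arc to the strand above it. -/
theorem arc_cap_bottom (l : List Bool) (x : Bool) :
    TangleIso (l ++ [x]) (x :: l) (arcWord (l ++ [x]) x ++ [cap (l.length + 1) x])
      (pullUp 0 l x) := by
  have h1 := (exchange_below (runs_pullUp l x) [] (.cap x))
  -- A curl on one strand: insert a cancelling pair of crossings, slide the cup past the strand,
  -- remove the resulting curl at the cap and straighten the zigzag.
  have h2 : TangleIso [x] [x] [cup 1 x, cross 0 x x false, cap 1 x] [] := by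
    have a1 : Runs [x] [cup 1 x] [x, x, !x] :=
      .single [x] [] rfl (by simp [Piece.dom]) (by simp [Piece.cod])
    have a2 : Runs [x, x, !x] [cross 0 x x false] [x, x, !x] :=
      .single [] [!x] rfl (by simp [Piece.dom]) (by simp [Piece.cod])
    have a3 : Runs [x, x, !x] [cap 1 x] [x] :=
      .single [x] [] rfl (by simp [Piece.dom]) (by simp [Piece.cod])
    have a4 : Runs [x, x, !x] [cross 1 x (!x) false] [x, !x, x] :=
      .single [x] [] rfl (by simp [Piece.dom]) (by simp [Piece.cod])
    have a5 : Runs [x, !x, x] [cross 1 (!x) x true] [x, x, !x] :=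
      .single [x] [] rfl (by simp [Piece.dom]) (by simp [Piece.cod])
    have a6 : Runs [x] [cup 0 x] [x, !x, x] :=
      .single [] [x] rfl (by simp [Piece.dom]) (by simp [Piece.cod])
    have a7 : Runs [x, !x, x] [cap 1 (!x)] [x] :=
      .single [x] [] rfl (by simp [Piece.dom]) (by simp [Piece.cod])
    have m := LinkMove.reidemeister1Cap 1 (!x) true
    rw [Bool.not_not] at m
    have b1 := of_move (.reidemeister2 1 x (!x) false) (a4.append a5) (.nil _)
    have b2 := of_move (.slideCup₂ 0 x x false) (a1.append (a2.append a4)) a6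
    have b3 := of_move m (a5.append a3) a7
    have b4 := of_move (.straighten₁ 0 x) (a6.append a7) (.nil _)
    have c1 := (b1.append_right a3).append_left (a1.append a2)
    have c2 := b2.append_right (a5.append a3)
    have c3 := b3.append_left a6
    exact ((c1.symm'.trans' c2).trans' c3).trans' b4
  have h2 := h2.frame l []
  have h3 := h2.append_right (v := pullUp 0 l x) (c := x :: l) (by simpa using runs_pullUp l x)
  have r : Runs (l ++ [x]) [cup (l.length + 1) x, cross l.length x x false] (l ++ [x, x, !x]) :=
    .append (b := l ++ [x, x, !x])
      (.single (l ++ [x]) [] (by simp) (by simp [Piece.dom]) (by simp [Piece.cod]))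
      (.single l [!x] rfl (by simp [Piece.dom]) (by simp [Piece.cod]))
  have h4 := h1.append_left (a := l ++ [x]) (by simpa [Piece.dom] using r)
  simp only [lowerWord_cons, lowerWord_nil, List.cons_append, List.nil_append, zero_add,
    List.append_nil, List.length_nil, add_zero, List.length_append, List.length_cons,
    Piece.cod, add_comm 1] at h3 h4
  simp only [arcWord, pullUp_append, pullUp, List.length_append, List.length_cons, List.length_nil,
    zero_add, List.nil_append, List.cons_append]
  exact h4.trans' h3

/-- The lower end of an arc passes under its upper branch and a further strand. -/
theorem arc_cross_bottom (l : List Bool) (x d : Bool) :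
    TangleIso (l ++ [x]) (d :: l ++ [!d, x])
      (arcWord (l ++ [x]) d ++ [cross (l.length + 1) x (!d) false])
      (cup l.length d :: pullUp 0 l d) := by
  have h1 := exchange_below (runs_pullUp l d) [] (.cross x (!d) false)
  have a1 : Runs [x] [cup 1 d] [x, d, !d] :=
    .single [x] [] rfl (by simp [Piece.dom]) (by simp [Piece.cod])
  have a2 : Runs [x, d, !d] [cross 0 x d false] [d, x, !d] :=
    .single [] [!d] rfl (by simp [Piece.dom]) (by simp [Piece.cod])
  have a3 : Runs [d, x, !d] [cross 1 x (!d) false] [d, !d, x] :=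
    .single [d] [] rfl (by simp [Piece.dom]) (by simp [Piece.cod])
  have a4 : Runs [x] [cup 0 d] [d, !d, x] :=
    .single [] [x] rfl (by simp [Piece.dom]) (by simp [Piece.cod])
  have h2 := (of_move (.slideCup₂ 0 d x false) (a1.append (a2.append a3)) a4).frame l []
  have r1 := (runs_pullUp l d).frame [] [!d, x]
  have r2 := (a1.append a2).frame l []
  simp only [lowerWord_cons, lowerWord_nil, List.cons_append, List.nil_append, zero_add,
    List.append_nil, List.length_nil, add_zero, lowerWord_zero, Piece.dom, Piece.cod,
    List.append_assoc, add_comm 1] at h1 h2 r1 r2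
  have h3 := h2.append_right r1
  have h4 := h1.append_left r2
  simp only [List.cons_append, List.nil_append, List.length_cons] at h3 h4
  simp only [arcWord, pullUp_append, pullUp, List.length_append, List.length_cons, List.length_nil,
    zero_add, List.nil_append, List.cons_append]
  exact TangleIso.trans' (by simpa using h4) (by simpa using h3)

end TangleIso

/-! ### Resolution of diagrams into unlinks -/

/-- Standard tangles with empty left boundary: below a standard tangle, arcs are added one by one,
each of them above all the previous ones; there may be circles. -/
inductive Standard : List Bool → List Event → Prop
  | nil : Standard [] []
  | circle (w : List Event) (d : Bool) : Standard [] w → Standard [] (w ++ [cup 0 d, cap 0 d])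
  | arc (u l : List Bool) (d : Bool) (w : List Event) : Standard (u ++ l) w →
      Standard (u ++ d :: l ++ [!d]) (w ++ lowerWord u.length (arcWord l d))

/-- Tangles with empty left boundary that reduce to standard ones by isotopies and skein
relations. -/
inductive Reducible : List Bool → List Event → Prop
  | standard {b : List Bool} {w : List Event} : Standard b w → Reducible b w
  | iso {b : List Bool} {w w' : List Event} : TangleIso [] b w w' → Reducible b w →
      Reducible b w'
  | positive {b : List Bool} (u v : List Event) {p m o : List Event} : LocalSkein p m o →
      Runs [] (u ++ p ++ v) b → Runs [] (u ++ m ++ v) b → Runs [] (u ++ o ++ v) b →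
      Reducible b (u ++ m ++ v) → Reducible b (u ++ o ++ v) → Reducible b (u ++ p ++ v)
  | negative {b : List Bool} (u v : List Event) {p m o : List Event} : LocalSkein p m o →
      Runs [] (u ++ p ++ v) b → Runs [] (u ++ m ++ v) b → Runs [] (u ++ o ++ v) b →
      Reducible b (u ++ p ++ v) → Reducible b (u ++ o ++ v) → Reducible b (u ++ m ++ v)

theorem Standard.runs {b : List Bool} {w : List Event} (h : Standard b w) : Runs [] w b := by
  induction h with
  | nil => exact .nil _
  | circle w d _ ih =>
    exact ih.append (.cons [] [] (.cup d) _ _ (.cons [] [] (.cap d) _ _ (.nil _)))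
  | arc u l d w _ ih => exact ih.append (by simpa using (runs_arcWord l d).frame u [])

namespace Reducible

variable {b c : List Bool} {w w' : List Event}

theorem runs (h : Reducible b w) : Runs [] w b := by
  induction h with
  | standard h => exact h.runs
  | iso h _ _ => exact h.runs.2
  | positive u v _ h _ _ _ _ => exact h
  | negative u v _ _ h _ _ _ => exact h

/-- A reduction of `w` is still one after `x` is appended to all its members, so only the standard
leaves matter. -/
theorem append (h : Reducible b w) {x : List Event} (hx : Runs b x c)
    (H : ∀ w, Standard b w → Reducible c (w ++ x)) : Reducible c (w ++ x) := by
  induction h with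
  | standard h => exact H _ h
  | iso h _ ih => exact iso (h.append_right hx) ih
  | positive u v hs h1 h2 h3 _ _ ih ih' =>
    have := positive (b := c) u (v ++ x) hs (by simpa using h1.append hx)
      (by simpa using h2.append hx) (by simpa using h3.append hx) (by simpa using ih)
      (by simpa using ih')
    simpa using this
  | negative u v hs h1 h2 h3 _ _ ih ih' =>
    have := negative (b := c) u (v ++ x) hs (by simpa using h1.append hx)
      (by simpa using h2.append hx) (by simpa using h3.append hx) (by simpa using ih)
      (by simpa using ih')
    simpa using this

theorem iso_append {x y : List Event} (hw : Runs [] w b) (h : TangleIso b c x y)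
    (hy : Reducible c (w ++ y)) : Reducible c (w ++ x) :=
  iso (h.symm'.append_left hw) hy

theorem arc {u l : List Bool} (h : Reducible (u ++ l) w) (d : Bool) :
    Reducible (u ++ d :: l ++ [!d]) (w ++ lowerWord u.length (arcWord l d)) :=
  h.append (by simpa using (runs_arcWord l d).frame u [])
    fun w hw => standard (.arc u l d w hw)

/-- A piece above an arc. -/
theorem arc_piece_above {u₁ u₂ l : List Bool} {p : Piece} {d : Bool}
    (hw : Runs [] w (u₁ ++ p.dom ++ u₂ ++ l))
    (h : Reducible (u₁ ++ p.cod ++ u₂ ++ l) (w ++ [⟨u₁.length, p⟩])) :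
    Reducible (u₁ ++ p.cod ++ u₂ ++ d :: l ++ [!d])
      (w ++ lowerWord (u₁ ++ p.dom ++ u₂).length (arcWord l d) ++ [⟨u₁.length, p⟩]) := by
  have h1 := (TangleIso.exchange_above (runs_arcWord l d) u₁ u₂ p).symm'
  have h2 := h.arc d
  simp only [List.length_append, List.append_assoc, List.cons_append, List.nil_append]
    at h1 h2 hw ⊢
  refine iso_append hw (by simpa [add_assoc] using h1) ?_
  simpa [add_assoc] using h2

/-- A piece inside an arc. -/
theorem arc_piece_inside {u l₁ l₂ : List Bool} {p : Piece} {d : Bool}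
    (hw : Runs [] w (u ++ (l₁ ++ p.dom ++ l₂)))
    (h : Reducible (u ++ (l₁ ++ p.cod ++ l₂)) (w ++ [⟨(u ++ l₁).length, p⟩])) :
    Reducible (u ++ d :: (l₁ ++ p.cod ++ l₂) ++ [!d])
      (w ++ lowerWord u.length (arcWord (l₁ ++ p.dom ++ l₂) d) ++
        [⟨(u ++ d :: l₁).length, p⟩]) := by
  have h1 := ((TangleIso.arc_event l₁ l₂ p d).frame u []).symm'
  have h2 := h.arc d
  simp only [lowerWord_append, lowerWord_cons, lowerWord_nil, List.append_nil] at h1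
  rw [List.append_assoc w]
  have e1 : (u ++ d :: l₁).length = l₁.length + 1 + u.length := by simp; omega
  have e2 : (u ++ l₁).length = l₁.length + u.length := by simp; omega
  rw [e1]
  rw [e2] at h2
  refine iso_append hw ?_ (by simpa using h2)
  simpa using h1

/-- Adding a cup. -/
theorem cup {k : ℕ} {d : Bool} (h : Reducible b w) (hc : Runs b [cup k d] c) :
    Reducible c (w ++ [cup k d]) := by
  refine h.append hc fun w hw => ?_
  clear h
  -- A cup at the bottom is an arc drawn over no strands.
  have bottom : ∀ {b w}, Standard b w →
      Reducible (b ++ [d, !d]) (w ++ [LegendrianFront.cup b.length d]) := by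
    intro b w hw
    have := standard (.arc b [] d w (by simpa using hw))
    simpa [lowerWord_arcWord, pullUp] using this
  obtain ⟨u', v', rfl, hb, rfl⟩ := hc.single_inv
  simp only [Piece.dom, Piece.cod, List.append_nil] at hb ⊢
  clear hc
  induction hw generalizing u' v' with
  | nil =>
    obtain ⟨rfl, rfl⟩ : u' = [] ∧ v' = [] := by simpa using hb.symm
    simpa using bottom .nil
  | circle w e hw ih =>
    obtain ⟨rfl, rfl⟩ : u' = [] ∧ v' = [] := by simpa using hb.symm
    simpa using bottom (.circle w e hw)
  | arc u l e w hw ih =>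
    rcases List.eq_nil_or_concat v' with rfl | ⟨v'', e', rfl⟩
    · simp only [List.append_nil] at hb ⊢
      subst hb
      exact bottom (.arc u l e w hw)
    · rw [List.concat_eq_append] at hb ⊢
      rw [← List.append_assoc] at hb
      obtain ⟨hb', he⟩ := List.append_inj' hb rfl
      clear hb
      obtain rfl : (!e) = e' := by simpa using he
      -- Anywhere else the cup lies above or inside the last arc and may be performed before it, so
      -- induction applies to the tangle without that arc.
      rcases List.append_eq_append_iff.1 hb' with ⟨m, rfl, hm⟩ | ⟨m, rfl, hm⟩
      · cases m with
        | nil =>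
          simp only [List.append_nil, List.nil_append] at hm hw ih ⊢
          subst hm
          have := arc_piece_above (u₁ := u) (u₂ := []) (l := l) (p := .cup d) (d := e)
            (by simpa [Piece.dom] using hw.runs) (by simpa [Piece.cod] using ih u l rfl)
          simpa [Piece.dom, Piece.cod] using this
        | cons e' l₁ =>
          obtain ⟨rfl, rfl⟩ : e = e' ∧ l = l₁ ++ v'' := by simpa using hm
          have := arc_piece_inside (u := u) (l₁ := l₁) (l₂ := v'') (p := .cup d) (d := e)
            (by simpa [Piece.dom] using hw.runs)
            (by simpa [Piece.cod] using ih (u ++ l₁) v'' (by simp))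
          simpa [Piece.dom, Piece.cod] using this
      · subst hm
        have := arc_piece_above (u₁ := u') (u₂ := m) (l := l) (p := .cup d) (d := e)
          (by simpa [Piece.dom] using hw.runs)
          (by simpa [Piece.cod] using ih u' (m ++ l) (by simp))
        simpa [Piece.dom, Piece.cod] using this

/-- Changing a crossing. -/
theorem switch {u v : List Bool} {x y s : Bool} (h : Reducible (u ++ [x, y] ++ v) w)
    (hcap : ∀ c, Runs (u ++ [x, y] ++ v) [cap u.length x] c →
      Reducible c (w ++ [cap u.length x]))
    (hs : Reducible (u ++ [y, x] ++ v) (w ++ [cross u.length x y (!s)])) :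
    Reducible (u ++ [y, x] ++ v) (w ++ [cross u.length x y s]) := by
  have r : ∀ s, Runs [] (w ++ [cross u.length x y s] ++ []) (u ++ [y, x] ++ v) := fun s => by
    rw [List.append_nil]
    exact h.runs.append (.single u v rfl rfl rfl)
  -- For parallel strands the smoothing is `w` itself. For antiparallel ones it is a cap followed by
  -- a cup, and this is where `hcap` is needed.
  by_cases hxy : y = x
  · subst hxy
    have r' : Runs [] (w ++ [] ++ []) (u ++ [y, y] ++ v) := by simpa using h.runs
    cases s
    · simpa using negative w [] (.parallel u.length y) (r _) (r _) r' (by simpa using hs)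
        (by simpa using h)
    · simpa using positive w [] (.parallel u.length y) (r _) (r _) r' (by simpa using hs)
        (by simpa using h)
  · obtain rfl := Bool.eq_not_of_ne hxy
    have h1 : Runs (u ++ [x, !x] ++ v) [cap u.length x] (u ++ v) :=
      .single u v rfl rfl (by simp [Piece.cod])
    have h2 : Runs (u ++ v) [LegendrianFront.cup u.length (!x)] (u ++ [!x, x] ++ v) :=
      .single u v rfl (by simp [Piece.dom]) (by simp [Piece.cod])
    have h3 := (hcap _ h1).cup h2
    have r' : Runs [] (w ++ [cap u.length x, LegendrianFront.cup u.length (!x)] ++ [])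
        (u ++ [!x, x] ++ v) := by simpa using h3.runs
    cases s
    · simpa using positive w [] (.antiparallel u.length x) (r _) (r _) r' (by simpa using hs)
        (by simpa using h3)
    · simpa using negative w [] (.antiparallel u.length x) (r _) (r _) r' (by simpa using hs)
        (by simpa using h3)

/-- The possible positions, relative to an arc, of a piece with two strands on its left. -/
theorem append_pair_cases {u l u' v' : List Bool} {d e x y : Bool}
    (h : u ++ d :: l ++ [e] = u' ++ [x, y] ++ v') :
    (∃ m, u = u' ++ [x, y] ++ m ∧ v' = m ++ d :: l ++ [e]) ∨
    (u = u' ++ [x] ∧ d = y ∧ v' = l ++ [e]) ∨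
    (∃ l₁, u = u' ∧ d = x ∧ l = y :: l₁ ∧ v' = l₁ ++ [e]) ∨
    (u = u' ∧ d = x ∧ e = y ∧ l = [] ∧ v' = []) ∨
    (∃ l₁ l₂, u' = u ++ d :: l₁ ∧ l = l₁ ++ [x, y] ++ l₂ ∧ v' = l₂ ++ [e]) ∨
    (∃ l₁, u' = u ++ d :: l₁ ∧ l = l₁ ++ [x] ∧ e = y ∧ v' = []) := by
  rw [List.append_assoc, List.append_assoc] at h
  rcases List.append_eq_append_iff.1 h with ⟨m, rfl, hm⟩ | ⟨m, rfl, hm⟩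
  · cases m with
    | nil =>
      cases l with
      | nil =>
        simp at hm
        obtain ⟨rfl, rfl, rfl⟩ := hm
        simp
      | cons y' l =>
        simp at hm
        obtain ⟨rfl, rfl, rfl⟩ := hm
        simp
    | cons d' l₁ =>
      obtain ⟨rfl, hm⟩ : d = d' ∧ l ++ [e] = l₁ ++ x :: y :: v' := by simpa using hm
      rcases List.eq_nil_or_concat v' with rfl | ⟨v'', e', rfl⟩
      · have : l ++ [e] = l₁ ++ [x] ++ [y] := by simpa using hm
        obtain ⟨rfl, he⟩ := List.append_inj' this rfl
        simp_all
      · have : l ++ [e] = l₁ ++ [x, y] ++ v'' ++ [e'] := by simpa using hm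
        obtain ⟨rfl, he⟩ := List.append_inj' this rfl
        obtain rfl : e = e' := by simpa using he
        refine Or.inr (Or.inr (Or.inr (Or.inr (Or.inl ⟨l₁, v'', ?_⟩))))
        simp
  · rcases m with _ | ⟨x', _ | ⟨y', m⟩⟩
    · cases l with
      | nil => simp at hm; simp [hm]
      | cons y' l => simp at hm; simp [hm]
    · simp at hm
      obtain ⟨rfl, rfl, rfl⟩ := hm
      simp
    · simp at hm
      obtain ⟨rfl, rfl, rfl⟩ := hm
      refine Or.inl ⟨m, ?_⟩
      simp

/-- All events of the word are crossings. -/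
def Crossings (w : List Event) : Prop := ∀ e ∈ w, ∃ k x y s, e = cross k x y s

theorem crossings_pullUp (k : ℕ) (l : List Bool) (d : Bool) : Crossings (pullUp k l d) := by
  induction l generalizing k with
  | nil => simp [pullUp, Crossings]
  | cons y l ih =>
    intro e he
    rcases List.mem_append.1 he with he | he
    · exact ih _ e he
    · exact ⟨_, _, _, _, List.mem_singleton.1 he⟩

theorem crossings_pullDown (k : ℕ) (l : List Bool) (d : Bool) : Crossings (pullDown k l d) := by
  induction l generalizing k with
  | nil => simp [pullDown, Crossings]
  | cons y l ih =>
    intro e he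
    rcases List.mem_cons.1 he with he | he
    · exact ⟨_, _, _, _, he⟩
    · exact ih _ e he

/-- If crossings can be appended to a tangle above the strands `t`, then so can words of
crossings. -/
theorem append_crossings {t : List Bool} {n : ℕ}
    (H : ∀ (u v : List Bool) (x y s : Bool) (w : List Event), (u ++ [x, y] ++ v ++ t).length = n →
      Reducible (u ++ [x, y] ++ v ++ t) w →
        Reducible (u ++ [y, x] ++ v ++ t) (w ++ [cross u.length x y s]))
    {x : List Event} (hx : Crossings x) (hr : Runs b x c) (hn : (b ++ t).length = n)
    (h : Reducible (b ++ t) w) : Reducible (c ++ t) (w ++ x) := by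
  induction hr generalizing w with
  | nil => simpa using h
  | cons u v p x c hr ih =>
    obtain ⟨k, a, a', s, he⟩ := hx _ (List.mem_cons_self ..)
    obtain ⟨rfl, rfl⟩ : u.length = k ∧ p = .cross a a' s := by simpa using he
    have := ih (fun e he => hx e (List.mem_cons_of_mem _ he))
      (by simpa [Piece.dom, Piece.cod] using hn)
      (H u v a a' s w hn h)
    simpa using this

/-! ### Appending pieces to standard tangles, by induction on the number of strands -/

/-- All pieces can be appended to reducible tangles with few strands. -/
def Extends (n : ℕ) : Prop :=
  ∀ ⦃b c : List Bool⦄ ⦃w : List Event⦄ ⦃e : Event⦄, b.length < n → Reducible b w →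
    Runs b [e] c → Reducible c (w ++ [e])

theorem Extends.append_crossings {n : ℕ} (H : Extends n) {x : List Event} (hx : Crossings x)
    (hr : Runs b x c) (hn : b.length < n) (h : Reducible b w) : Reducible c (w ++ x) := by
  have := Reducible.append_crossings (t := []) (n := b.length) (x := x) (b := b) (c := c) (w := w)
    (fun u v x y s w hl hw => H (by omega) hw (.single u v rfl (by simp; rfl) (by simp; rfl)))
    hx hr (by simp) (by simpa using h)
  simpa using this

theorem _root_.LegendrianFront.Standard.cons_circle (h : Standard b w) (d : Bool) :
    Standard b ([LegendrianFront.cup 0 d, cap 0 d] ++ w) := by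
  induction h with
  | nil => simpa using Standard.circle [] d .nil
  | circle w e _ ih => simpa using Standard.circle _ e ih
  | arc u l e w _ ih => simpa using Standard.arc u l e _ ih

theorem standard_circle (h : Standard b w) (d : Bool) :
    Reducible b (w ++ [LegendrianFront.cup b.length d, cap b.length d]) :=
  iso (by simpa using TangleIso.circle h.runs d) (standard (h.cons_circle d))

/-- Without its last arc the tangle has two strands fewer, so `H` applies to it. According to its
position, the cap slides off the arc, closes it to a circle, or joins one of its ends to a
neighbouring strand; in the last case the arc retracts and leaves a strand pulled over the others,
that is, only crossings of the smaller tangle. -/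
theorem standard_cap {n k : ℕ} {x : Bool} (H : Extends n) (h : Standard b w)
    (hn : b.length ≤ n) (hc : Runs b [cap k x] c) : Reducible c (w ++ [cap k x]) := by
  obtain ⟨u', v', rfl, hb, rfl⟩ := hc.single_inv
  simp only [Piece.dom, Piece.cod, List.append_nil] at hb ⊢
  clear hc
  cases h with
  | nil => simp at hb
  | circle w d hw => simp at hb
  | arc u l d w hw =>
    simp only [List.length_append, List.length_cons, List.length_nil] at hn
    have hr := hw.runs
    rcases append_pair_cases hb with ⟨m, rfl, rfl⟩ | ⟨rfl, rfl, rfl⟩ | ⟨l₁, rfl, rfl, rfl, rfl⟩ |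
      ⟨rfl, rfl, -, rfl, rfl⟩ | ⟨l₁, l₂, rfl, rfl, rfl⟩ | ⟨l₁, rfl, rfl, hd, rfl⟩
    · have := arc_piece_above (u₁ := u') (u₂ := m) (l := l) (p := .cap x) (d := d) hr
        (H (by simp at hn ⊢; omega) (standard hw)
          (.single u' (m ++ l) rfl (by simp [Piece.dom]) (by simp)))
      simpa [Piece.dom, Piece.cod] using this
    · have h1 := (TangleIso.arc_cap_above l x).frame u' []
      have h2 := H.append_crossings (crossings_pullDown u'.length l x) (b := u' ++ [x] ++ l)
        (c := u' ++ l ++ [x]) (by simpa [lowerWord_pullDown] using (runs_pullDown l x).frame u' [])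
        (by simp; simp at hn; omega) (standard hw)
      simp only [lowerWord_append, lowerWord_lowerWord, lowerWord_pullDown, zero_add,
        lowerWord_cons, lowerWord_nil, List.append_nil] at h1
      have h3 := iso_append (by simpa using hr) h1 (by simpa using h2)
      simpa [add_comm 1] using h3
    · have h1 := (TangleIso.arc_cap_below l₁ d).frame u []
      have h2 := H.append_crossings (crossings_pullDown u.length l₁ (!d))
        (b := u ++ (!d) :: l₁) (c := u ++ l₁ ++ [!d])
        (by simpa [lowerWord_pullDown] using (runs_pullDown l₁ (!d)).frame u [])
        (by simp at hn ⊢; omega) (standard hw)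
      simp only [lowerWord_append, lowerWord_pullDown, zero_add,
        lowerWord_cons, lowerWord_nil, List.append_nil] at h1
      have h3 := iso_append (by simpa using hr) h1 (by simpa using h2)
      simpa using h3
    · simpa [lowerWord_arcWord, pullUp] using standard_circle hw d
    · have := arc_piece_inside (u := u) (l₁ := l₁) (l₂ := l₂) (p := .cap x) (d := d) hr
        (H (by simp at hn ⊢; omega) (standard hw)
          (.single (u ++ l₁) l₂ rfl (by simp [Piece.dom]) (by simp)))
      simpa [Piece.dom, Piece.cod] using this
    · obtain rfl : d = x := by simpa using hd
      have h1 := (TangleIso.arc_cap_bottom l₁ d).frame u []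
      have h2 := H.append_crossings (crossings_pullUp u.length l₁ d)
        (b := u ++ (l₁ ++ [d])) (c := u ++ d :: l₁)
        (by simpa [lowerWord_pullUp] using (runs_pullUp l₁ d).frame u [])
        (by simp at hn ⊢; omega) (standard hw)
      simp only [lowerWord_append, lowerWord_pullUp, zero_add,
        lowerWord_cons, lowerWord_nil, List.append_nil] at h1
      have h3 := iso_append (by simpa using hr) h1 (by simpa using h2)
      simpa [add_comm, add_left_comm] using h3

/-- A crossing that does not involve the lowest strand. -/
theorem standard_cross {n : ℕ} {x y s : Bool} {u' v' : List Bool} (H : Extends n)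
    (h : Standard b w) (hn : b.length ≤ n) (hb : b = u' ++ [x, y] ++ v') (hv : v' ≠ []) :
    Reducible (u' ++ [y, x] ++ v') (w ++ [cross u'.length x y s]) := by
  -- Caps can already be appended, so by the skein relation it is enough to treat one of the two
  -- crossings, the one in which the last arc goes over.
  have hsw : Reducible (u' ++ [y, x] ++ v') (w ++ [cross u'.length x y (!s)]) →
      Reducible (u' ++ [y, x] ++ v') (w ++ [cross u'.length x y s]) := by
    subst hb
    exact switch (standard h) fun c hc => standard_cap H h hn hc
  cases h with
  | nil => simp at hb
  | circle w d hw => simp at hb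
  | arc u l d w hw =>
    simp only [List.length_append, List.length_cons, List.length_nil] at hn
    have hr := hw.runs
    rcases append_pair_cases hb with ⟨m, rfl, rfl⟩ | ⟨rfl, rfl, rfl⟩ | ⟨l₁, rfl, rfl, rfl, rfl⟩ |
      ⟨rfl, rfl, -, rfl, rfl⟩ | ⟨l₁, l₂, rfl, rfl, rfl⟩ | ⟨l₁, rfl, rfl, hd, rfl⟩
    · have := arc_piece_above (u₁ := u') (u₂ := m) (l := l) (p := .cross x y s) (d := d) hr
        (H (by simp at hn ⊢; omega) (standard hw)
          (.single u' (m ++ l) rfl (by simp [Piece.dom]) (by simp)))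
      simpa [Piece.dom, Piece.cod] using this
    -- The upper end of the arc goes over the strand above it: this is a longer arc.
    · have hover : Reducible (u' ++ [d, x] ++ (l ++ [!d]))
          (w ++ lowerWord (u' ++ [x]).length (arcWord l d) ++ [cross u'.length x d false]) := by
        have := standard (.arc u' (x :: l) d w (by simpa using hw))
        simpa [lowerWord_arcWord, pullUp, add_comm, add_left_comm] using this
      cases s
      · exact hover
      · exact hsw hover
    -- The upper end goes back over the last strand that it crossed: this is a shorter arc.
    · have hover : Reducible (u ++ [y, d] ++ (l₁ ++ [!d]))
          (w ++ lowerWord u.length (arcWord (y :: l₁) d) ++ [cross u.length d y true]) := by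
        have h1 := TangleIso.of_move (a := [y, d]) (b := [y, d]) (.reidemeister2 0 y d false)
          (.append (w := [_]) (w' := [_]) (b := [d, y]) (.single [] [] rfl (by simp [Piece.dom])
            (by simp [Piece.cod])) (.single [] [] rfl (by simp [Piece.dom]) (by simp [Piece.cod])))
          (.nil _)
        have h2 := h1.frame u (l₁ ++ [!d])
        have h3 := standard (.arc (u ++ [y]) l₁ d w (by simpa using hw))
        have h4 : Runs [] (w ++ lowerWord (u ++ [y]).length (arcWord l₁ d))
          (u ++ [y, d] ++ (l₁ ++ [!d])) := by simpa using h3.runs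
        have h5 := iso_append h4 h2 (by simpa using h3)
        simpa [lowerWord_arcWord, pullUp, add_comm, add_left_comm] using h5
      cases s
      · exact hsw hover
      · exact hover
    · exact absurd rfl hv
    · have := arc_piece_inside (u := u) (l₁ := l₁) (l₂ := l₂) (p := .cross x y s) (d := d) hr
        (H (by simp at hn ⊢; omega) (standard hw)
          (.single (u ++ l₁) l₂ rfl (by simp [Piece.dom]) (by simp)))
      simpa [Piece.dom, Piece.cod] using this
    · exact absurd rfl hv

/-- A crossing that involves the lowest strand. -/
theorem standard_cross_bottom {n : ℕ} {x y s : Bool} {u' : List Bool} (H : Extends n)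
    (h : Standard b w) (hn : b.length ≤ n) (hb : b = u' ++ [x, y]) :
    Reducible (u' ++ [y, x]) (w ++ [cross u'.length x y s]) := by
  have hsw : Reducible (u' ++ [y, x]) (w ++ [cross u'.length x y (!s)]) →
      Reducible (u' ++ [y, x]) (w ++ [cross u'.length x y s]) := by
    subst hb
    simpa using switch (u := u') (v := []) (s := s) (by simpa using standard h)
      fun c hc => standard_cap H h hn (by simpa using hc)
  have hb' : b = u' ++ [x, y] ++ [] := by simpa using hb
  cases h with
  | nil => simp at hb
  | circle w d hw => simp at hb
  | arc u l d w hw =>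
    simp only [List.length_append, List.length_cons, List.length_nil] at hn
    have hr := hw.runs
    rcases append_pair_cases hb' with ⟨m, rfl, hv⟩ | ⟨rfl, rfl, hv⟩ | ⟨l₁, rfl, rfl, rfl, hv⟩ |
      ⟨rfl, rfl, rfl, rfl, -⟩ | ⟨l₁, l₂, rfl, rfl, hv⟩ | ⟨l₁, rfl, rfl, rfl, -⟩
    · simp at hv
    · simp at hv
    · simp at hv
    -- The two ends of the arc cross: a curl, whose removal leaves an arc of opposite direction.
    · have h1 := TangleIso.of_move (a := []) (b := [!d, d]) (.reidemeister1Cup 0 d s)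
        (.append (w := [_]) (w' := [_]) (b := [d, !d])
          (.single [] [] rfl (by simp [Piece.dom]) (by simp [Piece.cod]))
          (.single [] [] rfl (by simp [Piece.dom]) (by simp [Piece.cod])))
        (.single [] [] rfl (by simp [Piece.dom]) (by simp [Piece.cod]))
      have h2 := h1.frame u []
      have h3 := standard (.arc u [] (!d) w hw)
      have h4 := iso_append (c := u ++ [!d, d]) (by simpa using hr) (by simpa using h2)
        (by simpa [lowerWord_arcWord, pullUp] using h3)
      simpa [lowerWord_arcWord, pullUp] using h4
    · simp at hv
    -- The lower end retracts past `x`, leaving a cup above `x` and crossings with `l₁`. The number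
    -- of strands has not dropped, but none of these crossings involves the lowest strand, so
    -- `standard_cross` applies. Hence the separate treatment of that strand.
    · have hover : Reducible (u ++ d :: l₁ ++ [!d, x]) (w ++ lowerWord u.length
          (arcWord (l₁ ++ [x]) d) ++ [cross (u ++ d :: l₁).length x (!d) false]) := by
        have h1 := (TangleIso.arc_cross_bottom l₁ x d).frame u []
        have h2 : Reducible (u ++ l₁ ++ [d, !d] ++ [x])
            (w ++ [LegendrianFront.cup (u ++ l₁).length d]) :=
          (standard hw).cup (.single (u ++ l₁) [x] rfl (by simp [Piece.dom]) (by simp [Piece.cod]))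
        have h3 : Runs (u ++ l₁ ++ [d, !d]) (pullUp u.length l₁ d) (u ++ d :: l₁ ++ [!d]) := by
          simpa [lowerWord_pullUp] using (runs_pullUp l₁ d).frame u [!d]
        have h4 := append_crossings (t := [x]) (n := (u ++ l₁ ++ [d, !d] ++ [x]).length)
          (fun u v x' y' s w hl hw => by
            have := hw.append (c := u ++ [y', x'] ++ (v ++ [x])) (x := [cross u.length x' y' s])
              (.single u (v ++ [x]) rfl (by simp [Piece.dom]) (by simp [Piece.cod]))
              (fun w hw => standard_cross H hw (by simp at hl hn ⊢; omega) (by simp) (by simp))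
            simpa using this)
          (crossings_pullUp _ _ _) h3 rfl h2
        simp only [lowerWord_append, lowerWord_pullUp, zero_add, lowerWord_cons, lowerWord_nil,
          List.append_nil] at h1
        have h5 := iso_append (by simpa using hr) h1 (by simpa [add_comm] using h4)
        simpa [add_comm, add_left_comm] using h5
      cases s
      · simpa using hover
      · exact hsw (by simpa using hover)

theorem extends_all (n : ℕ) : Extends n := by
  induction n with
  | zero => intro b c w e hb; exact absurd hb (by omega)
  | succ n H =>
    intro b c w e hb h hr
    obtain ⟨k, p⟩ := e
    refine h.append hr fun w hw => ?_
    have hb : b.length ≤ n := by omega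
    cases p with
    | cup d => exact (standard hw).cup hr
    | cap d => exact standard_cap H hw hb hr
    | cross x y s =>
      obtain ⟨u, v, rfl, h1, rfl⟩ := hr.single_inv
      simp only [Piece.dom, Piece.cod] at h1 ⊢
      by_cases hv : v = []
      · subst hv
        simpa using standard_cross_bottom (s := s) H hw hb (by simpa using h1)
      · exact standard_cross H hw hb h1 hv

theorem of_runs {a x} (ha : Reducible a w) (hr : Runs a x b) : Reducible b (w ++ x) := by
  induction hr generalizing w with
  | nil => simpa using ha
  | cons u v p x b hr ih =>
    have := ih (extends_all _ (Nat.lt_succ_self _) ha (.single u v rfl rfl rfl))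
    simpa using this

end Reducible

theorem Runs.reducible {b : List Bool} {w : List Event} (h : Runs [] w b) : Reducible b w := by
  simpa using (Reducible.standard .nil).of_runs h

theorem Runs.not_cross_nil {b : List Bool} {w : List Event} {k : ℕ} {x y s : Bool} :
    ¬ Runs [] (cross k x y s :: w) b := by
  intro h
  obtain ⟨u, v, -, h, -⟩ := h.cons_inv
  simp [Piece.dom] at h

/-- A local move never relates the empty diagram to another one. -/
theorem LinkMove.nil_iff {u l r v : List Event} (h : LinkMove l r)
    (hl : Runs [] (u ++ l ++ v) []) : u ++ l ++ v = [] ↔ u ++ r ++ v = [] := by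
  have hl' : l ≠ [] := by
    rintro rfl
    cases h with
    | exchange l r h => cases h
  simp only [List.append_eq_nil_iff, hl', and_false, false_and, false_iff, not_and, and_imp]
  rintro rfl rfl rfl
  simp only [List.nil_append, List.append_nil] at hl
  cases h with
  | exchange l r h => cases h
  | straighten₁ k x =>
    obtain ⟨u, v, rfl, h, h'⟩ := hl.cons_inv
    obtain ⟨rfl, rfl⟩ : u = [] ∧ v = [] := by simpa [Piece.dom] using h.symm
    obtain ⟨u, v, h1, h2, -⟩ := h'.cons_inv
    have := congrArg List.length h2
    simp [Piece.dom, Piece.cod] at this h1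
    omega
  | straighten₂ k x =>
    obtain ⟨u, v, h1, h, -⟩ := hl.cons_inv
    obtain ⟨rfl, rfl⟩ : u = [] ∧ v = [] := by simpa [Piece.dom] using h.symm
    simp at h1
  | reidemeister2 k x y s => exact hl.not_cross_nil

/-- The empty diagram must be kept apart: it occurs in no skein triple and is isotopic only to
itself, so the defining properties do not determine its polynomial. -/
theorem Diagram.Isotopic.nil_iff {D E : Diagram} (h : D.Isotopic E) :
    D.word = [] ↔ E.word = [] := by
  induction h with
  | rel D E h =>
    obtain ⟨u, l, r, v, h, hD, hE⟩ := h
    rw [hD, hE]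
    exact h.nil_iff (hD ▸ D.closed)
  | refl => rfl
  | symm _ _ _ ih => exact ih.symm
  | trans _ _ _ _ _ ih ih' => exact ih.trans ih'

theorem TangleIso.isotopic {w w' : List Event} (h : TangleIso [] [] w w') :
    Diagram.Isotopic ⟨w, h.runs.1⟩ ⟨w', h.runs.2⟩ := by
  induction h with
  | refl w h => exact .refl _
  | move u l r v h h1 h2 => exact .rel _ _ ⟨u, l, r, v, h, rfl, rfl⟩
  | symm w w' h ih => exact .symm _ _ ih
  | trans w w' w'' h h' ih ih' => exact .trans _ _ _ ih ih'

theorem Standard.unlink {b : List Bool} {w : List Event} (h : Standard b w) (hb : b = []) :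
    ∃ ds : List Bool, w = ds.flatMap fun d => [cup 0 d, cap 0 d] := by
  induction h with
  | nil => exact ⟨[], rfl⟩
  | circle w d _ ih =>
    obtain ⟨ds, rfl⟩ := ih rfl
    exact ⟨ds ++ [d], by simp⟩
  | arc => simp at hb

theorem LocalSkein.ne_nil {u p m o v : List Event} (h : LocalSkein p m o)
    (hp : Runs [] (u ++ p ++ v) []) :
    u ++ p ++ v ≠ [] ∧ u ++ m ++ v ≠ [] ∧ u ++ o ++ v ≠ [] := by
  cases h with
  | parallel k x =>
    refine ⟨by simp, by simp, ?_⟩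
    rintro h
    obtain ⟨rfl, rfl⟩ : u = [] ∧ v = [] := by simpa using h
    exact Runs.not_cross_nil hp
  | antiparallel k x => simp

/-- Properties of nonempty diagrams may be checked on unlinks, if they are compatible with isotopy
and with the skein relation. -/
theorem Diagram.resolution (S : Diagram → Prop) (iso : ∀ D E : Diagram, D.Isotopic E → S D → S E)
    (pos : ∀ Dp Dm D₀ : Diagram, SkeinTriple Dp Dm D₀ → S Dm → S D₀ → S Dp)
    (neg : ∀ Dp Dm D₀ : Diagram, SkeinTriple Dp Dm D₀ → S Dp → S D₀ → S Dm)
    (unlink : ∀ (D : Diagram) (ds : List Bool), ds ≠ [] →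
      (D.word = ds.flatMap fun d => [cup 0 d, cap 0 d]) → S D)
    (D : Diagram) (hD : D.word ≠ []) : S D := by
  have key : ∀ {b : List Bool} {w : List Event}, Reducible b w → b = [] →
      ∀ h : Runs [] w [], w ≠ [] → S ⟨w, h⟩ := by
    intro b w h
    induction h with
    | standard h =>
      intro hb hw hn
      obtain ⟨ds, rfl⟩ := h.unlink hb
      exact unlink _ ds (by rintro rfl; exact hn rfl) rfl
    | iso h _ ih =>
      rintro rfl hw hn
      exact iso _ _ h.isotopic (ih rfl _ (mt (h.isotopic.nil_iff).1 hn))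
    | positive u v hs hp hm ho _ _ ih ih' =>
      rintro rfl hw hn
      exact pos _ _ _ ⟨u, _, _, _, v, hs, rfl, rfl, rfl⟩ (ih rfl hm (hs.ne_nil hp).2.1)
        (ih' rfl ho (hs.ne_nil hp).2.2)
    | negative u v hs hp hm ho _ _ ih ih' =>
      rintro rfl hw hn
      exact neg _ _ _ ⟨u, _, _, _, v, hs, rfl, rfl, rfl⟩ (ih rfl hp (hs.ne_nil hp).1)
        (ih' rfl ho (hs.ne_nil hp).2.2)
  exact key D.closed.reducible rfl D.closed hD

open Filter Topology

/-! ### Laurent polynomials as functions -/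

section Laurent

open LaurentPolynomial

theorem laurent_eq_sum {R : Type*} [Semiring R] (p : R[T;T⁻¹]) :
    p = ∑ n ∈ p.coeff.support, C (p.coeff n) * T n := by
  ext a
  simp_rw [← single_eq_C_mul_T]
  simp only [AddMonoidAlgebra.coeff_sum, AddMonoidAlgebra.coeff_single]
  rw [Finset.sum_apply', Finset.sum_eq_single a, Finsupp.single_eq_same]
  · intro b _ hb
    rw [Finsupp.single_eq_of_ne' hb]
  · intro ha
    rw [Finsupp.single_eq_same, Finsupp.notMem_support_iff.mp ha]

theorem coeff_eq_zero_of_degree_lt {R : Type*} [Semiring R] {p : R[T;T⁻¹]} {n : ℤ}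
    (h : p.degree < n) : p.coeff n = 0 := by
  by_contra hn
  exact absurd (Finset.le_max (Finsupp.mem_support_iff.2 hn)) (not_le.2 h)

theorem coeff_C_mul {R : Type*} [Semiring R] (r : R) (p : R[T;T⁻¹]) (n : ℤ) :
    (C r * p).coeff n = r * p.coeff n := by
  rw [← single_eq_C, AddMonoidAlgebra.coeff_single_zero_mul]

theorem coeff_T_mul {R : Type*} [Semiring R] (p : R[T;T⁻¹]) (m n : ℤ) :
    (T m * p).coeff n = p.coeff (n - m) := by
  rw [T, AddMonoidAlgebra.coeff_single_mul_apply, one_mul, neg_add_eq_sub]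

/-- After division by `x ^ d` all terms of exponent below `d` tend to zero. -/
theorem tendsto_eval₂_mul_zpow {R α : Type*} [CommRing R] (f : R →+* ℝ) {l : Filter α}
    {x : α → ℝˣ} (hx : Tendsto (fun t => (x t : ℝ)) l atTop) {p : R[T;T⁻¹]} {d : ℤ}
    (hd : p.degree ≤ d) :
    Tendsto (fun t => eval₂ f (x t) p * (x t : ℝ) ^ (-d)) l (𝓝 (f (p.coeff d))) := by
  have h1 : ∀ t, eval₂ f (x t) p * (x t : ℝ) ^ (-d) =
      ∑ n ∈ p.coeff.support, f (p.coeff n) * (x t : ℝ) ^ (n - d) := by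
    intro t
    conv_lhs => rw [laurent_eq_sum p]
    rw [map_sum, Finset.sum_mul]
    refine Finset.sum_congr rfl fun n _ => ?_
    rw [eval₂_C_mul_T, mul_assoc, Units.val_zpow_eq_zpow_val, ← zpow_add₀ (x t).ne_zero]
    rfl
  have h2 : f (p.coeff d) = ∑ n ∈ p.coeff.support, f (p.coeff n) * if n = d then 1 else 0 := by
    simp only [mul_ite, mul_one, mul_zero, Finset.sum_ite_eq', Finsupp.mem_support_iff]
    split_ifs with h
    · rfl
    · rw [Finsupp.notMem_support_iff.1 h, map_zero]
  simp_rw [h1]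
  rw [h2]
  refine tendsto_finsetSum _ fun n hn => Tendsto.const_mul _ ?_
  split_ifs with h
  · simpa [h] using tendsto_const_nhds
  · have : n ≤ d := WithBot.coe_le_coe.1 ((Finset.le_max hn).trans hd)
    exact (tendsto_zpow_atTop_zero (by omega)).comp hx

/-- Evaluation of polynomials in `a` and `z`. -/
noncomputable def evalCoeff (a z : ℝˣ) : Coeff →+* ℝ :=
  eval₂ (eval₂ (Int.castRingHom ℝ) z) a

@[simp] theorem evalCoeff_aPow (a z : ℝˣ) (n : ℤ) : evalCoeff a z (aPow n) = (a : ℝ) ^ n := by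
  simp [evalCoeff, aPow]

@[simp] theorem evalCoeff_zVar (a z : ℝˣ) : evalCoeff a z zVar = z := by
  simp [evalCoeff, zVar]

theorem exists_degree_eq {R : Type*} [Semiring R] {p : R[T;T⁻¹]} (hp : p ≠ 0) :
    ∃ d : ℤ, p.degree = d ∧ p.coeff d ≠ 0 := by
  obtain ⟨d, hd⟩ := WithBot.ne_bot_iff_exists.1 (mt degree_eq_bot_iff.1 hp)
  exact ⟨d, hd.symm, Finsupp.mem_support_iff.1 (Finset.mem_of_max hd.symm)⟩

theorem sub_inv_pos {q : ℝ} (hq : 1 < q) : 0 < q - q⁻¹ :=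
  sub_pos.2 ((inv_lt_one_of_one_lt₀ hq).trans hq)

/-- The value `q - q⁻¹` of the variable `z`. -/
noncomputable def zUnit {q : ℝ} (hq : 1 < q) : ℝˣ := Units.mk0 (q - q⁻¹) (sub_inv_pos hq).ne'

/-- The specialization `a = q ^ N`, `z = q - q⁻¹`. -/
noncomputable def evalAt (N : ℕ) {q : ℝ} (hq : 1 < q) : Coeff →+* ℝ :=
  evalCoeff (Units.mk0 (q ^ N) (pow_pos (zero_lt_one.trans hq) N).ne') (zUnit hq)

/-- Since `q - q⁻¹` is unbounded, the leading term of `c` dominates for large `q`. -/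
theorem exists_eval₂_ne_zero {c : ℤ[T;T⁻¹]} (hc : c ≠ 0) :
    ∃ (q : ℝ) (hq : 1 < q), eval₂ (Int.castRingHom ℝ) (zUnit hq) c ≠ 0 := by
  obtain ⟨d, hd, hcd⟩ := exists_degree_eq hc
  have hq : ∀ n : ℕ, 1 < (n : ℝ) + 2 := fun n => by
    have := n.cast_nonneg (α := ℝ)
    linarith
  have hz : Tendsto (fun n : ℕ => (zUnit (hq n) : ℝ)) atTop atTop := by
    refine tendsto_atTop_mono (fun n => ?_) tendsto_natCast_atTop_atTop
    have := inv_lt_one_of_one_lt₀ (hq n)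
    simp only [zUnit, Units.val_mk0]
    linarith
  have h := tendsto_eval₂_mul_zpow (Int.castRingHom ℝ) hz hd.le
  have h0 : Int.castRingHom ℝ (c.coeff d) ≠ 0 := by simpa using hcd
  obtain ⟨n, hn⟩ := (h.eventually_ne h0).exists
  exact ⟨_, hq n, left_ne_zero_of_mul hn⟩

/-- The degree in `a` is the growth rate along `a = q ^ N`, where `q` is fixed in advance so that
the leading coefficient does not vanish at `z = q - q⁻¹`. -/
theorem exists_tendsto_evalAt {p : Coeff} {d : ℤ} (hd : p.degree = d) :
    ∃ (q : ℝ) (hq : 1 < q) (L : ℝ), L ≠ 0 ∧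
      Tendsto (fun N : ℕ => evalAt N hq p * (q ^ N) ^ (-d)) atTop (𝓝 L) := by
  have hp : p.coeff d ≠ 0 := Finsupp.mem_support_iff.1 (Finset.mem_of_max hd)
  obtain ⟨q, hq, h⟩ := exists_eval₂_ne_zero hp
  refine ⟨q, hq, _, h, ?_⟩
  have := tendsto_eval₂_mul_zpow (x := fun N : ℕ => Units.mk0 (q ^ N)
    (pow_pos (zero_lt_one.trans hq) N).ne') (eval₂ (Int.castRingHom ℝ) (zUnit hq))
    (tendsto_pow_atTop_atTop_of_one_lt hq) hd.le
  simpa [evalAt, evalCoeff] using this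

theorem evalAt_injective {p p' : Coeff}
    (h : ∀ (N : ℕ) (q : ℝ) (hq : 1 < q), 0 < N → evalAt N hq p = evalAt N hq p') : p = p' := by
  rw [← sub_eq_zero]
  by_contra hp
  obtain ⟨d, hd, -⟩ := exists_degree_eq hp
  obtain ⟨q, hq, L, hL, h'⟩ := exists_tendsto_evalAt hd
  obtain ⟨N, h1, h2⟩ := ((h'.eventually_ne hL).and (eventually_gt_atTop 0)).exists
  simp [h N q hq h2] at h1

end Laurent

/-! ### Existence of the HOMFLY-PT polynomial -/

section StateSum

variable {N : ℕ} {q : ℝ}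

theorem wordOp_linear (q : ℝ) (w : List Event) (c d : ℝ) (f g : Stream' (Fin N) → ℝ)
    (σ : Stream' (Fin N)) :
    wordOp q w (fun τ => c * f τ + d * g τ) σ = c * wordOp q w f σ + d * wordOp q w g σ := by
  induction w generalizing f g with
  | nil => rfl
  | cons e w ih =>
    have : eventOp q e (fun τ => c * f τ + d * g τ) =
        fun τ => c * eventOp q e f τ + d * eventOp q e g τ :=
      funext fun τ => lowerOp_pieceOp_linear q e.pos e.piece c d f g τ
    simp only [wordOp, this, ih]

theorem lowerOp_lowerOp (k : ℕ) (T T' : (Stream' (Fin N) → ℝ) → Stream' (Fin N) → ℝ)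
    (f : Stream' (Fin N) → ℝ) : lowerOp k T' (lowerOp k T f) = lowerOp k (fun g => T' (T g)) f := by
  induction k generalizing f with
  | zero => rfl
  | succ k ih =>
    funext σ
    exact congrFun (ih fun τ => f (Stream'.cons σ.head τ)) σ.tail

theorem lowerOp_id (k : ℕ) (f : Stream' (Fin N) → ℝ) : lowerOp k (fun g => g) f = f := by
  induction k generalizing f with
  | zero => rfl
  | succ k ih =>
    funext σ
    refine (congrFun (ih fun τ => f (Stream'.cons σ.head τ)) σ.tail).trans ?_
    rw [Stream'.eta]

theorem lowerOp_skein {A B C : ℝ} {T₁ T₂ T₃ : (Stream' (Fin N) → ℝ) → Stream' (Fin N) → ℝ}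
    (h : ∀ f σ, A * T₁ f σ - B * T₂ f σ = C * T₃ f σ) (k : ℕ) (f : Stream' (Fin N) → ℝ)
    (σ : Stream' (Fin N)) :
    A * lowerOp k T₁ f σ - B * lowerOp k T₂ f σ = C * lowerOp k T₃ f σ := by
  induction k generalizing f σ with
  | zero => exact h f σ
  | succ k ih => exact ih _ _

/-- On distinct labels the swaps cancel and exactly one of the two crossings contributes a
smoothing, the label orders being opposite; on equal labels the swaps give `q - q⁻¹`. -/
theorem crossOp_skein_parallel (hq : 0 < q) (x : Bool) (f : Stream' (Fin N) → ℝ)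
    (σ : Stream' (Fin N)) :
    q ^ N * pieceOp q (.cross x x true) f σ - (q ^ N)⁻¹ * pieceOp q (.cross x x false) f σ =
      (q - q⁻¹) * f σ := by
  obtain ⟨i, j, τ, rfl⟩ := exists_cons_cons σ
  have hN : q ^ N ≠ 0 := pow_ne_zero _ hq.ne'
  simp only [pieceOp_cross, crossOp, smoothTerm, beq_self_eq_true, ← mul_assoc, mul_inv_cancel₀ hN,
    inv_mul_cancel₀ hN, reduceIte, show (true == false) = false from rfl, Bool.false_eq_true]
  rcases lt_trichotomy i j with h | rfl | h
  · cases x <;> simp [labelLT, h, h.ne, h.not_gt]; ring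
  · cases x <;> simp [labelLT] <;> ring
  · cases x <;> simp [labelLT, h, h.ne', h.not_gt]; ring

/-- The smoothings of the two crossings run over the labels on either side of `i`. The missing label
`k = i` comes from the swaps, since its weight in the full sum is `1`. -/
theorem crossOp_skein_antiparallel (hq : 0 < q) (x : Bool) (f : Stream' (Fin N) → ℝ)
    (σ : Stream' (Fin N)) :
    q ^ N * pieceOp q (.cross x (!x) false) f σ - (q ^ N)⁻¹ * pieceOp q (.cross x (!x) true) f σ =
      (q - q⁻¹) * pieceOp q (.cup (!x)) (pieceOp q (.cap x) f) σ := by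
  obtain ⟨i, j, τ, rfl⟩ := exists_cons_cons σ
  have hN : q ^ N ≠ 0 := pow_ne_zero _ hq.ne'
  have hx : (x == !x) = false := by cases x <;> rfl
  have hx' : ¬ x = !x := by cases x <;> simp
  rw [pieceOp_cup, pieceOp_cap]
  simp only [pieceOp_cross, crossOp, smoothTerm, hx, hx', ← mul_assoc, mul_inv_cancel₀ hN,
    inv_mul_cancel₀ hN, reduceIte, beq_self_eq_true, Bool.false_eq_true,
    show (false == true) = false from rfl]
  by_cases hij : i = j
  · subst hij
    simp only [reduceIte]
    have key : cupWeight q (!x) i * ∑ k, capWeight q x k * f (Stream'.cons k (Stream'.cons k τ)) =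
        f (Stream'.cons i (Stream'.cons i τ)) +
        (∑ k, if labelLT (x == true) k i then
          capWeight q x k * cupWeight q (!x) i * f (Stream'.cons k (Stream'.cons k τ)) else 0) +
        ∑ k, if labelLT (x == false) k i then
          capWeight q x k * cupWeight q (!x) i * f (Stream'.cons k (Stream'.cons k τ)) else 0 := by
      have h1 : f (Stream'.cons i (Stream'.cons i τ)) = ∑ k, if k = i then
          capWeight q x k * cupWeight q (!x) i * f (Stream'.cons k (Stream'.cons k τ)) else 0 := by
        rw [Finset.sum_ite_eq' Finset.univ i]
        simp [capWeight_mul_cupWeight_not hq]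
      rw [h1, ← Finset.sum_add_distrib, ← Finset.sum_add_distrib, Finset.mul_sum]
      refine Finset.sum_congr rfl fun k _ => ?_
      rcases lt_trichotomy i k with h | rfl | h
      · cases x <;> simp [labelLT, h, h.ne', h.not_gt] <;> ring
      · cases x <;> simp [labelLT] <;> ring
      · cases x <;> simp [labelLT, h, h.ne, h.not_gt] <;> ring
    rw [key]
    ring
  · simp [hij]

theorem wordOp_skein (hq : 0 < q) {p m o : List Event} (h : LocalSkein p m o)
    (f : Stream' (Fin N) → ℝ) (σ : Stream' (Fin N)) :
    q ^ N * wordOp q p f σ - (q ^ N)⁻¹ * wordOp q m f σ = (q - q⁻¹) * wordOp q o f σ := by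
  cases h with
  | parallel k x =>
    have := lowerOp_skein (T₃ := fun g => g) (crossOp_skein_parallel (N := N) hq x) k f σ
    rwa [lowerOp_id] at this
  | antiparallel k x =>
    have := lowerOp_skein (crossOp_skein_antiparallel (N := N) hq x) k f σ
    rwa [← lowerOp_lowerOp k (pieceOp q (.cap x)) (pieceOp q (.cup !x))] at this

/-- The state sum of a diagram, with `M + 1` labels. -/
noncomputable def stateSum (M : ℕ) (q : ℝ) (D : Diagram) : ℝ :=
  wordOp (N := M + 1) q D.word (fun _ => 1) (Stream'.const 0)

theorem stateSum_eq_of_isotopic (hq : 0 < q) (M : ℕ) {D E : Diagram} (h : D.Isotopic E) :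
    stateSum M q D = stateSum M q E := by
  induction h with
  | rel D E h =>
    obtain ⟨u, l, r, v, h, hD, hE⟩ := h
    simp only [stateSum, hD, hE, wordOp_append, wordOp_linkMove hq h]
  | refl => rfl
  | symm _ _ _ ih => exact ih.symm
  | trans _ _ _ _ _ ih ih' => exact ih.trans ih'

/-- Solving for the positive term makes it a linear combination of the other two, which the linear
operator of `v` preserves. -/
theorem wordOp_skein_append (hq : 0 < q) {p m o : List Event}
    (h : ∀ (f : Stream' (Fin N) → ℝ) (σ : Stream' (Fin N)),
      q ^ N * wordOp q p f σ - (q ^ N)⁻¹ * wordOp q m f σ = (q - q⁻¹) * wordOp q o f σ)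
    (u v : List Event) (f : Stream' (Fin N) → ℝ) (σ : Stream' (Fin N)) :
    q ^ N * wordOp q (u ++ p ++ v) f σ - (q ^ N)⁻¹ * wordOp q (u ++ m ++ v) f σ =
      (q - q⁻¹) * wordOp q (u ++ o ++ v) f σ := by
  simp only [wordOp_append]
  have hN : q ^ N ≠ 0 := pow_ne_zero _ hq.ne'
  have h1 : wordOp q p (wordOp q u f) = fun τ =>
      ((q ^ N)⁻¹ * (q ^ N)⁻¹) * wordOp q m (wordOp q u f) τ +
      ((q ^ N)⁻¹ * (q - q⁻¹)) * wordOp q o (wordOp q u f) τ := by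
    funext τ
    rw [mul_assoc _ (q - q⁻¹), ← h]
    field_simp
    ring
  rw [h1, wordOp_linear]
  field_simp
  ring

theorem stateSum_skein (hq : 0 < q) (M : ℕ) {Dp Dm D₀ : Diagram}
    (h : Diagram.SkeinTriple Dp Dm D₀) :
    q ^ (M + 1) * stateSum M q Dp - (q ^ (M + 1))⁻¹ * stateSum M q Dm =
      (q - q⁻¹) * stateSum M q D₀ := by
  obtain ⟨u, p, m, o, v, h, hp, hm, ho⟩ := h
  simp only [stateSum, hp, hm, ho]
  exact wordOp_skein_append hq (wordOp_skein hq h) u v _ _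

/-- The quantum integer `[N]`. -/
noncomputable def qInt (N : ℕ) (q : ℝ) : ℝ := (q ^ N - (q ^ N)⁻¹) / (q - q⁻¹)

theorem qInt_pos (hq : 1 < q) (hN : 0 < N) : 0 < qInt N q :=
  div_pos (sub_inv_pos (one_lt_pow₀ hq hN.ne')) (sub_inv_pos hq)

theorem wordOp_circle (hq : 1 < q) (d : Bool) (c : ℝ) :
    wordOp q [cup 0 d, cap 0 d] (fun _ : Stream' (Fin N) => c) = fun _ => qInt N q * c := by
  funext σ
  have h : ∑ i : Fin N, capWeight q d i * cupWeight q d i = qInt N q := by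
    have hq' := zero_lt_one.trans hq
    rw [qInt, eq_div_iff (sub_inv_pos hq).ne', mul_comm]
    cases d
    · simpa [capWeight, cupWeight] using sum_cuspWeight_univ (N := N) hq'
    · simpa [capWeight, cupWeight] using sum_cuspWeight_inv_univ (N := N) hq'
  have : wordOp q [cup 0 d, cap 0 d] (fun _ : Stream' (Fin N) => c) σ =
      ∑ i, capWeight q d i * (if i = i then cupWeight q d i * c else 0) := rfl
  rw [this, ← h, Finset.sum_mul]
  simp [mul_assoc]

theorem wordOp_unlink (hq : 1 < q) (ds : List Bool) (c : ℝ) :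
    wordOp q (ds.flatMap fun d => [cup 0 d, cap 0 d]) (fun _ : Stream' (Fin N) => c) =
      fun _ => qInt N q ^ ds.length * c := by
  induction ds generalizing c with
  | nil => simp [wordOp]
  | cons d ds ih =>
    rw [List.flatMap_cons, wordOp_append, wordOp_circle hq, ih]
    simp [pow_succ, mul_assoc]

/-- The state sums of `D` are values of the polynomial `p`. -/
def Represents (p : Coeff) (D : Diagram) : Prop :=
  ∀ (M : ℕ) (q : ℝ) (hq : 1 < q), stateSum M q D = qInt (M + 1) q * evalAt (M + 1) hq p

theorem Represents.unique {p p' : Coeff} {D : Diagram} (h : Represents p D)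
    (h' : Represents p' D) : p = p' := by
  refine evalAt_injective fun N q hq hN => ?_
  obtain ⟨M, rfl⟩ := Nat.exists_eq_succ_of_ne_zero hN.ne'
  exact mul_left_cancel₀ (qInt_pos hq hN).ne' ((h M q hq).symm.trans (h' M q hq))

theorem represents_iff_of_isotopic {p : Coeff} {D E : Diagram} (h : D.Isotopic E) :
    Represents p D ↔ Represents p E := by
  unfold Represents
  refine forall₃_congr fun M q hq => ?_
  rw [stateSum_eq_of_isotopic (zero_lt_one.trans hq) M h]

@[simp] theorem evalAt_aPow (hq : 1 < q) (n : ℤ) : evalAt N hq (aPow n) = (q ^ N) ^ n := by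
  simp [evalAt]

@[simp] theorem evalAt_zVar (hq : 1 < q) : evalAt N hq zVar = q - q⁻¹ := by
  simp [evalAt, zUnit]

theorem Represents.positive {pm p₀ p : Coeff} {Dp Dm D₀ : Diagram}
    (h : Diagram.SkeinTriple Dp Dm D₀) (hm : Represents pm Dm) (h₀ : Represents p₀ D₀)
    (hp : aPow 1 * p - aPow (-1) * pm = zVar * p₀) : Represents p Dp := by
  intro M q hq
  have h1 := stateSum_skein (zero_lt_one.trans hq) M h
  have h2 := congrArg (evalAt (M + 1) hq) hp
  simp only [map_sub, map_mul, evalAt_aPow, evalAt_zVar, zpow_one, zpow_neg] at h2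
  rw [hm M q hq, h₀ M q hq] at h1
  refine mul_left_cancel₀ (pow_pos (zero_lt_one.trans hq) (M + 1)).ne' ?_
  linear_combination h1 - qInt (M + 1) q * h2

theorem Represents.negative {pp p₀ p : Coeff} {Dp Dm D₀ : Diagram}
    (h : Diagram.SkeinTriple Dp Dm D₀) (hm : Represents pp Dp) (h₀ : Represents p₀ D₀)
    (hp : aPow 1 * pp - aPow (-1) * p = zVar * p₀) : Represents p Dm := by
  intro M q hq
  have h1 := stateSum_skein (zero_lt_one.trans hq) M h
  have h2 := congrArg (evalAt (M + 1) hq) hp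
  simp only [map_sub, map_mul, evalAt_aPow, evalAt_zVar, zpow_one, zpow_neg] at h2
  rw [hm M q hq, h₀ M q hq] at h1
  refine mul_left_cancel₀ (inv_pos.2 (pow_pos (zero_lt_one.trans hq) (M + 1))).ne' ?_
  linear_combination - h1 + qInt (M + 1) q * h2

theorem aPow_mul_aPow (m n : ℤ) : aPow m * aPow n = aPow (m + n) :=
  (LaurentPolynomial.T_add m n).symm

theorem aPow_zero : aPow 0 = 1 := rfl

/-- The inverse of `z`. -/
noncomputable def zInv : Coeff := LaurentPolynomial.C (LaurentPolynomial.T (-1))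

theorem zVar_mul_zInv : zVar * zInv = 1 := by
  rw [zVar, zInv, ← map_mul, ← LaurentPolynomial.T_add]
  simp

theorem zVar_mul_cancel {p p' : Coeff} (h : zVar * p = zVar * p') : p = p' := by
  rw [← one_mul p, ← one_mul p', ← zVar_mul_zInv, mul_comm zVar, mul_assoc, h, mul_assoc]

/-- The factor `(a - a⁻¹) z⁻¹` of the HOMFLY-PT polynomial for each further circle. -/
noncomputable def circleFactor : Coeff := (aPow 1 - aPow (-1)) * zInv

theorem zVar_mul_circleFactor : zVar * circleFactor = aPow 1 - aPow (-1) := by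
  rw [circleFactor, mul_left_comm, zVar_mul_zInv, mul_one]

theorem evalAt_circleFactor (hq : 1 < q) : evalAt N hq circleFactor = qInt N q := by
  have h := congrArg (evalAt N hq) zVar_mul_circleFactor
  simp only [map_sub, map_mul, evalAt_aPow, evalAt_zVar, zpow_one, zpow_neg] at h
  rw [qInt, eq_div_iff (sub_inv_pos hq).ne', ← h, mul_comm]

theorem represents_unlink {D : Diagram} {ds : List Bool} (hds : ds ≠ [])
    (hD : D.word = ds.flatMap fun d => [cup 0 d, cap 0 d]) :
    Represents (circleFactor ^ (ds.length - 1)) D := by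
  intro M q hq
  rw [stateSum, hD, wordOp_unlink hq, map_pow, evalAt_circleFactor, mul_one, ← pow_succ',
    Nat.sub_add_cancel (List.length_pos_of_ne_nil hds)]

theorem aPow_skein_solve_pos (pm p₀ : Coeff) :
    aPow 1 * (aPow (-1) * (aPow (-1) * pm + zVar * p₀)) - aPow (-1) * pm = zVar * p₀ := by
  rw [← mul_assoc, aPow_mul_aPow, add_neg_cancel, aPow_zero]
  ring

theorem aPow_skein_solve_neg (pp p₀ : Coeff) :
    aPow 1 * pp - aPow (-1) * (aPow 1 * (aPow 1 * pp - zVar * p₀)) = zVar * p₀ := by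
  rw [← mul_assoc (aPow (-1)), aPow_mul_aPow, neg_add_cancel, aPow_zero]
  ring

/-- The skein relation can be solved for either crossing because `a` is invertible, and it holds for
the state sums. -/
theorem exists_represents (D : Diagram) (hD : D.word ≠ []) : ∃ p, Represents p D := by
  refine Diagram.resolution (fun D => ∃ p, Represents p D) ?_ ?_ ?_ ?_ D hD
  · rintro D E h ⟨p, hp⟩
    exact ⟨p, (represents_iff_of_isotopic h).1 hp⟩
  · rintro Dp Dm D₀ h ⟨pm, hm⟩ ⟨p₀, h₀⟩
    exact ⟨_, hm.positive h h₀ (aPow_skein_solve_pos pm p₀)⟩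
  · rintro Dp Dm D₀ h ⟨pp, hp⟩ ⟨p₀, h₀⟩
    exact ⟨_, hp.negative h h₀ (aPow_skein_solve_neg pp p₀)⟩
  · intro D ds hds hD
    exact ⟨_, represents_unlink hds hD⟩

theorem Diagram.SkeinTriple.ne_nil {Dp Dm D₀ : Diagram} (h : Diagram.SkeinTriple Dp Dm D₀) :
    Dp.word ≠ [] ∧ Dm.word ≠ [] ∧ D₀.word ≠ [] := by
  obtain ⟨u, p, m, o, v, h, hp, hm, ho⟩ := h
  rw [hp, hm, ho]
  exact h.ne_nil (hp ▸ Dp.closed)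

theorem exists_isHomfly : ∃ P, IsHomfly P := by
  classical
  -- By `exists_represents`, at most the empty diagram receives the default value.
  let P : Diagram → Coeff := fun D => if h : ∃ p, Represents p D then h.choose else 1
  have key : ∀ {D : Diagram} {p : Coeff}, Represents p D → P D = p := by
    intro D p hp
    have h : ∃ p, Represents p D := ⟨p, hp⟩
    have : P D = h.choose := dif_pos h
    rw [this]
    exact h.choose_spec.unique hp
  refine ⟨P, ?_, ?_, ?_⟩
  · intro D E h
    by_cases hD : ∃ p, Represents p D
    · obtain ⟨p, hp⟩ := hD
      rw [key hp, key ((represents_iff_of_isotopic h).1 hp)]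
    · have hE : ¬ ∃ p, Represents p E := by simpa only [represents_iff_of_isotopic h] using hD
      simp only [P, dif_neg hD, dif_neg hE]
  · intro D d hD
    exact key (by simpa using represents_unlink (ds := [d]) (by simp) (by simpa using hD))
  · intro Dp Dm D₀ h
    obtain ⟨pm, hm⟩ := exists_represents Dm h.ne_nil.2.1
    obtain ⟨p₀, h₀⟩ := exists_represents D₀ h.ne_nil.2.2
    rw [key hm, key h₀, key (hm.positive h h₀ (aPow_skein_solve_pos pm p₀))]
    exact aPow_skein_solve_pos pm p₀

theorem isHomfly_homfly : IsHomfly homfly := Classical.epsilon_spec exists_isHomfly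

end StateSum

/-! ### The HOMFLY-PT polynomial of an unlink -/

section Unlink

theorem runs_circle (d : Bool) : Runs [] [cup 0 d, cap 0 d] [] :=
  .append (w := [_]) (w' := [_]) (b := [d, !d])
    (.single [] [] rfl (by simp [Piece.dom]) (by simp [Piece.cod]))
    (.single [] [] rfl (by simp [Piece.dom]) (by simp [Piece.cod]))

theorem runs_twisted_circle (d s : Bool) :
    Runs [] [cup 0 d, cross 0 d (!d) s, cap 0 (!d)] [] :=
  .append (w := [_]) (w' := [_, _]) (b := [d, !d])
    (.single [] [] rfl (by simp [Piece.dom]) (by simp [Piece.cod]))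
    (.append (w := [_]) (w' := [_]) (b := [!d, d])
      (.single [] [] rfl (by simp [Piece.dom]) (by simp [Piece.cod]))
      (.single [] [] rfl (by simp [Piece.dom]) (by simp [Piece.cod])))

theorem runs_unlink (ds : List Bool) : Runs [] (ds.flatMap fun d => [cup 0 d, cap 0 d]) [] := by
  induction ds with
  | nil => exact .nil _
  | cons d ds ih => exact (runs_circle d).append ih

variable {w : List Event} (hw : Runs [] w [])

theorem isotopic_twisted_circle (d s : Bool) :
    Diagram.Isotopic ⟨_, (runs_twisted_circle d s).append hw⟩ ⟨_, (runs_circle (!d)).append hw⟩ :=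
  .rel _ _ ⟨[], _, _, cap 0 (!d) :: w, .reidemeister1Cup 0 d s, by simp, by simp⟩

theorem isotopic_circle_not (d : Bool) :
    Diagram.Isotopic ⟨_, (runs_circle d).append hw⟩ ⟨_, (runs_circle (!d)).append hw⟩ :=
  .trans _ _ _ (.symm _ _ (.rel _ _
    ⟨[cup 0 d], _, _, w, .reidemeister1Cap 0 d true, by simp, by simp⟩))
    (isotopic_twisted_circle hw d true)

theorem IsHomfly.append_circle {P : Diagram → Coeff} (hP : IsHomfly P) (d e : Bool) :
    P ⟨_, (runs_circle d).append ((runs_circle e).append hw)⟩ =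
      circleFactor * P ⟨_, (runs_circle e).append hw⟩ := by
  have key : ∀ d, P ⟨_, (runs_circle d).append ((runs_circle (!d)).append hw)⟩ =
      circleFactor * P ⟨_, (runs_circle (!d)).append hw⟩ := by
    intro d
    -- The two figure-eight curves of opposite sign are both isotopic to a circle, and their common
    -- smoothing is a pair of circles.
    have h := hP.skein ⟨_, (runs_twisted_circle d false).append hw⟩
      ⟨_, (runs_twisted_circle d true).append hw⟩
      ⟨_, (runs_circle d).append ((runs_circle (!d)).append hw)⟩
      ⟨[cup 0 d], _, _, _, cap 0 (!d) :: w, .antiparallel 0 d, by simp, by simp, by simp⟩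
    rw [hP.isotopy _ _ (isotopic_twisted_circle hw d false),
      hP.isotopy _ _ (isotopic_twisted_circle hw d true), ← sub_mul, ← zVar_mul_circleFactor,
      mul_assoc] at h
    exact (zVar_mul_cancel h).symm
  by_cases hde : e = d
  · subst hde
    have := key (!e)
    simp only [Bool.not_not] at this
    rw [hP.isotopy _ _ (isotopic_circle_not ((runs_circle e).append hw) e)]
    exact this
  · obtain rfl := Bool.eq_not_of_ne hde
    exact key d

theorem IsHomfly.unlink {P : Diagram → Coeff} (hP : IsHomfly P) (d : Bool) (ds : List Bool) :
    P ⟨_, runs_unlink (d :: ds)⟩ = circleFactor ^ ds.length := by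
  induction ds generalizing d with
  | nil => exact hP.unknot _ d rfl
  | cons e ds ih =>
    rw [List.length_cons, pow_succ', ← ih e]
    exact hP.append_circle (runs_unlink ds) d e

/-- The defining properties suffice for the resolution argument, so the choice made by `epsilon` is
irrelevant on nonempty diagrams. -/
theorem represents_homfly (D : Diagram) (hD : D.word ≠ []) : Represents (homfly D) D := by
  refine Diagram.resolution (fun D => Represents (homfly D) D) ?_ ?_ ?_ ?_ D hD
  · intro D E h hD
    rw [← isHomfly_homfly.isotopy _ _ h]
    exact (represents_iff_of_isotopic h).1 hD
  · intro Dp Dm D₀ h hm h₀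
    exact hm.positive h h₀ (isHomfly_homfly.skein _ _ _ h)
  · intro Dp Dm D₀ h hp h₀
    exact hp.negative h h₀ (isHomfly_homfly.skein _ _ _ h)
  · rintro ⟨w, h⟩ ds hds rfl
    cases ds with
    | nil => exact absurd rfl hds
    | cons d ds =>
      rw [isHomfly_homfly.unlink d ds]
      simpa using represents_unlink hds rfl

end Unlink

open Filter Topology

/-! ### The HOMFLY-PT bound -/

section Bound

variable {N : ℕ} {q : ℝ}

theorem cuspWeight_pos (hq : 1 < q) (i : Fin N) : 0 < cuspWeight q i :=
  zpow_pos (zero_lt_one.trans hq) _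

theorem cuspWeight_le (hq : 1 < q) (i : Fin N) : cuspWeight q i ≤ q ^ N := by
  rw [cuspWeight, ← zpow_natCast q N]
  exact zpow_le_zpow_right₀ hq.le (by have := i.2; omega)

theorem cuspWeight_inv_le (hq : 1 < q) (i : Fin N) : (cuspWeight q i)⁻¹ ≤ q ^ N := by
  rw [cuspWeight, ← zpow_natCast q N, ← zpow_neg]
  exact zpow_le_zpow_right₀ hq.le (by omega)

theorem cuspWeight_mono (hq : 1 < q) {i j : Fin N} (h : i ≤ j) :
    cuspWeight q i ≤ cuspWeight q j := by
  have : (i : ℕ) ≤ j := h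
  exact zpow_le_zpow_right₀ hq.le (by omega)

theorem one_le_label_factor (hq : 1 < q) (N : ℕ) : 1 ≤ q * (N + 1) := by
  have := N.cast_nonneg (α := ℝ)
  nlinarith

theorem abs_sum_le_card_mul {ι : Type*} [Fintype ι] {g : ι → ℝ} {C : ℝ} (h : ∀ i, |g i| ≤ C) :
    |∑ i, g i| ≤ Fintype.card ι * C := by
  refine (Finset.abs_sum_le_sum_abs _ _).trans ?_
  simpa using Finset.sum_le_card_nsmul Finset.univ _ C fun i _ => h i

/-- At a front crossing the descending strand is over, so the sign is positive exactly when the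
directions agree; this is the value `x == y` of the flag. For antiparallel strands with nontrivial
weights it restricts the sum to `i < k`, where the ratio of the weights of `i` and `k` is at most
`1`. The opposite crossing would allow ratios up to `q ^ (2 * N - 2)`. -/
theorem abs_smoothTerm_le (hq : 1 < q) {x y : Bool} {f : Stream' (Fin N) → ℝ} {B : ℝ}
    (hf : ∀ σ, |f σ| ≤ B) (i j : Fin N) (τ : Stream' (Fin N)) :
    |smoothTerm q x y (x == y) f i j τ| ≤ N * B := by
  have hB : 0 ≤ B := (abs_nonneg _).trans (hf τ)
  have hN : (1 : ℝ) ≤ N := by exact_mod_cast Nat.succ_le_of_lt (i.pos)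
  unfold smoothTerm
  split_ifs with h1 h2 h3
  · exact (hf _).trans (le_mul_of_one_le_left hB hN)
  · rw [abs_zero]; positivity
  · have := abs_sum_le_card_mul (g := fun k => if labelLT (x == (x == y)) k i then
      capWeight q x k * cupWeight q (!x) i * f (Stream'.cons k (Stream'.cons k τ)) else 0)
      (C := B) fun k => by
        obtain rfl := Bool.eq_not_of_ne (Ne.symm h1)
        split_ifs with hk
        · cases x
          · simpa [capWeight, cupWeight] using hf _
          · have hik : i < k := by simpa [labelLT] using hk
            have h4 : |(cuspWeight q k)⁻¹ * cuspWeight q i| ≤ 1 := by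
              rw [abs_of_nonneg (mul_nonneg (inv_nonneg.2 (cuspWeight_pos hq k).le)
                (cuspWeight_pos hq i).le)]
              exact inv_mul_le_one_of_le₀ (cuspWeight_mono hq hik.le) (cuspWeight_pos hq k).le
            have h5 : capWeight q true k * cupWeight q (!true) i =
              (cuspWeight q k)⁻¹ * cuspWeight q i := rfl
            rw [h5, abs_mul]
            exact (mul_le_mul h4 (hf _) (abs_nonneg _) zero_le_one).trans_eq (one_mul B)
        · simpa using hB
    simpa using this
  · rw [abs_zero]; positivity

/-- The size of the operators of pieces of fronts. -/
theorem abs_pieceOp_le (hq : 1 < q) {p : Piece} (hp : ∀ x y s, p = .cross x y s → s = true)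
    {f : Stream' (Fin N) → ℝ} {B : ℝ} (hf : ∀ σ, |f σ| ≤ B) (σ : Stream' (Fin N)) :
    |pieceOp q p f σ| ≤ q * (N + 1) * (q ^ N) ^ (p.downCusp - p.sign) * B := by
  have hB : 0 ≤ B := (abs_nonneg _).trans (hf σ)
  have h1 := one_le_label_factor hq N
  have hqN : 0 < q ^ N := pow_pos (zero_lt_one.trans hq) N
  have hNB : (N : ℝ) ≤ q * (N + 1) := by
    have := N.cast_nonneg (α := ℝ)
    nlinarith
  cases p with
  | cup d =>
    have h2 : |cupWeight q d σ.head * f σ.tail.tail| ≤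
        q * (N + 1) * (q ^ N) ^ ((Piece.cup d).downCusp - (Piece.cup d).sign) * B := by
      rw [abs_mul]
      refine mul_le_mul ?_ (hf _) (abs_nonneg _) (by positivity)
      cases d
      · simp only [cupWeight, Piece.downCusp, Piece.sign, Bool.false_eq_true, if_false, sub_zero,
          zpow_one]
        rw [abs_of_pos (cuspWeight_pos hq _)]
        exact (cuspWeight_le hq _).trans (le_mul_of_one_le_left hqN.le h1)
      · simpa [cupWeight, Piece.downCusp, Piece.sign] using h1
    simp only [pieceOp]
    split_ifs
    · exact h2
    · rw [abs_zero]; exact (abs_nonneg _).trans h2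
  | cap d =>
    refine (abs_sum_le_card_mul (C := (q ^ N) ^ ((Piece.cap d).downCusp - (Piece.cap d).sign) * B)
      fun i => ?_).trans ?_
    · rw [abs_mul]
      refine mul_le_mul ?_ (hf _) (abs_nonneg _) (by positivity)
      cases d
      · simp [capWeight, Piece.downCusp, Piece.sign]
      · simp only [capWeight, Piece.downCusp, Piece.sign, if_true, sub_zero, zpow_one]
        rw [abs_of_pos (inv_pos.2 (cuspWeight_pos hq _))]
        exact cuspWeight_inv_le hq i
    · rw [Fintype.card_fin, mul_assoc]
      exact mul_le_mul_of_nonneg_right hNB (by positivity)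
  | cross x y s =>
    obtain rfl := hp x y s rfl
    have h2 : (if (x == y) then (q ^ N)⁻¹ else q ^ N) =
        (q ^ N) ^ ((Piece.cross x y true).downCusp - (Piece.cross x y true).sign) := by
      cases h : (x == y) <;> simp [Piece.downCusp, Piece.sign, h]
    have hq1 : q⁻¹ ≤ 1 := inv_le_one_of_one_le₀ hq.le
    have hq2 : 0 < q⁻¹ := inv_pos.2 (zero_lt_one.trans hq)
    have he : ((x == y) == true) = (x == y) := by cases (x == y) <;> rfl
    simp only [pieceOp, crossOp, he, h2]
    rw [abs_mul, abs_of_pos (zpow_pos hqN _), mul_assoc, mul_left_comm]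
    refine mul_le_mul_of_nonneg_left ?_ (zpow_pos hqN _).le
    refine (abs_add_le _ _).trans ?_
    rw [abs_mul, abs_mul]
    have h3 : |if σ.head = σ.tail.head then (if (x == y) then q else q⁻¹) else 1| ≤ q := by
      rw [abs_le]
      split_ifs <;> constructor <;> linarith
    have h4 : |if (x == y) then q - q⁻¹ else q⁻¹ - q| ≤ q := by
      rw [abs_le]
      split_ifs <;> constructor <;> linarith
    have h5 := mul_le_mul h3 (hf (Stream'.cons σ.tail.head (Stream'.cons σ.head σ.tail.tail)))
      (abs_nonneg _) (by linarith)
    have h6 := mul_le_mul h4 (abs_smoothTerm_le (x := x) (y := y) hq hf σ.head σ.tail.head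
      σ.tail.tail) (abs_nonneg _) (by linarith)
    calc _ ≤ q * B + q * (N * B) := add_le_add h5 h6
      _ = q * (N + 1) * B := by ring

theorem abs_lowerOp_le {T : (Stream' (Fin N) → ℝ) → Stream' (Fin N) → ℝ} {B C : ℝ}
    (hT : ∀ f : Stream' (Fin N) → ℝ, (∀ σ, |f σ| ≤ B) → ∀ σ, |T f σ| ≤ C) (k : ℕ)
    {f : Stream' (Fin N) → ℝ} (hf : ∀ σ, |f σ| ≤ B) (σ : Stream' (Fin N)) :
    |lowerOp k T f σ| ≤ C := by
  induction k generalizing f σ with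
  | zero => exact hT f hf σ
  | succ k ih => exact ih (fun _ => hf _) _

theorem abs_wordOp_le (hq : 1 < q) {w : List Event}
    (hw : ∀ k x y s, cross k x y s ∈ w → s = true)
    {f : Stream' (Fin N) → ℝ} {B : ℝ} (hf : ∀ σ, |f σ| ≤ B) (σ : Stream' (Fin N)) :
    |wordOp q w f σ| ≤ (q * (N + 1)) ^ w.length *
      (q ^ N) ^ ((w.map fun e => e.piece.downCusp).sum - (w.map fun e => e.piece.sign).sum) *
        B := by
  induction w generalizing f B with
  | nil => simpa [wordOp] using hf σ
  | cons e w ih =>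
    have hqN : 0 < q ^ N := pow_pos (zero_lt_one.trans hq) N
    have h := ih (fun k x y s h => hw k x y s (List.mem_cons_of_mem _ h))
      (f := eventOp q e f) (fun σ => abs_lowerOp_le (fun f hf => abs_pieceOp_le hq
        (fun x y s h => hw e.pos x y s (by rw [cross, ← h]; exact List.mem_cons_self)) hf)
        e.pos hf σ)
    refine h.trans_eq ?_
    simp only [List.length_cons, List.map_cons, List.sum_cons, add_sub_add_comm]
    rw [zpow_add₀ hqN.ne', pow_succ]
    ring

theorem abs_stateSum_le (hq : 1 < q) (M : ℕ) (F : Front) :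
    |stateSum M q F.toDiagram| ≤
      (q * ((M + 1 : ℕ) + 1)) ^ F.word.length * (q ^ (M + 1)) ^ (-F.sl) := by
  have := abs_wordOp_le (N := M + 1) hq F.descending_over (f := fun _ => 1) (B := 1)
    (fun _ => by simp) (Stream'.const 0)
  rw [Front.sl, Front.downCusps, Diagram.writhe, neg_sub]
  simpa [stateSum] using this

/-- The numerator is polynomial in `N` and `[N]` grows like `q ^ N`. This division accounts for the
summand `-1` in the bound. -/
theorem tendsto_bound (hq : 1 < q) (m : ℕ) :
    Tendsto (fun N : ℕ => (q * (N + 1)) ^ m / qInt N q) atTop (𝓝 0) := by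
  have hq0 := zero_lt_one.trans hq
  have hz := sub_inv_pos hq
  have hq1 : 0 < 1 - q⁻¹ := sub_pos.2 (inv_lt_one_of_one_lt₀ hq)
  have h1 : Tendsto (fun N : ℕ => ((N + 1 : ℕ) : ℝ) ^ m / q ^ (N + 1)) atTop (𝓝 0) :=
    (tendsto_pow_const_div_const_pow_of_one_lt m hq).comp (tendsto_add_atTop_nat 1)
  have h2 := h1.const_mul (q ^ m * q * ((q - q⁻¹) / (1 - q⁻¹)))
  rw [mul_zero] at h2
  refine squeeze_zero' (Eventually.of_forall fun N => ?_) ?_ h2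
  · rcases N.eq_zero_or_pos with rfl | hN
    · simp [qInt]
    · have := qInt_pos hq hN
      positivity
  · filter_upwards [eventually_gt_atTop 0] with N hN
    have h3 : 1 ≤ q ^ N := one_le_pow₀ hq.le
    have h4 : q ≤ q ^ N := le_self_pow₀ hq.le hN.ne'
    have h5 : (q ^ N)⁻¹ ≤ q ^ N * q⁻¹ :=
      (inv_le_one_of_one_le₀ h3).trans (by rw [← div_eq_mul_inv, one_le_div hq0]; exact h4)
    have h6 : q ^ N * ((1 - q⁻¹) / (q - q⁻¹)) ≤ qInt N q := by
      rw [qInt, ← mul_div_assoc]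
      exact div_le_div_of_nonneg_right (by linarith) hz.le
    have h7 : 0 < q ^ N * ((1 - q⁻¹) / (q - q⁻¹)) := by positivity
    refine (div_le_div_of_nonneg_left (by positivity) h7 h6).trans_eq ?_
    push_cast
    rw [mul_pow, pow_succ q N]
    field_simp

/-- The HOMFLY-PT bound. -/
theorem degree_homfly_le (F : Front) (hF : F.word ≠ []) :
    (homfly F.toDiagram).degree ≤ ((-F.sl - 1 : ℤ) : WithBot ℤ) := by
  by_cases h0 : homfly F.toDiagram = 0
  · rw [h0, LaurentPolynomial.degree_zero]; exact bot_le
  obtain ⟨d, hd, -⟩ := exists_degree_eq h0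
  rw [hd, WithBot.coe_le_coe]
  -- If `d ≥ -sl`, then `a ^ (-sl - d) ≤ 1`, and the normalized values tend to zero by
  -- `tendsto_bound`, although their limit `L` is nonzero.
  by_contra hlt
  obtain ⟨q, hq, L, hL, h⟩ := exists_tendsto_evalAt hd
  refine hL (tendsto_nhds_unique h ?_)
  refine squeeze_zero_norm' ?_ (tendsto_bound hq F.word.length)
  filter_upwards [eventually_gt_atTop 0] with N hN
  obtain ⟨M, rfl⟩ := Nat.exists_eq_succ_of_ne_zero hN.ne'
  have h1 := abs_stateSum_le hq M F
  have hN' := qInt_pos hq hN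
  have hqN : 0 < q ^ (M + 1) := pow_pos (zero_lt_one.trans hq) _
  rw [represents_homfly F.toDiagram hF M q hq, abs_mul, abs_of_pos hN'] at h1
  rw [Real.norm_eq_abs, abs_mul, abs_of_pos (zpow_pos hqN _), le_div_iff₀ hN', mul_right_comm,
    mul_comm |_|]
  refine (mul_le_mul_of_nonneg_right h1 (zpow_pos hqN _).le).trans ?_
  rw [mul_assoc, ← zpow_add₀ hqN.ne']
  refine mul_le_of_le_one_right (by have := one_le_label_factor hq (M + 1); positivity) ?_
  exact zpow_le_one_of_nonpos₀ (one_le_pow₀ hq.le) (by omega)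

end Bound

/-! ### Fronts -/

section Fronts

variable {N : ℕ} {q : ℝ}

/-- Lets fronts be compared through their operators, without exhibiting the intermediate diagrams of
an isotopy. -/
theorem homfly_eq_of_stateSum {D E : Diagram} (hD : D.word ≠ []) (hE : E.word ≠ [])
    (h : ∀ (M : ℕ) (q : ℝ), 1 < q → stateSum M q D = stateSum M q E) : homfly D = homfly E :=
  Represents.unique (D := D) (represents_homfly D hD) fun M q hq => by
    rw [h M q hq, represents_homfly E hE M q hq]

theorem homfly_skein_of_stateSum {Dp Dm D₀ : Diagram} (hp : Dp.word ≠ []) (hm : Dm.word ≠ [])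
    (h₀ : D₀.word ≠ []) (h : ∀ (M : ℕ) (q : ℝ), 1 < q →
      q ^ (M + 1) * stateSum M q Dp - (q ^ (M + 1))⁻¹ * stateSum M q Dm =
        (q - q⁻¹) * stateSum M q D₀) :
    aPow 1 * homfly Dp - aPow (-1) * homfly Dm = zVar * homfly D₀ := by
  refine evalAt_injective fun N q hq hN => ?_
  obtain ⟨M, rfl⟩ := Nat.exists_eq_add_one_of_ne_zero hN.ne'
  have h1 := h M q hq
  rw [represents_homfly Dp hp M q hq, represents_homfly Dm hm M q hq,
    represents_homfly D₀ h₀ M q hq] at h1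
  simp only [map_sub, map_mul, evalAt_aPow, evalAt_zVar, zpow_one, zpow_neg]
  refine mul_left_cancel₀ (qInt_pos hq hN).ne' ?_
  linear_combination h1

theorem wordOp_legendrianMove (hq : 0 < q) {l r : List Event} (h : LegendrianMove l r)
    (f : Stream' (Fin N) → ℝ) : wordOp q l f = wordOp q r f := by
  cases h with
  | exchange l r h => exact wordOp_exchange q h f
  | reidemeister1Above k x =>
    -- The crossing slides from the lower branch of the right cusp to the upper one, where it forms
    -- a curl at the left cusp. Removing the curl leaves a zigzag.
    have h := eventOp_slideCap hq k (!x) x true (eventOp q (cup k (!x)) f)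
    have h' := eventOp_R1_cup hq k (!x) false f
    have h'' := eventOp_straighten₁ hq k x f
    simp only [Bool.not_not, Bool.not_true] at h h'
    rw [h'] at h
    exact h.trans h''
  | reidemeister1Below k x =>
    have h := eventOp_slideCup hq k x x false f
    have h' := eventOp_R1_cap hq (k + 1) (!x) false (eventOp q (cup k x) f)
    have h'' := eventOp_straighten₁ hq k x f
    simp only [Bool.not_not, Bool.not_false] at h h'
    rw [h] at h'
    exact h'.trans h''
  | reidemeister2Left₁ k d x => exact eventOp_slideCup₁ hq k d x true f
  | reidemeister2Left₂ k d x => exact eventOp_slideCup₂ hq k d x true f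
  | reidemeister2Right₁ k d x => exact eventOp_slideCap₁ hq k d x true f
  | reidemeister2Right₂ k d x => exact eventOp_slideCap₂ hq k d x true f
  | reidemeister3 k x y t => exact YangBaxter.of_not_cyclic hq (by simp) k f

/-- Sliding the strand of the negative tangle to the other branch of the cusp turns that tangle into
the positive one with its crossing changed, a crossing of parallel strands. -/
theorem wordOp_frontLocalSkein (hq : 0 < q) {p m o : List Event} (h : FrontLocalSkein p m o)
    (f : Stream' (Fin N) → ℝ) (σ : Stream' (Fin N)) :
    q ^ N * wordOp q p f σ - (q ^ N)⁻¹ * wordOp q m f σ = (q - q⁻¹) * wordOp q o f σ := by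
  cases h with
  | left₁ k d =>
    have h := eventOp_slideCup hq k d (!d) false f
    have h' := wordOp_skein_append hq (wordOp_skein hq (.parallel (k + 1) (!d))) [cup k d] [] f σ
    simp only [wordOp, List.cons_append, List.nil_append, Bool.not_false] at h h' ⊢
    rwa [h] at h'
  | left₂ k d =>
    have h := eventOp_slideCup hq k d d true f
    have h' := wordOp_skein_append hq (wordOp_skein hq (.parallel k d)) [cup (k + 1) d] [] f σ
    simp only [wordOp, List.cons_append, List.nil_append, Bool.not_true] at h h' ⊢
    rwa [← h] at h'
  | right₁ k d =>
    have h := eventOp_slideCap hq k d (!d) false f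
    have h' := wordOp_skein_append hq (wordOp_skein hq (.parallel (k + 1) (!d))) [] [cap k d] f σ
    simp only [wordOp, List.cons_append, List.nil_append, Bool.not_false] at h h' ⊢
    rwa [h] at h'
  | right₂ k d =>
    have h := eventOp_slideCap hq k d d true f
    have h' := wordOp_skein_append hq (wordOp_skein hq (.parallel k d)) [] [cap (k + 1) d] f σ
    simp only [wordOp, List.cons_append, List.nil_append, Bool.not_true] at h h' ⊢
    rwa [← h] at h'

/-- The contribution of an event to the self-linking number. -/
def Event.sl (e : Event) : ℤ := e.piece.sign - e.piece.downCusp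

theorem Front.sl_eq (F : Front) : F.sl = (F.word.map Event.sl).sum := by
  rw [Front.sl, Diagram.writhe, Front.downCusps]
  induction F.word with
  | nil => rfl
  | cons e w ih =>
    simp only [List.map_cons, List.sum_cons, ← ih, Event.sl]
    ring

theorem LegendrianMove.sl_eq {l r : List Event} (h : LegendrianMove l r) :
    (l.map Event.sl).sum = (r.map Event.sl).sum := by
  cases h with
  | exchange l r h => cases h; simp [Event.sl, add_comm]
  | reidemeister1Above k x => cases x <;> rfl
  | reidemeister1Below k x => cases x <;> rfl
  | reidemeister2Left₁ k d x => cases d <;> cases x <;> rfl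
  | reidemeister2Left₂ k d x => cases d <;> cases x <;> rfl
  | reidemeister2Right₁ k d x => cases d <;> cases x <;> rfl
  | reidemeister2Right₂ k d x => cases d <;> cases x <;> rfl
  | reidemeister3 k x y t => simp [Event.sl]; ring

theorem FrontLocalSkein.sl_eq {p m o : List Event} (h : FrontLocalSkein p m o) :
    (p.map Event.sl).sum = (o.map Event.sl).sum + 1 ∧
      (m.map Event.sl).sum = (o.map Event.sl).sum - 1 := by
  cases h with
  | left₁ k d => cases d <;> exact ⟨rfl, rfl⟩
  | left₂ k d => cases d <;> exact ⟨rfl, rfl⟩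
  | right₁ k d => cases d <;> exact ⟨rfl, rfl⟩
  | right₂ k d => cases d <;> exact ⟨rfl, rfl⟩

theorem Zigzag.sl_eq {down : Bool} {l : List Event} (h : Zigzag down l) :
    (l.map Event.sl).sum = if down then -2 else 0 := by
  cases h <;> cases down <;> rfl

theorem Zigzag.linkMove {down : Bool} {l : List Event} (h : Zigzag down l) : LinkMove l [] := by
  cases h with
  | above k => simpa using LinkMove.straighten₁ k (!down)
  | below k => exact .straighten₂ k down

theorem LegendrianMove.nil_iff {u l r v : List Event} (h : LegendrianMove l r)
    (hl : Runs [] (u ++ l ++ v) []) : u ++ l ++ v = [] ↔ u ++ r ++ v = [] := by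
  have hl' : l ≠ [] := by
    rintro rfl
    cases h with
    | exchange l r h => cases h
  simp only [List.append_eq_nil_iff, hl', and_false, false_and, false_iff, not_and, and_imp]
  rintro rfl rfl rfl
  simp only [List.nil_append, List.append_nil] at hl
  cases h with
  | exchange l r h => cases h
  | reidemeister1Above k x =>
    obtain ⟨u, v, rfl, h, h'⟩ := hl.cons_inv
    obtain ⟨rfl, rfl⟩ : u = [] ∧ v = [] := by simpa [Piece.dom] using h.symm
    obtain ⟨u, v, h1, h2, -⟩ := h'.cons_inv
    have := congrArg List.length h2
    simp [Piece.dom, Piece.cod] at this h1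
    omega
  | reidemeister1Below k x =>
    obtain ⟨u, v, h1, h, -⟩ := hl.cons_inv
    obtain ⟨rfl, rfl⟩ : u = [] ∧ v = [] := by simpa [Piece.dom] using h.symm
    simp at h1

theorem Front.Isotopic.nil_iff {F G : Front} (h : F.Isotopic G) : F.word = [] ↔ G.word = [] := by
  induction h with
  | rel F G h =>
    obtain ⟨u, l, r, v, h, hF, hG⟩ := h
    rw [hF, hG]
    exact h.nil_iff (hF ▸ F.closed)
  | refl => rfl
  | symm _ _ _ ih => exact ih.symm
  | trans _ _ _ _ _ ih ih' => exact ih.trans ih'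

theorem Front.Isotopic.sl_eq {F G : Front} (h : F.Isotopic G) : F.sl = G.sl := by
  induction h with
  | rel F G h =>
    obtain ⟨u, l, r, v, h, hF, hG⟩ := h
    simp [Front.sl_eq, hF, hG, h.sl_eq]
  | refl => rfl
  | symm _ _ _ ih => exact ih.symm
  | trans _ _ _ _ _ ih ih' => exact ih.trans ih'

theorem Front.Isotopic.stateSum_eq (hq : 0 < q) (M : ℕ) {F G : Front} (h : F.Isotopic G) :
    stateSum M q F.toDiagram = stateSum M q G.toDiagram := by
  induction h with
  | rel F G h =>
    obtain ⟨u, l, r, v, h, hF, hG⟩ := h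
    simp only [stateSum, hF, hG, wordOp_append, wordOp_legendrianMove hq h]
  | refl => rfl
  | symm _ _ _ ih => exact ih.symm
  | trans _ _ _ _ _ ih ih' => exact ih.trans ih'

theorem Front.Isotopic.homfly_eq {F G : Front} (h : F.Isotopic G) (hF : F.word ≠ []) :
    homfly F.toDiagram = homfly G.toDiagram :=
  homfly_eq_of_stateSum hF (mt h.nil_iff.2 hF) fun M _ hq =>
    h.stateSum_eq (zero_lt_one.trans hq) M

theorem Runs.zigzag_inv {down : Bool} {l : List Event} {a b : List Bool} (h : Zigzag down l)
    (hl : Runs a l b) : a = b := by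
  cases h with
  | above k =>
    obtain ⟨u, v, rfl, rfl, h⟩ := hl.cons_inv
    obtain ⟨u', v', h1, h2, rfl⟩ := h.single_inv
    have h3 : (u ++ [!down]) ++ ([down] ++ v) = u' ++ ([down, !down] ++ v') := by
      simpa [Piece.dom, Piece.cod] using h2
    obtain ⟨rfl, h4⟩ := List.append_inj h3 (by simpa using h1)
    obtain rfl : v = (!down) :: v' := by simpa using h4
    simp [Piece.dom, Piece.cod]
  | below k =>
    obtain ⟨u, v, h1, rfl, h⟩ := hl.cons_inv
    obtain ⟨u', v', rfl, h2, rfl⟩ := h.single_inv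
    obtain ⟨u'', x, rfl⟩ : ∃ u'' x, u = u'' ++ [x] := by
      rcases List.eq_nil_or_concat u with rfl | ⟨u'', x, rfl⟩
      · simp at h1
      · exact ⟨u'', x, by simp⟩
    have h3 : u'' ++ ([x, !down] ++ (down :: v)) = u' ++ ([down, !down] ++ v') := by
      simpa [Piece.dom, Piece.cod] using h2
    obtain ⟨rfl, h4⟩ := List.append_inj h3 (by simpa using h1.symm)
    obtain ⟨rfl, rfl⟩ : x = down ∧ down :: v = v' := by simpa using h4
    simp [Piece.dom, Piece.cod]

/-- Straightening a zigzag of a front. -/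
theorem Front.exists_straightened {F : Front} {down : Bool} {u l v : List Event}
    (h : Zigzag down l) (hF : F.word = u ++ l ++ v) : ∃ G : Front, G.word = u ++ v := by
  have hr := F.closed
  rw [hF] at hr
  obtain ⟨b, hul, hv⟩ := hr.append_inv
  obtain ⟨a, hu, hl⟩ := hul.append_inv
  obtain rfl := hl.zigzag_inv h
  refine ⟨⟨⟨u ++ v, hu.append hv⟩, fun k x y s hs => F.descending_over k x y s ?_⟩, rfl⟩
  rw [hF]
  rcases List.mem_append.1 hs with hs | hs <;> simp [hs]

theorem Front.EliminatesZigzag.isotopic {F G : Front} {down : Bool}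
    (h : F.EliminatesZigzag down G) : F.toDiagram.Isotopic G.toDiagram := by
  obtain ⟨u, l, v, h, hF, hG⟩ := h
  exact .rel _ _ ⟨u, l, [], v, h.linkMove, hF, by simpa using hG⟩

theorem Front.EliminatesZigzag.sl_eq {F G : Front} {down : Bool}
    (h : F.EliminatesZigzag down G) : F.sl = G.sl + if down then -2 else 0 := by
  obtain ⟨u, l, v, h, hF, hG⟩ := h
  simp only [Front.sl_eq, hF, hG, List.map_append, List.sum_append, h.sl_eq]
  ring

end Fronts

/-! ### The critical coefficient modulo two -/

section Parity

open LaurentPolynomial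

/-- The reduction modulo two of the value at `z = 1`. -/
noncomputable def parity : ℤ[T;T⁻¹] →+* ZMod 2 := eval₂ (Int.castRingHom (ZMod 2)) 1

/-- The parity of the coefficient of `a ^ (- sl - 1)` in the HOMFLY-PT polynomial. -/
noncomputable def Front.criticalParity (F : Front) : ZMod 2 :=
  parity ((homfly F.toDiagram).coeff (-F.sl - 1))

theorem coeff_aPow_mul (p : Coeff) (m n : ℤ) : (aPow m * p).coeff n = p.coeff (n - m) :=
  coeff_T_mul p m n

theorem parity_coeff_zVar_mul (p : Coeff) (n : ℤ) :
    parity ((zVar * p).coeff n) = parity (p.coeff n) := by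
  rw [zVar, coeff_C_mul, map_mul]
  simp [parity]

theorem parity_coeff_zInv_mul (p : Coeff) (n : ℤ) :
    parity ((zInv * p).coeff n) = parity (p.coeff n) := by
  rw [zInv, coeff_C_mul, map_mul]
  simp [parity]

/-- The leading term in `a` of `((a - a⁻¹) / z) ^ n` is `a ^ n * z ^ (-n)`, and `z` is set to `1`.
-/
theorem parity_coeff_circleFactor_pow (n : ℕ) :
    (∀ m : ℤ, n < m → parity ((circleFactor ^ n).coeff m) = 0) ∧
      parity ((circleFactor ^ n).coeff n) = 1 := by
  have key : ∀ (p : Coeff) (m : ℤ), parity ((circleFactor * p).coeff m) =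
      parity (p.coeff (m - 1)) - parity (p.coeff (m + 1)) := by
    intro p m
    rw [circleFactor, mul_assoc, sub_mul, AddMonoidAlgebra.coeff_sub, Finsupp.sub_apply, map_sub,
      coeff_aPow_mul, coeff_aPow_mul, parity_coeff_zInv_mul, parity_coeff_zInv_mul, sub_neg_eq_add]
  induction n with
  | zero =>
    rw [pow_zero, ← aPow_zero]
    refine ⟨fun m hm => ?_, ?_⟩
    · have : (0 : ℤ) ≠ m := by simpa using hm.ne
      rw [aPow, T_apply, if_neg this, map_zero]
    · rw [aPow, Nat.cast_zero, T_apply, if_pos rfl, map_one]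
  | succ n ih =>
    rw [pow_succ']
    refine ⟨fun m hm => ?_, ?_⟩
    · push_cast at hm
      rw [key, ih.1 _ (by omega), ih.1 _ (by omega), sub_zero]
    · push_cast
      rw [key, add_sub_cancel_right, ih.2, ih.1 _ (by omega), sub_zero]

/-- The shifts of `sl` by `1` and `-1` compensate the factors `a` and `a⁻¹`, so all three critical
coefficients are read off at the same exponent `-sl(F₀) - 1` of the skein relation. The factor `z`
becomes `1`. -/
theorem Front.SkeinTriple.criticalParity {Fp Fm F₀ : Front} (h : Front.SkeinTriple Fp Fm F₀) :
    Fp.criticalParity - Fm.criticalParity = F₀.criticalParity := by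
  obtain ⟨u, p, m, o, v, h, hp, hm, ho⟩ := h
  have h1 : Fp.sl = F₀.sl + 1 := by
    simp only [Front.sl_eq, hp, ho, List.map_append, List.sum_append, h.sl_eq.1]; ring
  have h2 : Fm.sl = F₀.sl - 1 := by
    simp only [Front.sl_eq, hm, ho, List.map_append, List.sum_append, h.sl_eq.2]; ring
  have h3 := homfly_skein_of_stateSum (Dp := Fp.toDiagram) (Dm := Fm.toDiagram)
    (D₀ := F₀.toDiagram) (by rw [hp]; cases h <;> simp) (by rw [hm]; cases h <;> simp)
    (by rw [ho]; cases h <;> simp) fun M q hq => by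
      simp only [stateSum, hp, hm, ho]
      have hq' := zero_lt_one.trans hq
      exact wordOp_skein_append hq' (wordOp_frontLocalSkein hq' h) u v _ _
  have h4 := congrArg (fun p => parity (AddMonoidAlgebra.coeff p (-F₀.sl - 1))) h3
  simp only [AddMonoidAlgebra.coeff_sub, Finsupp.sub_apply, map_sub, coeff_aPow_mul,
    parity_coeff_zVar_mul] at h4
  rw [Front.criticalParity, Front.criticalParity, Front.criticalParity, h1, h2, ← h4]
  rw [show -(F₀.sl + 1) - 1 = -F₀.sl - 1 - 1 by ring,
    show -(F₀.sl - 1) - 1 = -F₀.sl - 1 - -1 by ring]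

theorem Front.Isotopic.criticalParity {F G : Front} (h : F.Isotopic G) (hF : F.word ≠ []) :
    F.criticalParity = G.criticalParity := by
  rw [Front.criticalParity, Front.criticalParity, h.homfly_eq hF, h.sl_eq]

/-- Straightening a downward zigzag keeps the polynomial and raises `sl` by two, so the bound for
the straightened front forces the critical coefficient of the original one to vanish. -/
theorem Front.IsPositiveStabilization.criticalParity {F : Front} (h : F.IsPositiveStabilization)
    (hF : F.word ≠ []) : F.criticalParity = 0 := by
  obtain ⟨G, hG, u, l, v, hl, hw⟩ := h
  obtain ⟨E, hE⟩ := Front.exists_straightened hl hw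
  have h : G.EliminatesZigzag true E := ⟨u, l, v, hl, hw, hE⟩
  have hG0 := mt hG.nil_iff.2 hF
  have hd := degree_homfly_le E (mt h.isotopic.nil_iff.2 hG0)
  rw [hG.criticalParity hF, Front.criticalParity, isHomfly_homfly.isotopy _ _ h.isotopic,
    coeff_eq_zero_of_degree_lt, map_zero]
  refine hd.trans_lt (WithBot.coe_lt_coe.2 ?_)
  rw [h.sl_eq]
  simp

theorem Front.IsStandardUnlink.nonempty {F : Front} (h : F.IsStandardUnlink) : F.word ≠ [] := by
  obtain ⟨G, hG, ds, hds, hw⟩ := h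
  rw [ne_eq, hG.nil_iff, hw]
  cases ds <;> simp at hds ⊢

/-- With `n` components `sl = -n`, so the critical exponent `n - 1` is the degree of `circleFactor ^
(n - 1)`. -/
theorem Front.IsStandardUnlink.criticalParity {F : Front} (h : F.IsStandardUnlink) :
    F.criticalParity = 1 := by
  have hF := h.nonempty
  obtain ⟨⟨⟨w, hr⟩, hw'⟩, hG, ds, hds, hw⟩ := h
  obtain rfl : w = _ := hw
  rw [hG.criticalParity hF]
  have hsl : ∀ ds : List Bool,
      ((ds.flatMap fun d => [cup 0 d, cap 0 d]).map Event.sl).sum = -ds.length := by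
    intro ds
    induction ds with
    | nil => rfl
    | cons d ds ih =>
      rw [List.flatMap_cons, List.map_append, List.sum_append, ih]
      cases d <;> simp [Event.sl, Piece.sign, Piece.downCusp]
  cases ds with
  | nil => exact absurd rfl hds
  | cons d ds =>
    rw [Front.criticalParity, Front.sl_eq, hsl, isHomfly_homfly.unlink d ds]
    simpa using (parity_coeff_circleFactor_pow ds.length).2

/-- Excludes the empty front, whose polynomial is not determined: it can have a skein tree only with
no unlink leaf. -/
theorem OrientedSkeinTree.unlinkLeaves_eq_zero {F : Front} (T : OrientedSkeinTree F)
    (hF : F.word = []) : T.unlinkLeaves = 0 := by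
  induction T with
  | unlinkLeaf F h => exact absurd hF h.nonempty
  | stabilizedLeaf F h => rfl
  | isotopy F G h T ih => exact ih (h.nil_iff.1 hF)
  | destabilize F G h T ih => exact ih (h.isotopic.nil_iff.1 hF)
  | skeinPositive Fp Fm F₀ h T T' ih ih' =>
    obtain ⟨u, p, m, o, v, h, hp, hm, ho⟩ := h
    rw [hp] at hF
    cases h <;> simp at hF
  | skeinNegative Fp Fm F₀ h T T' ih ih' =>
    obtain ⟨u, p, m, o, v, h, hp, hm, ho⟩ := h
    rw [hm] at hF
    cases h <;> simp at hF

theorem Front.SkeinTriple.ne_nil {Fp Fm F₀ : Front} (h : Front.SkeinTriple Fp Fm F₀) :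
    Fp.word ≠ [] ∧ Fm.word ≠ [] ∧ F₀.word ≠ [] := by
  obtain ⟨u, p, m, o, v, h, hp, hm, ho⟩ := h
  rw [hp, hm, ho]
  cases h <;> simp

/-- The critical coefficient has the parity of the number of unlinks in a skein tree. -/
theorem OrientedSkeinTree.criticalParity_eq {F : Front} (T : OrientedSkeinTree F)
    (hF : F.word ≠ []) : F.criticalParity = T.unlinkLeaves := by
  induction T with
  | unlinkLeaf F h => simpa [unlinkLeaves] using h.criticalParity
  | stabilizedLeaf F h => simpa [unlinkLeaves] using h.criticalParity hF
  | isotopy F G h T ih =>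
    rw [h.criticalParity hF, ih (mt h.nil_iff.2 hF), unlinkLeaves]
  | destabilize F G h T ih =>
    rw [unlinkLeaves, ← ih (mt h.isotopic.nil_iff.2 hF), Front.criticalParity,
      Front.criticalParity, isHomfly_homfly.isotopy _ _ h.isotopic, h.sl_eq]
    simp
  | skeinPositive Fp Fm F₀ h T T' ih ih' =>
    rw [unlinkLeaves, Nat.cast_add, ← ih h.ne_nil.2.1, ← ih' h.ne_nil.2.2, ← h.criticalParity]
    ring
  | skeinNegative Fp Fm F₀ h T T' ih ih' =>
    -- Here the relation reads `c(F₋) = c(F₊) - c(F₀)`; only modulo two is this a count of leaves.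
    rw [unlinkLeaves, Nat.cast_add, ← ih h.ne_nil.1, ← ih' h.ne_nil.2.2, ← h.criticalParity,
      CharTwo.sub_eq_add, ← add_assoc, CharTwo.add_self_eq_zero, zero_add]

theorem OrientedSkeinTree.homflySharp {F : Front} (T : OrientedSkeinTree F)
    (hT : Odd T.unlinkLeaves) : F.HomflySharp := by
  have hF : F.word ≠ [] := by
    intro hF
    rw [T.unlinkLeaves_eq_zero hF] at hT
    exact absurd hT (by decide)
  refine le_antisymm (degree_homfly_le F hF) (not_lt.1 fun hlt => ?_)
  have h := T.criticalParity_eq hF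
  rw [Front.criticalParity, coeff_eq_zero_of_degree_lt hlt, map_zero, hT.natCast_zmod_two] at h
  exact zero_ne_one h

end Parity

end LegendrianFront

/-- If an odd number of terminal leaves of an oriented skein tree of a front `F` are standard
Legendrian unlinks, then the HOMFLY-PT polynomial bound on `sl` is sharp for `F`. -/
theorem theorem3p4 (F : LegendrianFront.Front) (T : LegendrianFront.OrientedSkeinTree F)
    (hT : Odd T.unlinkLeaves) : F.HomflySharp := T.homflySharp hT
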